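/- Let $\mathcal H$ be a right Hilbert space over the quaternions $\mathbb H$ with a fixed Hilbert basis $(b_i)$, and let left multiplication on $\mathcal H$ be the one induced by this basis, $s x=\sum_i b_i\, s\,\langle b_i,x\rangle$. Let $\mathbb S$ be the sphere of imaginary units, $\mathbb C_{\mathbb I}=\mathbb R+\mathbb I\,\mathbb R$ for $\mathbb I\in\mathbb S$, $[q]=\{\mathrm{Re}\,q+\mathbb J|\mathrm{Im}\,q| : \mathbb J\in\mathbb S\}$, $\tilde A=\bigcup_{q\in A}[q]$ the axially symmetric completion of $A\subset\mathbb H$, and $|[s]-[t]|=\inf\{|p-q| : p\in[s],\,q\in[t]\}$. For a bounded right linear operator $T$ on $\mathcal H$ the $S$-spectrum is $$\sigma_S(T)=\{s\in\mathbb H : T^2-2\,\mathrm{Re}(s)T+|s|^2\mathcal I\ \text{is not invertible}\},$$ and for $s\notin\sigma_S(T)$ put $Q_s(T)=(T^2-2\,\mathrm{Re}(s)T+|s|^2\mathcal I)^{-1}$, $S_L^{-1}(s,T)=-Q_s(T)(T-\bar s\,\mathcal I)$ and $S_R^{-1}(s,T)=-(T-\bar s\,\mathcal I)Q_s(T)$.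 Let $\mathbb I\in\mathbb S$ and let $\mathcal C\subset\mathbb C_{\mathbb I}$ be an exposed arc of $\sigma_S(T)$: a smooth open Jordan arc (a homeomorphic image $\gamma((0,1))$ under a continuously differentiable $\gamma$ with $\gamma'\ne0$) such that $\mathbb D\cap\sigma_S(T)=\mathcal C$ for some open disk $\mathbb D$ of $\mathbb C_{\mathbb I}$. Let $k\in\mathbb N$. Suppose that for each $s_0\in\mathcal C$ and each closed line segment $L\subset\mathbb C_{\mathbb I}$ through $s_0$ that is not tangent to $\mathcal C$ and satisfies $\tilde L\cap\sigma_S(T)=[s_0]$ there is a constant $K>0$ with $$\|S_L^{-1}(s,T)\|\le\exp\bigl(K\,|[s]-[s_0]|^{-k}\bigr)\qquad\text{for all } s\in\tilde L\setminus[s_0].$$ Then $T$ has a non-trivial hyperinvariant subspace: a closed right linear subspace $\mathcal M$ with $\{0\}\ne\mathcal M\ne\mathcal H$ and $B\mathcal M\subset\mathcal M$ for every bounded right linear operator $B$ that commutes with $T$. Moreover $\mathcal M$ can be chosen of the following form: for some compact subarc $\mathcal J=\gamma([t_1,t_2])$ of $\mathcal C$, $0<t_1<t_2<1$, $\mathcal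 M$ is the set of all $x\in\mathcal H$ for which $s\mapsto S_R^{-1}(s,T)x$ extends from $\mathbb H\setminus\sigma_S(T)$ to a left slice hyperholomorphic function on $\mathbb H\setminus\tilde{\mathcal J}$, that is, a function $f(u+\mathbb J v)=\alpha(u,v)+\mathbb J\beta(u,v)$ ($\mathbb J\in\mathbb S$) with differentiable $\mathcal H$-valued $\alpha,\beta$, $\alpha$ even and $\beta$ odd in $v$, $\partial_u\alpha=\partial_v\beta$ and $\partial_v\alpha=-\partial_u\beta$. -/

import Mathlib

open Set
open scoped Quaternion RightActions

/-- A right inner product space over the quaternions. The right multiplication `x <• q` is the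
action of the opposite ring; the inner product is conjugate linear in the first and right linear in
the second variable, and induces the norm. The real scalars act through their inclusion in `ℍ`. -/
class QInnerProductSpace (H : Type*) [NormedAddCommGroup H] [NormedSpace ℝ H]
    [Module ℍ[ℝ]ᵐᵒᵖ H] extends Inner ℍ[ℝ] H, IsScalarTower ℝ ℍ[ℝ]ᵐᵒᵖ H where
  star_inner : ∀ x y : H, star (inner x y) = inner y x
  inner_add_right : ∀ x y z : H, inner x (y + z) = inner x y + inner x z
  inner_rsmul_right : ∀ (x y : H) (q : ℍ[ℝ]), inner x (y <• q) = inner x y * q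
  inner_self : ∀ x : H, inner x x = ((‖x‖ ^ 2 : ℝ) : ℍ[ℝ])

/-- An orthonormal family whose right linear span is dense. -/
structure QHilbertBasis (ι H : Type*) [NormedAddCommGroup H] [NormedSpace ℝ H]
    [Module ℍ[ℝ]ᵐᵒᵖ H] [QInnerProductSpace H] where
  vec : ι → H
  inner_self_eq : ∀ i, inner ℍ[ℝ] (vec i) (vec i) = 1
  inner_eq_zero : ∀ i j, i ≠ j → inner ℍ[ℝ] (vec i) (vec j) = 0
  dense_span : Dense (Submodule.span ℍ[ℝ]ᵐᵒᵖ (range vec) : Set H)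

noncomputable section

namespace QInnerProductSpace

variable {H : Type*} [NormedAddCommGroup H] [NormedSpace ℝ H] [Module ℍ[ℝ]ᵐᵒᵖ H]
  [QInnerProductSpace H]

theorem inner_add_left (x y z : H) :
    inner ℍ[ℝ] (x + y) z = inner ℍ[ℝ] x z + inner ℍ[ℝ] y z := by
  rw [← star_inner, inner_add_right, star_add, star_inner, star_inner]

theorem inner_rsmul_left (x y : H) (q : ℍ[ℝ]) :
    inner ℍ[ℝ] (x <• q) y = star q * inner ℍ[ℝ] x y := by
  rw [← star_inner, inner_rsmul_right, star_mul, star_inner]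

theorem rsmul_coe (x : H) (r : ℝ) : x <• (r : ℍ[ℝ]) = r • x := by
  have h := smul_assoc r (1 : ℍ[ℝ]ᵐᵒᵖ) x
  rw [one_smul] at h
  rw [← h]
  congr 1
  apply MulOpposite.unop_injective
  simp [Algebra.smul_def]

theorem norm_rsmul (x : H) (q : ℍ[ℝ]) : ‖x <• q‖ = ‖x‖ * ‖q‖ := by
  have h := inner_self (x <• q)
  rw [inner_rsmul_right, inner_rsmul_left, inner_self, mul_assoc, Quaternion.coe_mul_eq_smul,
    mul_smul_comm, Quaternion.star_mul_self, Quaternion.normSq_eq_norm_mul_self] at h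
  have h2 : ‖x‖ ^ 2 * (‖q‖ * ‖q‖) = ‖x <• q‖ ^ 2 := by
    rw [← Quaternion.coe_smul] at h
    exact Quaternion.coe_injective h
  have : ‖x <• q‖ ^ 2 = (‖x‖ * ‖q‖) ^ 2 := by rw [← h2]; ring
  exact (pow_left_inj₀ (norm_nonneg _) (by positivity) two_ne_zero).1 this

/-- The real Hilbert space structure given by the real part of the inner product. -/
abbrev realInner : InnerProductSpace ℝ H where
  inner x y := (inner ℍ[ℝ] x y).re
  norm_sq_eq_re_inner x := by
    change _ = (inner ℍ[ℝ] x x).re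
    rw [inner_self, Quaternion.re_coe]
  conj_inner_symm x y := by
    change (inner ℍ[ℝ] y x).re = (inner ℍ[ℝ] x y).re
    rw [← star_inner]; simp
  add_left x y z := by
    change (inner ℍ[ℝ] (x + y) z).re = (inner ℍ[ℝ] x z).re + (inner ℍ[ℝ] y z).re
    rw [inner_add_left]; simp
  smul_left x y r := by
    change (inner ℍ[ℝ] (r • x) y).re = r * (inner ℍ[ℝ] x y).re
    rw [← rsmul_coe, inner_rsmul_left]; simp

theorem norm_inner_le (x y : H) : ‖inner ℍ[ℝ] x y‖ ≤ ‖x‖ * ‖y‖ := by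
  let _ : InnerProductSpace ℝ H := realInner
  set q := inner ℍ[ℝ] x y with hq
  have h1 : inner ℝ x (y <• star q) ≤ ‖x‖ * ‖y <• star q‖ := real_inner_le_norm _ _
  have h2 : inner ℝ x (y <• star q) = ‖q‖ * ‖q‖ := by
    change (inner ℍ[ℝ] x (y <• star q)).re = _
    rw [inner_rsmul_right, ← hq, Quaternion.self_mul_star, Quaternion.normSq_eq_norm_mul_self]
    simp
  rw [h2, norm_rsmul, norm_star] at h1
  by_cases h0 : ‖q‖ = 0
  · rw [h0]; positivity
  · have : 0 < ‖q‖ := lt_of_le_of_ne (norm_nonneg _) (Ne.symm h0)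
    nlinarith

theorem continuous_inner_right (x : H) : Continuous fun y : H => inner ℍ[ℝ] x y := by
  let f : H →+ ℍ[ℝ] := AddMonoidHom.mk' (fun y => inner ℍ[ℝ] x y) (inner_add_right x)
  exact AddMonoidHomClass.continuous_of_bound f ‖x‖ fun y => norm_inner_le x y

end QInnerProductSpace

namespace QHilbertBasis

open QInnerProductSpace

variable {ι H : Type*} [NormedAddCommGroup H] [NormedSpace ℝ H] [Module ℍ[ℝ]ᵐᵒᵖ H]
  [QInnerProductSpace H]

/-- `q ↦ bᵢ q` as a real linear isometry. -/
def coordLine (b : QHilbertBasis ι H) (i : ι) : ℍ[ℝ] →ₗᵢ[ℝ] H where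
  toFun q := b.vec i <• q
  map_add' p q := by rw [MulOpposite.op_add, add_smul]
  map_smul' r q := by
    rw [MulOpposite.op_smul, smul_assoc]; rfl
  norm_map' q := by
    have h := inner_self (b.vec i)
    rw [b.inner_self_eq] at h
    have h2 : (1 : ℝ) = ‖b.vec i‖ ^ 2 := Quaternion.coe_injective (by rw [← h]; rfl)
    have h3 : ‖b.vec i‖ = 1 := by nlinarith [norm_nonneg (b.vec i)]
    change ‖b.vec i <• q‖ = ‖q‖
    rw [norm_rsmul, h3, one_mul]

theorem isHilbertSum [CompleteSpace H] (b : QHilbertBasis ι H) :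
    letI : InnerProductSpace ℝ H := realInner
    IsHilbertSum ℝ (fun _ : ι => ℍ[ℝ]) b.coordLine := by
  let _ : InnerProductSpace ℝ H := realInner
  refine IsHilbertSum.mk ?_ ?_
  · intro i j hij p q
    change (inner ℍ[ℝ] (b.vec i <• p) (b.vec j <• q)).re = 0
    rw [inner_rsmul_right, inner_rsmul_left, b.inner_eq_zero i j hij]
    simp
  · intro x _
    refine (closure_mono ?_) (b.dense_span x)
    intro y hy
    induction hy using Submodule.span_induction with
    | mem y hy =>
      obtain ⟨i, rfl⟩ := hy
      exact Submodule.mem_iSup_of_mem i ⟨1, by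
        change b.vec i <• (1 : ℍ[ℝ]) = b.vec i
        simp⟩
    | zero => exact Submodule.zero_mem _
    | add x y _ _ hx hy => exact Submodule.add_mem _ hx hy
    | smul a x _ hx =>
      refine Submodule.iSup_induction _ (motive := fun x => a • x ∈ ((⨆ i,
        LinearMap.range (b.coordLine i).toLinearMap : Submodule ℝ H) : Set H)) hx ?_ ?_ ?_
      · rintro i _ ⟨q, rfl⟩
        refine Submodule.mem_iSup_of_mem i ⟨q * a.unop, ?_⟩
        change MulOpposite.op (q * a.unop) • b.vec i = a • MulOpposite.op q • b.vec i
        rw [smul_smul]; simp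
      · rw [smul_zero]; exact Submodule.zero_mem _
      · intro x y hx hy
        rw [smul_add]; exact Submodule.add_mem _ hx hy

/-- The identification of `H` with the square summable quaternionic families. -/
def coords [CompleteSpace H] (b : QHilbertBasis ι H) : H ≃ₗᵢ[ℝ] lp (fun _ : ι => ℍ[ℝ]) 2 :=
  letI : InnerProductSpace ℝ H := realInner
  b.isHilbertSum.linearIsometryEquiv

theorem coords_apply [CompleteSpace H] (b : QHilbertBasis ι H) (x : H) (i : ι) :
    b.coords x i = inner ℍ[ℝ] (b.vec i) x := by
  let _ : InnerProductSpace ℝ H := realInner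
  have h : HasSum (fun j => b.vec j <• (b.coords x j)) x := by
    have := b.isHilbertSum.hasSum_linearIsometryEquiv_symm (b.coords x)
    rwa [show b.isHilbertSum.linearIsometryEquiv.symm (b.coords x) = x from
      b.isHilbertSum.linearIsometryEquiv.symm_apply_apply x] at this
  let f : H →+ ℍ[ℝ] :=
    AddMonoidHom.mk' (fun y => inner ℍ[ℝ] (b.vec i) y) (inner_add_right (b.vec i))
  have h2 := h.map f (continuous_inner_right (b.vec i))
  have h3 : HasSum (f ∘ fun j => b.vec j <• (b.coords x j)) (b.coords x i) := by
    have h4 := hasSum_single (f := f ∘ fun j => b.vec j <• (b.coords x j)) i (by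
      intro j hj
      change inner ℍ[ℝ] (b.vec i) (b.vec j <• (b.coords x j)) = 0
      rw [inner_rsmul_right, b.inner_eq_zero i j hj.symm, zero_mul])
    have h5 : (f ∘ fun j => b.vec j <• (b.coords x j)) i = b.coords x i := by
      change inner ℍ[ℝ] (b.vec i) (b.vec i <• (b.coords x i)) = _
      rw [inner_rsmul_right, b.inner_self_eq, one_mul]
    rwa [h5] at h4
  exact h3.unique h2

/-- Left multiplication by `s` with respect to the Hilbert basis `b`, that is the bounded right
linear operator `x ↦ ∑ᵢ bᵢ s ⟨bᵢ, x⟩`. -/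
def leftMul [CompleteSpace H] (b : QHilbertBasis ι H) (s : ℍ[ℝ]) : H →L[ℍ[ℝ]ᵐᵒᵖ] H where
  toFun x := b.coords.symm (s • b.coords x)
  map_add' x y := by simp
  map_smul' a x := by
    apply b.coords.injective
    ext1
    funext i
    simp only [RingHom.id_apply, LinearIsometryEquiv.apply_symm_apply, lp.coeFn_smul,
      Pi.smul_apply, coords_apply, smul_eq_mul]
    have key : ∀ y : H, inner ℍ[ℝ] (b.vec i) (a • y) = inner ℍ[ℝ] (b.vec i) y * a.unop :=
      fun y => inner_rsmul_right (b.vec i) y a.unop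
    rw [key, key, ← coords_apply b (b.coords.symm _), LinearIsometryEquiv.apply_symm_apply]
    simp [coords_apply, mul_assoc]
  cont := by
    have : Continuous fun f : lp (fun _ : ι => ℍ[ℝ]) 2 => s • f := continuous_const_smul s
    exact b.coords.symm.continuous.comp (this.comp b.coords.continuous)

theorem hasSum_leftMul [CompleteSpace H] (b : QHilbertBasis ι H) (s : ℍ[ℝ]) (x : H) :
    HasSum (fun i => b.vec i <• (s * inner ℍ[ℝ] (b.vec i) x)) (b.leftMul s x) := by
  let _ : InnerProductSpace ℝ H := realInner
  have := b.isHilbertSum.hasSum_linearIsometryEquiv_symm (s • b.coords x)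
  simp only [lp.coeFn_smul, Pi.smul_apply, coords_apply, smul_eq_mul] at this
  exact this

end QHilbertBasis

/-- The sphere `𝕊` of quaternionic imaginary units. -/
def imagUnits : Set ℍ[ℝ] := {J | J.re = 0 ∧ ‖J‖ = 1}

/-- The class `[q] = {Re q + J |Im q| : J ∈ 𝕊}`. -/
def qClass (q : ℍ[ℝ]) : Set ℍ[ℝ] := {p | ∃ J ∈ imagUnits, p = (q.re : ℍ[ℝ]) + ‖q.im‖ • J}

/-- The axially symmetric completion of a set of quaternions. -/
def axialCompletion (A : Set ℍ[ℝ]) : Set ℍ[ℝ] := ⋃ q ∈ A, qClass q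

/-- The distance `|[s] - [t]|` of two classes. -/
def classDist (s t : ℍ[ℝ]) : ℝ :=
  sInf (Set.image2 (fun p q : ℍ[ℝ] => ‖p - q‖) (qClass s) (qClass t))

/-- The identification `u + i v ↦ u + I v` of `ℂ` with the slice `ℂ_I`. -/
def toSlice (I : ℍ[ℝ]) (z : ℂ) : ℍ[ℝ] := (z.re : ℍ[ℝ]) + z.im • I

section Operators

variable {ι H : Type*} [NormedAddCommGroup H] [NormedSpace ℝ H] [Module ℍ[ℝ]ᵐᵒᵖ H]
  [QInnerProductSpace H]

/-- `T² - 2 Re(s) T + |s|² 𝓘`. -/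
def pseudoResolventInv (T : H →L[ℍ[ℝ]ᵐᵒᵖ] H) (s : ℍ[ℝ]) : H →L[ℍ[ℝ]ᵐᵒᵖ] H :=
  T ^ 2 - (2 * s.re) • T + (‖s‖ ^ 2) • (1 : H →L[ℍ[ℝ]ᵐᵒᵖ] H)

/-- The `S`-spectrum. -/
def sSpectrum (T : H →L[ℍ[ℝ]ᵐᵒᵖ] H) : Set ℍ[ℝ] := {s | ¬ IsUnit (pseudoResolventInv T s)}

/-- The pseudo-resolvent operator `Q_s(T)`, meaningful for `s ∉ sSpectrum T`. -/
def pseudoResolvent (T : H →L[ℍ[ℝ]ᵐᵒᵖ] H) (s : ℍ[ℝ]) : H →L[ℍ[ℝ]ᵐᵒᵖ] H :=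
  Ring.inverse (pseudoResolventInv T s)

/-- The left `S`-resolvent operator `-Q_s(T) (T - s̄ 𝓘)`. -/
def leftSResolvent [CompleteSpace H] (b : QHilbertBasis ι H) (T : H →L[ℍ[ℝ]ᵐᵒᵖ] H) (s : ℍ[ℝ]) :
    H →L[ℍ[ℝ]ᵐᵒᵖ] H :=
  -(pseudoResolvent T s * (T - b.leftMul (star s)))

/-- The right `S`-resolvent operator `-(T - s̄ 𝓘) Q_s(T)`. -/
def rightSResolvent [CompleteSpace H] (b : QHilbertBasis ι H) (T : H →L[ℍ[ℝ]ᵐᵒᵖ] H) (s : ℍ[ℝ]) :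
    H →L[ℍ[ℝ]ᵐᵒᵖ] H :=
  -((T - b.leftMul (star s)) * pseudoResolvent T s)

/-- The operator norm of a bounded right linear operator. -/
def rightOpNorm (A : H →L[ℍ[ℝ]ᵐᵒᵖ] H) : ℝ := ‖A.restrictScalars ℝ‖

/-- Left slice hyperholomorphy of an `H`-valued function on an axially symmetric open set `U`:
`f (u + J v) = α (u, v) + J β (u, v)` with `α` even and `β` odd in `v`, both differentiable and
satisfying the Cauchy-Riemann system on the set of all `(u, v)` with `u + J v ∈ U`. -/
def IsLeftSliceHyperholomorphicOn [CompleteSpace H] (b : QHilbertBasis ι H) (f : ℍ[ℝ] → H)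
    (U : Set ℍ[ℝ]) : Prop :=
  ∃ α β : ℝ × ℝ → H, ∀ u v : ℝ, ∀ J ∈ imagUnits, (u : ℍ[ℝ]) + v • J ∈ U →
    f ((u : ℍ[ℝ]) + v • J) = α (u, v) + b.leftMul J (β (u, v)) ∧
    α (u, -v) = α (u, v) ∧ β (u, -v) = -β (u, v) ∧
    DifferentiableAt ℝ α (u, v) ∧ DifferentiableAt ℝ β (u, v) ∧
    fderiv ℝ α (u, v) (1, 0) - fderiv ℝ β (u, v) (0, 1) = 0 ∧
    fderiv ℝ α (u, v) (0, 1) + fderiv ℝ β (u, v) (1, 0) = 0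

/-- A subspace that is invariant under every bounded right linear operator commuting with `T`. -/
def IsHyperinvariant (T : H →L[ℍ[ℝ]ᵐᵒᵖ] H) (M : Submodule ℍ[ℝ]ᵐᵒᵖ H) : Prop :=
  ∀ B : H →L[ℍ[ℝ]ᵐᵒᵖ] H, B * T = T * B → ∀ x ∈ M, B x ∈ M

end Operators

/-- `γ`, restricted to `(0, 1)`, parametrizes a smooth Jordan arc. -/
structure IsSmoothJordanArc (γ : ℝ → ℂ) : Prop where
  contDiffOn : ContDiffOn ℝ 1 γ (Ioo 0 1)
  deriv_ne_zero : ∀ t ∈ Ioo (0 : ℝ) 1, deriv γ t ≠ 0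
  isEmbedding : Topology.IsEmbedding (fun t : Ioo (0 : ℝ) 1 => γ t)

/-- `γ` parametrizes, in the coordinates of the slice `ℂ_I`, an exposed arc of `σ ∩ ℂ_I`: some open
disk of `ℂ_I` meets `σ` exactly in a smooth Jordan arc. -/
structure IsExposedArc (σ : Set ℍ[ℝ]) (I : ℍ[ℝ]) (γ : ℝ → ℂ) : Prop where
  isSmoothJordanArc : IsSmoothJordanArc γ
  exists_disk : ∃ (c : ℂ) (r : ℝ), 0 < r ∧
    toSlice I '' Metric.ball c r ∩ σ = toSlice I '' (γ '' Ioo 0 1)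

end

/-! Right multiplication by complex numbers turns `H` into a complex Banach space on which `T` acts
as a complex linear operator A. If s and z have the same real part and norm, then T² - 2 Re(s) T +
|s|² = (z - A)(z̄ - A). Right multiplication by j commutes with `T` and conjugates scalars, so the
spectrum of A is symmetric, and each slice of the S-spectrum is a copy of it (`mem_sSpectrum_iff`).
Write S_R⁻¹(u + Jv)x = α + Jβ with α = (u - T)Qx and β = -vQx. With i acting from the right, α + iβ
= (z - A)⁻¹x. Slice hyperholomorphic extensions of S_R⁻¹(·)x therefore correspond to holomorphic
extensions of the local resolvent of A off the subarc and its mirror image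
(`exists_slice_extension_iff`, `extendsResolvent_of_pair`, `pair_of_extendsResolvent`). Operators
commuting with `T` can be applied to α and β directly, which gives hyperinvariance.

What remains is a statement about A (`exists_subarc`). Over a short chord of the arc stands a thin
rhombus whose edges are transversal to the arc and meet the spectrum only at the two ends of the
chord. There the resolvent grows at most like exp(K r⁻ᵏ), and the zero-free function exp(-(1+w)⁻ᵖ -
(1-w)⁻ᵖ) with p = k + 1 cancels this growth.

This has two consequences. By the maximum principle on rhombi over subarcs disjoint from the chosen
one, every extension F of the local resolvent of x satisfies a local bound |F| ≤ C‖x‖ there. The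
maximum principle on a larger domain then gives such bounds wherever F is defined, so limits of
extendable vectors are extendable and the subspace is closed. Secondly, integrating the tamed
resolvent of x around the rhombus over the chosen subarc produces a vector whose local resolvent
extends, by the resolvent identity and Cauchy's theorem. If all these vectors vanished, the same
identity inside the rhombus would give every local resolvent a limit at a spectral point, making
that point regular (`notMem_spectrum_of_tendsto`). The subspace is proper for the same reason:
otherwise every local resolvent would have a limit at a point of the arc outside the subarc. -/

open Filter Topology Metric MeasureTheory

/-! ### Rhombi -/

/-- The open rhombus with vertices `±1` and `±h i`. -/
def openRhombus (h : ℝ) : Set ℂ := {w | |w.im| < h * (1 - |w.re|)}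

/-- The closed rhombus with vertices `±1` and `±h i`. -/
def closedRhombus (h : ℝ) : Set ℂ := {w | |w.im| ≤ h * (1 - |w.re|)}

/-- The boundary of the rhombus with vertices `±1` and `±h i`. -/
def rhombusBoundary (h : ℝ) : Set ℂ := {w | |w.im| = h * (1 - |w.re|)}

theorem isOpen_openRhombus (h : ℝ) : IsOpen (openRhombus h) :=
  isOpen_lt (by fun_prop) (by fun_prop)

theorem isClosed_closedRhombus (h : ℝ) : IsClosed (closedRhombus h) :=
  isClosed_le (by fun_prop) (by fun_prop)

theorem openRhombus_subset_closedRhombus (h : ℝ) : openRhombus h ⊆ closedRhombus h :=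
  fun w hw => show |w.im| ≤ _ from le_of_lt hw

theorem rhombusBoundary_subset_closedRhombus (h : ℝ) : rhombusBoundary h ⊆ closedRhombus h :=
  fun _ hw => le_of_eq hw

theorem frontier_openRhombus_subset (h : ℝ) : frontier (openRhombus h) ⊆ rhombusBoundary h :=
  frontier_lt_subset_eq (by fun_prop) (by fun_prop)

theorem closure_openRhombus_subset (h : ℝ) : closure (openRhombus h) ⊆ closedRhombus h :=
  closure_minimal (openRhombus_subset_closedRhombus h) (isClosed_closedRhombus h)

theorem mem_closedRhombus_iff {h : ℝ} {w : ℂ} (hh : 0 < h) :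
    w ∈ closedRhombus h ↔ |w.im| ≤ h * (1 + w.re) ∧ |w.im| ≤ h * (1 - w.re) := by
  change |w.im| ≤ h * (1 - |w.re|) ↔ _
  rcases abs_cases w.re with ⟨h1, h2⟩ | ⟨h1, h2⟩ <;> rw [h1]
  · refine ⟨fun H => ⟨H.trans ?_, H⟩, fun H => H.2⟩
    nlinarith
  · refine ⟨fun H => ⟨by simpa using H, H.trans ?_⟩, fun H => by simpa using H.1⟩
    nlinarith

theorem mem_openRhombus_iff {h : ℝ} {w : ℂ} (hh : 0 < h) :
    w ∈ openRhombus h ↔ |w.im| < h * (1 + w.re) ∧ |w.im| < h * (1 - w.re) := by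
  change |w.im| < h * (1 - |w.re|) ↔ _
  rcases abs_cases w.re with ⟨h1, h2⟩ | ⟨h1, h2⟩ <;> rw [h1]
  · refine ⟨fun H => ⟨H.trans_le ?_, H⟩, fun H => H.2⟩
    nlinarith
  · refine ⟨fun H => ⟨by simpa using H, H.trans_le ?_⟩, fun H => by simpa using H.1⟩
    nlinarith

theorem norm_le_one_of_mem_closedRhombus {h : ℝ} {w : ℂ} (hh : 0 < h) (hh1 : h ≤ 1)
    (hw : w ∈ closedRhombus h) : ‖w‖ ≤ 1 := by
  have h1 : |w.im| ≤ h * (1 - |w.re|) := hw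
  have h2 : 0 ≤ 1 - |w.re| := nonneg_of_mul_nonneg_right ((abs_nonneg _).trans h1) hh
  have h3 : |w.im| ≤ 1 - |w.re| := h1.trans (mul_le_of_le_one_left h2 hh1)
  linarith [Complex.norm_le_abs_re_add_abs_im w]

theorem convex_openRhombus {h : ℝ} (hh : 0 < h) : Convex ℝ (openRhombus h) := by
  intro x hx y hy a c ha hc hac
  rw [mem_openRhombus_iff hh, abs_lt, abs_lt] at *
  simp only [Complex.add_re, Complex.add_im, Complex.real_smul, Complex.mul_re, Complex.mul_im,
    Complex.ofReal_re, Complex.ofReal_im, zero_mul, sub_zero, add_zero]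
  obtain rfl : c = 1 - a := by linarith
  rcases ha.eq_or_lt with rfl | ha
  · simpa using hy
  · refine ⟨⟨?_, ?_⟩, ?_, ?_⟩ <;> nlinarith

theorem smul_mem_openRhombus {h r : ℝ} {w : ℂ} (hh : 0 < h) (hr0 : 0 ≤ r) (hr : r < 1)
    (hw : w ∈ closedRhombus h) : (r : ℂ) * w ∈ openRhombus h := by
  have h1 : |w.im| ≤ h * (1 - |w.re|) := hw
  change |((r : ℂ) * w).im| < h * (1 - |((r : ℂ) * w).re|)
  simp only [Complex.mul_re, Complex.mul_im, Complex.ofReal_re, Complex.ofReal_im, zero_mul,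
    sub_zero, add_zero, abs_mul, abs_of_nonneg hr0]
  nlinarith [abs_nonneg w.re]

theorem conj_mem_rhombusBoundary {h : ℝ} {w : ℂ} (hw : w ∈ rhombusBoundary h) :
    (starRingEnd ℂ) w ∈ rhombusBoundary h := by
  simpa [rhombusBoundary] using hw

theorem conj_mem_openRhombus {h : ℝ} {w : ℂ} (hw : w ∈ openRhombus h) :
    (starRingEnd ℂ) w ∈ openRhombus h := by
  simpa [openRhombus] using hw

theorem conj_mem_closedRhombus {h : ℝ} {w : ℂ} (hw : w ∈ closedRhombus h) :
    (starRingEnd ℂ) w ∈ closedRhombus h := by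
  simpa [closedRhombus] using hw

theorem neg_mem_closedRhombus {h : ℝ} {w : ℂ} (hw : w ∈ closedRhombus h) :
    -w ∈ closedRhombus h := by
  simpa [closedRhombus] using hw

/-! ### The flat function -/

/-- Powers of a unimodular number stay close to `1`. -/
theorem norm_pow_sub_one_le {v : ℂ} (hv : ‖v‖ = 1) (p : ℕ) : ‖v ^ p - 1‖ ≤ p * ‖v - 1‖ := by
  induction p with
  | zero => simp
  | succ n ih =>
    have : v ^ (n + 1) - 1 = v * (v ^ n - 1) + (v - 1) := by ring
    rw [this]
    refine (norm_add_le _ _).trans ?_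
    rw [norm_mul, hv, one_mul]
    push_cast
    linarith

/-- In a thin sector about the positive axis, the real part of `u ^ (-p)` is large. -/
theorem half_le_re_inv_pow {h : ℝ} {p : ℕ} (hp : 4 * p * h ≤ 1) {u : ℂ} (hu : u ≠ 0)
    (hh : 0 < h) (hs : |u.im| ≤ h * u.re) : (‖u‖ ^ p)⁻¹ / 2 ≤ ((u ^ p)⁻¹).re := by
  have hn : 0 < ‖u‖ := norm_pos_iff.2 hu
  have hn' : (‖u‖ : ℂ) ≠ 0 := by exact_mod_cast hn.ne'
  set v : ℂ := ‖u‖ * u⁻¹ with hv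
  have hv1 : ‖v‖ = 1 := by
    rw [hv, norm_mul, norm_inv, Complex.norm_real, norm_norm, mul_inv_cancel₀ hn.ne']
  have hre : 0 ≤ u.re := nonneg_of_mul_nonneg_right ((abs_nonneg _).trans hs) hh
  have h1 : ‖(‖u‖ : ℂ) - u‖ ≤ 2 * h * ‖u‖ := by
    have := Complex.norm_le_abs_re_add_abs_im ((‖u‖ : ℂ) - u)
    have h3 := Complex.norm_le_abs_re_add_abs_im u
    have h4 := Complex.re_le_norm u
    simp only [Complex.sub_re, Complex.sub_im, Complex.ofReal_re, Complex.ofReal_im, zero_sub,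
      abs_neg] at this
    rw [abs_of_nonneg (by linarith : 0 ≤ ‖u‖ - u.re)] at this
    rw [abs_of_nonneg hre] at h3
    nlinarith
  have h2 : ‖v - 1‖ ≤ 2 * h := by
    have : v - 1 = ((‖u‖ : ℂ) - u) * u⁻¹ := by rw [hv, sub_mul, mul_inv_cancel₀ hu]
    rw [this, norm_mul, norm_inv, ← div_eq_mul_inv, div_le_iff₀ hn]
    exact h1
  -- The condition `4 * p * h ≤ 1` says exactly that p · 2h ≤ 1/2.
  have h3 : ‖v ^ p - 1‖ ≤ 1 / 2 := by
    refine (norm_pow_sub_one_le hv1 p).trans ?_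
    have : (p : ℝ) * ‖v - 1‖ ≤ p * (2 * h) := by gcongr
    linarith
  have h4 : 1 / 2 ≤ (v ^ p).re := by
    have := (Complex.abs_re_le_norm (v ^ p - 1)).trans h3
    rw [abs_le] at this
    simp only [Complex.sub_re, Complex.one_re] at this
    linarith
  have h5 : (u ^ p)⁻¹ = ((‖u‖ ^ p)⁻¹ : ℝ) * v ^ p := by
    rw [hv, mul_pow]
    push_cast
    rw [← mul_assoc, inv_mul_cancel₀ (pow_ne_zero _ hn'), one_mul, inv_pow]
  rw [h5, Complex.re_ofReal_mul]
  have : 0 < (‖u‖ ^ p)⁻¹ := by positivity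
  nlinarith

open Classical in
/-- A function without zeros in the rhombus that vanishes to infinite order, with exponential rate
`p`, at the vertices `±1`. -/
noncomputable def flatFn (p : ℕ) (w : ℂ) : ℂ :=
  if w = 1 ∨ w = -1 then 0 else Complex.exp (-((1 + w) ^ p)⁻¹ - ((1 - w) ^ p)⁻¹)

theorem flatFn_of_ne {p : ℕ} {w : ℂ} (h1 : w ≠ 1) (h2 : w ≠ -1) :
    flatFn p w = Complex.exp (-((1 + w) ^ p)⁻¹ - ((1 - w) ^ p)⁻¹) :=
  if_neg (by tauto)

theorem flatFn_ne_zero {p : ℕ} {w : ℂ} (h1 : w ≠ 1) (h2 : w ≠ -1) : flatFn p w ≠ 0 := by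
  rw [flatFn_of_ne h1 h2]; exact Complex.exp_ne_zero _

theorem flatFn_one (p : ℕ) : flatFn p 1 = 0 := if_pos (Or.inl rfl)

theorem flatFn_neg_one (p : ℕ) : flatFn p (-1) = 0 := if_pos (Or.inr rfl)

theorem flatFn_neg (p : ℕ) (w : ℂ) : flatFn p (-w) = flatFn p w := by
  unfold flatFn
  have : (-w = 1 ∨ -w = -1) ↔ (w = 1 ∨ w = -1) := by
    rw [neg_inj, neg_eq_iff_eq_neg, or_comm]
  simp only [this]
  congr 2
  ring

/-- On the rhombus both 1 + w and 1 - w lie in the sector |Im u| ≤ h Re u. Both inverse powers then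
have nonnegative real part, and one of the two exponential factors can be dropped. -/
theorem norm_flatFn_le_left {h : ℝ} {p : ℕ} (hp : 4 * p * h ≤ 1) (hh : 0 < h) {w : ℂ}
    (hw : w ∈ closedRhombus h) : ‖flatFn p w‖ ≤ Real.exp (-((‖1 + w‖ ^ p)⁻¹ / 2)) := by
  by_cases h1 : w = 1
  · rw [h1, flatFn_one, norm_zero]; positivity
  by_cases h2 : w = -1
  · rw [h2, flatFn_neg_one, norm_zero]; positivity
  rw [flatFn_of_ne h1 h2, Complex.norm_exp]
  refine Real.exp_le_exp.2 ?_
  rw [mem_closedRhombus_iff hh] at hw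
  have a1 := half_le_re_inv_pow hp (u := 1 + w) (fun H => h2 (by linear_combination H)) hh
    (by simpa using hw.1)
  have a2 := half_le_re_inv_pow hp (u := 1 - w) (fun H => h1 (by linear_combination -H)) hh
    (by simpa using hw.2)
  have a3 : 0 ≤ (‖1 - w‖ ^ p)⁻¹ / 2 := by positivity
  rw [Complex.sub_re, Complex.neg_re]
  linarith

theorem norm_flatFn_le_right {h : ℝ} {p : ℕ} (hp : 4 * p * h ≤ 1) (hh : 0 < h) {w : ℂ}
    (hw : w ∈ closedRhombus h) : ‖flatFn p w‖ ≤ Real.exp (-((‖1 - w‖ ^ p)⁻¹ / 2)) := by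
  have := norm_flatFn_le_left hp hh (neg_mem_closedRhombus hw)
  rwa [flatFn_neg, ← sub_eq_add_neg] at this

theorem differentiableAt_flatFn {p : ℕ} {w : ℂ} (h1 : w ≠ 1) (h2 : w ≠ -1) :
    DifferentiableAt ℂ (flatFn p) w := by
  have : (fun w => Complex.exp (-((1 + w) ^ p)⁻¹ - ((1 - w) ^ p)⁻¹)) =ᶠ[𝓝 w] flatFn p := by
    filter_upwards [isOpen_ne.mem_nhds h1, isOpen_ne.mem_nhds h2] with z hz1 hz2
    exact (flatFn_of_ne hz1 hz2).symm
  refine DifferentiableAt.congr_of_eventuallyEq ?_ this.symm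
  have a1 : (1 + w) ^ p ≠ 0 := pow_ne_zero _ (fun H => h2 (by linear_combination H))
  have a2 : (1 - w) ^ p ≠ 0 := pow_ne_zero _ (fun H => h1 (by linear_combination -H))
  fun_prop (disch := assumption)

theorem tendsto_exp_neg_inv_pow {p : ℕ} (hp : p ≠ 0) :
    Tendsto (fun u : ℂ => Real.exp (-((‖u‖ ^ p)⁻¹ / 2))) (𝓝[≠] 0) (𝓝 0) := by
  refine Real.tendsto_exp_atBot.comp (tendsto_neg_atTop_atBot.comp ?_)
  refine Tendsto.atTop_div_const (by norm_num) (tendsto_inv_nhdsGT_zero.comp ?_)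
  refine tendsto_nhdsWithin_iff.2 ⟨?_, ?_⟩
  · have : Tendsto (fun u : ℂ => ‖u‖ ^ p) (𝓝 0) (𝓝 (‖(0 : ℂ)‖ ^ p)) :=
      (continuous_norm.pow p).tendsto 0
    rw [norm_zero, zero_pow hp] at this
    exact this.mono_left nhdsWithin_le_nhds
  · filter_upwards [self_mem_nhdsWithin] with u hu
    have : 0 < ‖u‖ := norm_pos_iff.2 hu
    exact pow_pos this p

/-- For `p ≠ 0` the exponential has an essential singularity at the vertex, so continuity holds only
relative to the thin rhombus. -/
theorem continuousWithinAt_flatFn_neg_one {h : ℝ} {p : ℕ} (hp0 : p ≠ 0) (hp : 4 * p * h ≤ 1)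
    (hh : 0 < h) : ContinuousWithinAt (flatFn p) (closedRhombus h) (-1) := by
  rw [← continuousWithinAt_sdiff_self, ContinuousWithinAt, flatFn_neg_one]
  have h2 : Tendsto (fun w : ℂ => 1 + w) (𝓝[closedRhombus h \ {-1}] (-1)) (𝓝[≠] 0) := by
    refine tendsto_nhdsWithin_iff.2 ⟨?_, ?_⟩
    · have : Tendsto (fun w : ℂ => 1 + w) (𝓝 (-1)) (𝓝 (1 + -1)) :=
        (continuous_const.add continuous_id).tendsto (-1)
      rw [add_neg_cancel] at this
      exact this.mono_left nhdsWithin_le_nhds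
    · filter_upwards [self_mem_nhdsWithin] with w hw H
      exact hw.2 (by
        have : 1 + w = 0 := H
        simp only [mem_singleton_iff]; linear_combination this)
  refine squeeze_zero_norm' ?_ ((tendsto_exp_neg_inv_pow hp0).comp h2)
  filter_upwards [self_mem_nhdsWithin] with w hw
  exact norm_flatFn_le_left hp hh hw.1

theorem continuousOn_flatFn {h : ℝ} {p : ℕ} (hp0 : p ≠ 0) (hp : 4 * p * h ≤ 1)
    (hh : 0 < h) : ContinuousOn (flatFn p) (closedRhombus h) := by
  intro w hw
  by_cases h2 : w = -1
  · rw [h2]; exact continuousWithinAt_flatFn_neg_one hp0 hp hh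
  by_cases h1 : w = 1
  · have h3 : ContinuousWithinAt (flatFn p ∘ Neg.neg) (closedRhombus h) 1 :=
      (continuousWithinAt_flatFn_neg_one hp0 hp hh).comp continuous_neg.continuousWithinAt
        fun w hw => neg_mem_closedRhombus hw
    have h4 : flatFn p ∘ Neg.neg = flatFn p := funext fun w => flatFn_neg p w
    rw [h1]
    rwa [h4] at h3
  exact (differentiableAt_flatFn h1 h2).continuousAt.continuousWithinAt

theorem ne_of_mem_openRhombus {h : ℝ} {w : ℂ} (hw : w ∈ openRhombus h) : w ≠ 1 ∧ w ≠ -1 := by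
  constructor <;> rintro rfl <;> simp [openRhombus] at hw

theorem differentiableOn_flatFn (h : ℝ) (p : ℕ) :
    DifferentiableOn ℂ (flatFn p) (openRhombus h) := fun _ hw =>
  (differentiableAt_flatFn (ne_of_mem_openRhombus hw).1
    (ne_of_mem_openRhombus hw).2).differentiableWithinAt

/-- The decay of order `k + 1` beats growth of order `k`. -/
theorem exp_mul_exp_le (K : ℝ) (hK : 0 ≤ K) (k : ℕ) {x : ℝ} (hx : 0 ≤ x) :
    Real.exp (K * (x ^ k)⁻¹) * Real.exp (-((x ^ (k + 1))⁻¹ / 2)) ≤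
      Real.exp (K * (2 * K) ^ k) := by
  rw [← Real.exp_add]
  refine Real.exp_le_exp.2 ?_
  rw [← inv_pow, ← inv_pow]
  have hy : 0 ≤ x⁻¹ := by positivity
  generalize x⁻¹ = y at hy
  have hyk : 0 ≤ y ^ k := by positivity
  -- With y = 1/x the exponent is yᵏ(K - y/2), which changes sign at y = 2K.
  rcases le_total y (2 * K) with h | h
  · have : y ^ k ≤ (2 * K) ^ k := by gcongr
    have h2 : 0 ≤ y ^ (k + 1) := by positivity
    nlinarith
  · have : y ^ (k + 1) = y ^ k * y := pow_succ _ _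
    have h2 : 0 ≤ K * (2 * K) ^ k := by positivity
    nlinarith [mul_le_mul_of_nonneg_left h hyk]

/-! ### Contour integrals along the rhombus -/

/-- The vertices of the rhombus, in counterclockwise order. -/
noncomputable def rhombusVertex (h : ℝ) : Fin 4 → ℂ :=
  ![-1, -(h * Complex.I), 1, h * Complex.I]

/-- The direction of the `j`-th edge of the rhombus. -/
noncomputable def rhombusDir (h : ℝ) (j : Fin 4) : ℂ :=
  rhombusVertex h (j + 1) - rhombusVertex h j

/-- The affine parametrization of the `j`-th edge of the rhombus. -/
noncomputable def rhombusEdge (h : ℝ) (j : Fin 4) (t : ℝ) : ℂ :=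
  rhombusVertex h j + t * rhombusDir h j

/-- The contour integral along the boundary of the rhombus. -/
noncomputable def rhombusIntegral {X : Type*} [NormedAddCommGroup X] [NormedSpace ℂ X] (h : ℝ)
    (g : ℂ → X) : X :=
  ∑ j, ∫ t in (0 : ℝ)..1, rhombusDir h j • g (rhombusEdge h j t)

theorem continuous_rhombusEdge (h : ℝ) (j : Fin 4) : Continuous (rhombusEdge h j) := by
  unfold rhombusEdge; fun_prop

theorem rhombusEdge_mem {h : ℝ} (hh : 0 < h) (j : Fin 4) {t : ℝ} (ht : t ∈ Icc (0 : ℝ) 1) :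
    rhombusEdge h j t ∈ rhombusBoundary h := by
  obtain ⟨h0, h1⟩ := ht
  have e1 : |1 - t| = 1 - t := abs_of_nonneg (by linarith)
  have e3 : |-1 + t| = 1 - t := by rw [← e1, abs_sub_comm]; congr 1; ring
  have e4 : |-h + h * t| = h * (1 - t) := by
    rw [show -h + h * t = -(h * (1 - t)) by ring, abs_neg, abs_of_nonneg (by nlinarith)]
  have e5 : |h - h * t| = h * (1 - t) := by
    rw [show h - h * t = (h * (1 - t)) by ring, abs_of_nonneg (by nlinarith)]
  fin_cases j <;>
    simp [rhombusBoundary, rhombusEdge, rhombusDir, rhombusVertex, abs_mul, abs_of_pos hh,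
      abs_of_nonneg h0, e1, e3, e4, e5, ← sub_eq_add_neg, mul_comm]

theorem rhombusEdge_ne {h : ℝ} (hh : 0 < h) (j : Fin 4) {t : ℝ} (ht : t ∈ Ioo (0 : ℝ) 1) :
    rhombusEdge h j t ∉ ({1, -1} : Set ℂ) := by
  obtain ⟨h0, h1⟩ := ht
  have : (rhombusEdge h j t).im ≠ 0 := by
    fin_cases j <;>
      simp [rhombusEdge, rhombusDir, rhombusVertex, h0.ne', hh.ne'] <;> nlinarith
  rintro (H | H) <;> rw [H] at this <;> simp at this

section Integrability

variable {X : Type*} [NormedAddCommGroup X] [NormedSpace ℂ X]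

/-- The vertices ±1 are left out because the resolvent is not controlled there. They are a null set,
so boundedness and continuity elsewhere suffice. -/
theorem intervalIntegrable_rhombusEdge {h : ℝ} (hh : 0 < h) {g : ℂ → X} {C : ℝ}
    (hg : ContinuousOn g (rhombusBoundary h \ {1, -1}))
    (hC : ∀ w ∈ rhombusBoundary h \ {1, -1}, ‖g w‖ ≤ C) (j : Fin 4) :
    IntervalIntegrable (fun t => rhombusDir h j • g (rhombusEdge h j t)) volume 0 1 := by
  rw [intervalIntegrable_iff_integrableOn_Ioo_of_le zero_le_one]
  have hmem : ∀ t ∈ Ioo (0 : ℝ) 1, rhombusEdge h j t ∈ rhombusBoundary h \ {1, -1} := fun t ht =>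
    ⟨rhombusEdge_mem hh j (Ioo_subset_Icc_self ht), rhombusEdge_ne hh j ht⟩
  refine Integrable.of_bound ?_ (‖rhombusDir h j‖ * C) ?_
  · exact ((hg.comp (continuous_rhombusEdge h j).continuousOn hmem).const_smul
      (rhombusDir h j)).aestronglyMeasurable measurableSet_Ioo
  · refine (ae_restrict_iff' measurableSet_Ioo).2 (ae_of_all _ fun t ht => ?_)
    rw [norm_smul]
    exact mul_le_mul_of_nonneg_left (hC _ (hmem t ht)) (norm_nonneg _)

theorem rhombusIntegral_congr {h : ℝ} (hh : 0 < h) {g₁ g₂ : ℂ → X}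
    (H : ∀ w ∈ rhombusBoundary h \ {1, -1}, g₁ w = g₂ w) :
    rhombusIntegral h g₁ = rhombusIntegral h g₂ := by
  refine Finset.sum_congr rfl fun j _ => ?_
  rw [intervalIntegral.integral_of_le zero_le_one, intervalIntegral.integral_of_le zero_le_one,
    integral_Ioc_eq_integral_Ioo, integral_Ioc_eq_integral_Ioo]
  refine setIntegral_congr_fun measurableSet_Ioo fun t ht => ?_
  rw [H _ ⟨rhombusEdge_mem hh j (Ioo_subset_Icc_self ht), rhombusEdge_ne hh j ht⟩]

theorem rhombusIntegral_sub {h : ℝ} (hh : 0 < h) {g₁ g₂ : ℂ → X} {C₁ C₂ : ℝ}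
    (hg₁ : ContinuousOn g₁ (rhombusBoundary h \ {1, -1}))
    (hC₁ : ∀ w ∈ rhombusBoundary h \ {1, -1}, ‖g₁ w‖ ≤ C₁)
    (hg₂ : ContinuousOn g₂ (rhombusBoundary h \ {1, -1}))
    (hC₂ : ∀ w ∈ rhombusBoundary h \ {1, -1}, ‖g₂ w‖ ≤ C₂) :
    rhombusIntegral h (fun w => g₁ w - g₂ w) = rhombusIntegral h g₁ - rhombusIntegral h g₂ := by
  unfold rhombusIntegral
  rw [← Finset.sum_sub_distrib]
  refine Finset.sum_congr rfl fun j _ => ?_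
  rw [← intervalIntegral.integral_sub (intervalIntegrable_rhombusEdge hh hg₁ hC₁ j)
    (intervalIntegrable_rhombusEdge hh hg₂ hC₂ j)]
  simp only [smul_sub]

theorem ContinuousLinearMap.map_rhombusIntegral [CompleteSpace X] (L : X →L[ℂ] X) {h : ℝ}
    (hh : 0 < h) {g : ℂ → X} {C : ℝ}
    (hg : ContinuousOn g (rhombusBoundary h \ {1, -1}))
    (hC : ∀ w ∈ rhombusBoundary h \ {1, -1}, ‖g w‖ ≤ C) :
    L (rhombusIntegral h g) = rhombusIntegral h (fun w => L (g w)) := by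
  unfold rhombusIntegral
  rw [map_sum]
  refine Finset.sum_congr rfl fun j _ => ?_
  rw [← L.intervalIntegral_comp_comm (intervalIntegrable_rhombusEdge hh hg hC j)]
  simp only [map_smul]

theorem rhombusIntegral_smul_const [CompleteSpace X] (h : ℝ) (g : ℂ → ℂ) (x : X) :
    rhombusIntegral h (fun w => g w • x) = rhombusIntegral h g • x := by
  unfold rhombusIntegral
  rw [Finset.sum_smul]
  refine Finset.sum_congr rfl fun j _ => ?_
  rw [← intervalIntegral.integral_smul_const]
  simp only [smul_assoc]

theorem isCompact_closedRhombus {h : ℝ} (hh : 0 < h) : IsCompact (closedRhombus h) := by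
  refine Metric.isCompact_of_isClosed_isBounded (isClosed_closedRhombus h)
    (isBounded_closedBall.subset (t := closedBall 0 (1 + h)) fun w hw => ?_)
  rw [mem_closedBall_zero_iff]
  have h1 : |w.im| ≤ h * (1 - |w.re|) := hw
  have h2 : 0 ≤ 1 - |w.re| := nonneg_of_mul_nonneg_right ((abs_nonneg _).trans h1) hh
  have := Complex.norm_le_abs_re_add_abs_im w
  nlinarith [abs_nonneg w.re]

theorem isClosed_rhombusBoundary (h : ℝ) : IsClosed (rhombusBoundary h) :=
  isClosed_eq (by fun_prop) (by fun_prop)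

/-- A Cauchy transform along the boundary of the rhombus is holomorphic off the boundary. -/
theorem differentiableAt_rhombusIntegral_inv_smul {h : ℝ} (hh : 0 < h) {g : ℂ → X} {C : ℝ}
    (hg : ContinuousOn g (rhombusBoundary h \ {1, -1}))
    (hC : ∀ w ∈ rhombusBoundary h \ {1, -1}, ‖g w‖ ≤ C) {ζ : ℂ} (hζ : ζ ∉ rhombusBoundary h) :
    DifferentiableAt ℂ (fun z => rhombusIntegral h fun w => (w - z)⁻¹ • g w) ζ := by
  obtain ⟨δ, hδ, hball⟩ := Metric.isOpen_iff.1 (isClosed_rhombusBoundary h).isOpen_compl ζ hζ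
  -- Halving the radius keeps the kernel and its derivative uniformly bounded, as differentiation
  -- under the integral requires.
  have hdist : ∀ z ∈ ball ζ (δ / 2), ∀ w ∈ rhombusBoundary h, δ / 2 ≤ ‖w - z‖ := by
    intro z hz w hw
    by_contra! H
    refine hball ?_ hw
    rw [mem_ball, dist_eq_norm] at *
    calc ‖w - ζ‖ ≤ ‖w - z‖ + ‖z - ζ‖ := norm_sub_le_norm_sub_add_norm_sub _ _ _
      _ < δ := by linarith
  have hne : ∀ z ∈ ball ζ (δ / 2), ∀ w ∈ rhombusBoundary h, w - z ≠ 0 := fun z hz w hw H => by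
    have := hdist z hz w hw
    rw [H, norm_zero] at this
    linarith
  have hcont : ∀ z ∈ ball ζ (δ / 2), ∀ n : ℕ,
      ContinuousOn (fun w => ((w - z) ^ n)⁻¹ • g w) (rhombusBoundary h \ {1, -1}) := by
    intro z hz n
    refine ContinuousOn.smul (ContinuousOn.inv₀ (by fun_prop) fun w hw => ?_) hg
    exact pow_ne_zero _ (hne z hz w hw.1)
  have hbd : ∀ z ∈ ball ζ (δ / 2), ∀ n : ℕ, ∀ w ∈ rhombusBoundary h \ {1, -1},
      ‖((w - z) ^ n)⁻¹ • g w‖ ≤ ((δ / 2) ^ n)⁻¹ * C := by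
    intro z hz n w hw
    rw [norm_smul, norm_inv, norm_pow]
    have h1 := hdist z hz w hw.1
    gcongr
    exact hC w hw
  unfold rhombusIntegral
  refine DifferentiableAt.fun_sum fun j _ => ?_
  have hmem : ∀ t ∈ Ioo (0 : ℝ) 1, rhombusEdge h j t ∈ rhombusBoundary h \ {1, -1} := fun t ht =>
    ⟨rhombusEdge_mem hh j (Ioo_subset_Icc_self ht), rhombusEdge_ne hh j ht⟩
  have hint := fun z hz n => intervalIntegrable_rhombusEdge hh (hcont z hz n) (hbd z hz n) j
  have hae : ∀ᵐ t : ℝ, t ∈ uIoc (0 : ℝ) 1 → t ∈ Ioo (0 : ℝ) 1 := by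
    rw [uIoc_of_le zero_le_one]
    filter_upwards [Measure.ae_ne volume (1 : ℝ)] with t h1 ht
    exact ⟨ht.1, lt_of_le_of_ne ht.2 h1⟩
  have hball' : ball ζ (δ / 2) ∈ 𝓝 ζ := ball_mem_nhds _ (by positivity)
  refine (intervalIntegral.hasDerivAt_integral_of_dominated_loc_of_deriv_le
    (F := fun z t => rhombusDir h j • (rhombusEdge h j t - z)⁻¹ • g (rhombusEdge h j t))
    (F' := fun z t => rhombusDir h j • ((rhombusEdge h j t - z) ^ 2)⁻¹ • g (rhombusEdge h j t))
    (bound := fun _ => ‖rhombusDir h j‖ * (((δ / 2) ^ 2)⁻¹ * C))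
    (s := ball ζ (δ / 2)) hball' ?_ ?_ ?_ ?_ ?_ ?_).2.differentiableAt
  · filter_upwards [hball'] with z hz
    have := (hint z hz 1).def'.aestronglyMeasurable
    simpa only [pow_one] using this
  · simpa only [pow_one] using hint ζ (mem_ball_self (by positivity)) 1
  · exact (hint ζ (mem_ball_self (by positivity)) 2).def'.aestronglyMeasurable
  · filter_upwards [hae] with t ht htt z hz
    rw [norm_smul]
    exact mul_le_mul_of_nonneg_left (hbd z hz 2 _ (hmem t (ht htt))) (norm_nonneg _)
  · exact intervalIntegrable_const
  · filter_upwards [hae] with t ht htt z hz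
    have h0 := hne z hz _ (hmem t (ht htt)).1
    have h1 : HasDerivAt (fun z => rhombusEdge h j t - z) (-1) z := by
      simpa using (hasDerivAt_id z).const_sub (rhombusEdge h j t)
    have h2 := (h1.inv h0).smul_const (g (rhombusEdge h j t))
    have h3 := h2.fun_const_smul (rhombusDir h j)
    simpa [neg_neg, one_div] using h3

end Integrability

/-! ### Cauchy's theorem and formula -/

/-- **Cauchy's theorem** for the rhombus. -/
theorem rhombusIntegral_eq_zero {h : ℝ} (hh : 0 < h) {g : ℂ → ℂ}
    (hg : ContinuousOn g (closedRhombus h)) (hd : DifferentiableOn ℂ g (openRhombus h)) :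
    rhombusIntegral h g = 0 := by
  obtain ⟨P, hP⟩ := (convex_openRhombus hh).exists_forall_hasDerivWithinAt hd
  have hP' : ∀ w ∈ openRhombus h, HasDerivAt P (g w) w := fun w hw =>
    (hP w hw).hasDerivAt ((isOpen_openRhombus h).mem_nhds hw)
  have hE : ∀ j, ∀ t ∈ Icc (0 : ℝ) 1, rhombusEdge h j t ∈ closedRhombus h := fun j t ht =>
    rhombusBoundary_subset_closedRhombus h (rhombusEdge_mem hh j ht)
  have hR : ∀ r ∈ Icc (0 : ℝ) 1, ∀ j, ∀ t ∈ Icc (0 : ℝ) 1,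
      (r : ℂ) * rhombusEdge h j t ∈ closedRhombus h := by
    intro r hr j t ht
    rcases hr.2.eq_or_lt with rfl | h1
    · simpa using hE j t ht
    · exact openRhombus_subset_closedRhombus h (smul_mem_openRhombus hh hr.1 h1 (hE j t ht))
  -- A primitive exists only in the open rhombus. The contour is therefore shrunk by r < 1, where
  -- the integral telescopes to zero, and r → 1 is justified by dominated convergence.
  set Φ : ℝ → ℂ := fun r => ∑ j, ∫ t in (0 : ℝ)..1,
    (r * rhombusDir h j) • g (r * rhombusEdge h j t) with hΦ
  have hcont : ∀ r ∈ Icc (0 : ℝ) 1, ∀ j, ContinuousOn (fun t : ℝ =>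
      (r * rhombusDir h j) • g (r * rhombusEdge h j t)) (Icc 0 1) := fun r hr j =>
    (hg.comp (continuous_const.mul (continuous_rhombusEdge h j)).continuousOn
      fun t ht => hR r hr j t ht).const_smul (r * rhombusDir h j)
  have h0 : ∀ r ∈ Ico (0 : ℝ) 1, Φ r = 0 := by
    intro r hr
    have hj : ∀ j, ∫ t in (0 : ℝ)..1, (r * rhombusDir h j) • g (r * rhombusEdge h j t) =
        P (r * rhombusVertex h (j + 1)) - P (r * rhombusVertex h j) := by
      intro j
      have := intervalIntegral.integral_eq_sub_of_hasDerivAt (a := 0) (b := 1)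
        (f := fun t : ℝ => P (r * rhombusEdge h j t))
        (f' := fun t => (r * rhombusDir h j) • g (r * rhombusEdge h j t)) ?_ ?_
      · rw [this]
        simp [rhombusEdge, rhombusDir]
      · intro t ht
        rw [uIcc_of_le zero_le_one] at ht
        have h1 : HasDerivAt (fun t : ℝ => (r : ℂ) * rhombusEdge h j t) (r * rhombusDir h j) t := by
          unfold rhombusEdge
          have := (((Complex.ofRealCLM.hasDerivAt (x := t)).mul_const
            (rhombusDir h j)).const_add (rhombusVertex h j)).const_mul (r : ℂ)
          simpa using this
        have h2 := (hP' _ (smul_mem_openRhombus hh hr.1 hr.2 (hE j t ht))).scomp t h1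
        exact h2
      · refine ContinuousOn.intervalIntegrable ?_
        rw [uIcc_of_le zero_le_one]
        exact hcont r (Ico_subset_Icc_self hr) j
    simp only [hΦ, hj, Fin.sum_univ_four, Fin.isValue]
    norm_num [Fin.ext_iff]
    rw [show (1 : Fin 4) + 1 = 2 from rfl, show (2 : Fin 4) + 1 = 3 from rfl,
      show (3 : Fin 4) + 1 = 0 from rfl]
    ring
  obtain ⟨C, hC⟩ := (isCompact_closedRhombus hh).exists_bound_of_continuousOn hg
  have hlim : ContinuousWithinAt Φ (Icc 0 1) 1 := by
    refine tendsto_finsetSum _ fun j _ => ?_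
    refine intervalIntegral.continuousWithinAt_of_dominated_interval
      (bound := fun _ => ‖rhombusDir h j‖ * C) ?_ ?_ intervalIntegrable_const ?_
    · filter_upwards [self_mem_nhdsWithin] with r hr
      rw [uIoc_of_le zero_le_one]
      exact ((hcont r hr j).mono Ioc_subset_Icc_self).aestronglyMeasurable measurableSet_Ioc
    · filter_upwards [self_mem_nhdsWithin] with r hr
      refine ae_of_all _ fun t ht => ?_
      rw [uIoc_of_le zero_le_one] at ht
      have h1 := hC _ (hR r hr j t (Ioc_subset_Icc_self ht))
      rw [norm_smul, norm_mul, Complex.norm_real, Real.norm_of_nonneg hr.1]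
      have h2 : r * ‖rhombusDir h j‖ ≤ ‖rhombusDir h j‖ :=
        mul_le_of_le_one_left (norm_nonneg _) hr.2
      exact mul_le_mul h2 h1 (norm_nonneg _) (norm_nonneg _)
    · refine ae_of_all _ fun t ht => ?_
      rw [uIoc_of_le zero_le_one] at ht
      have h1 : ContinuousOn (fun r : ℝ => (r * rhombusDir h j) • g (r * rhombusEdge h j t))
          (Icc 0 1) := by
        refine ContinuousOn.smul (f := fun r : ℝ => (r : ℂ) * rhombusDir h j) (by fun_prop) ?_
        exact hg.comp (f := fun r : ℝ => (r : ℂ) * rhombusEdge h j t) (by fun_prop)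
          fun r hr => hR r hr j t (Ioc_subset_Icc_self ht)
      exact h1 1 ⟨zero_le_one, le_rfl⟩
  have hmono : ContinuousWithinAt Φ (Ico 0 1) 1 := hlim.mono Ico_subset_Icc_self
  have hne : (𝓝[Ico (0 : ℝ) 1] 1).NeBot := by
    rw [← mem_closure_iff_nhdsWithin_neBot, closure_Ico zero_ne_one]
    exact ⟨zero_le_one, le_rfl⟩
  have hz : Tendsto Φ (𝓝[Ico 0 1] 1) (𝓝 0) := by
    refine tendsto_const_nhds.congr' ?_
    filter_upwards [self_mem_nhdsWithin] with r hr
    exact (h0 r hr).symm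
  have := tendsto_nhds_unique hmono hz
  simpa [hΦ, rhombusIntegral] using this

/-- Since d · d̄ is real, Im(d · conj(a + td - ζ)) does not depend on t. Its sign tells on which
side of the line a + ℝd the point ζ lies. -/
theorem im_div_pos {a d ζ : ℂ} {t : ℝ} (H : 0 < (d * (starRingEnd ℂ) (a - ζ)).im) :
    0 < (d * (a + t * d - ζ)⁻¹).im := by
  have h0 : (d * (starRingEnd ℂ) (a + t * d - ζ)).im = (d * (starRingEnd ℂ) (a - ζ)).im := by
    simp only [map_sub, map_add, map_mul, Complex.conj_ofReal, Complex.mul_im, Complex.sub_im,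
      Complex.add_im, Complex.sub_re, Complex.add_re, Complex.mul_re, Complex.conj_re,
      Complex.conj_im, Complex.ofReal_re, Complex.ofReal_im]
    ring
  have h1 : a + t * d - ζ ≠ 0 := by
    intro h
    rw [h] at h0
    simp only [map_zero, mul_zero, Complex.zero_im] at h0
    linarith
  rw [Complex.inv_def, ← mul_assoc, mul_comm _ ((_ : ℝ) : ℂ), Complex.im_ofReal_mul, h0]
  have := Complex.normSq_pos.2 h1
  positivity

theorem notMem_rhombusBoundary_of_mem_openRhombus {h : ℝ} {ζ : ℂ} (hζ : ζ ∈ openRhombus h) :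
    ζ ∉ rhombusBoundary h := fun H => (ne_of_lt hζ) H

theorem rhombusDir_mul_conj_im_pos {h : ℝ} (hh : 0 < h) {ζ : ℂ} (hζ : ζ ∈ openRhombus h)
    (j : Fin 4) :
    0 < (rhombusDir h j * (starRingEnd ℂ) (rhombusVertex h j - ζ)).im := by
  rw [mem_openRhombus_iff hh, abs_lt, abs_lt] at hζ
  fin_cases j <;> simp [rhombusDir, rhombusVertex] <;> linarith

/-- The rhombus winds around its interior points. -/
theorem rhombusIntegral_inv_ne_zero {h : ℝ} (hh : 0 < h) {ζ : ℂ} (hζ : ζ ∈ openRhombus h) :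
    rhombusIntegral h (fun w => (w - ζ)⁻¹) ≠ 0 := by
  -- Every edge runs counterclockwise as seen from ζ and contributes a positive imaginary part. Only
  -- nonvanishing is needed, so the value 2πi is never computed.
  have hpos : 0 < (rhombusIntegral h (fun w => (w - ζ)⁻¹)).im := by
    unfold rhombusIntegral
    rw [Complex.im_sum]
    refine Finset.sum_pos (fun j _ => ?_) Finset.univ_nonempty
    have hne : ∀ t ∈ Icc (0 : ℝ) 1, rhombusEdge h j t - ζ ≠ 0 := by
      intro t ht H
      exact notMem_rhombusBoundary_of_mem_openRhombus hζ
        (sub_eq_zero.1 H ▸ rhombusEdge_mem hh j ht)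
    have hc : ContinuousOn (fun t => rhombusDir h j • (rhombusEdge h j t - ζ)⁻¹) (Icc 0 1) :=
      ContinuousOn.fun_const_smul (((continuous_rhombusEdge h j).sub
        continuous_const).continuousOn.inv₀ hne) _
    have hi : IntervalIntegrable (fun t => rhombusDir h j • (rhombusEdge h j t - ζ)⁻¹) volume
        0 1 := ContinuousOn.intervalIntegrable (by rwa [uIcc_of_le zero_le_one])
    rw [show (∫ t in (0 : ℝ)..1, rhombusDir h j • (rhombusEdge h j t - ζ)⁻¹).im =
      ∫ t in (0 : ℝ)..1, (rhombusDir h j • (rhombusEdge h j t - ζ)⁻¹).im from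
      (Complex.imCLM.intervalIntegral_comp_comm hi).symm]
    refine intervalIntegral.intervalIntegral_pos_of_pos_on ?_ (fun t ht => ?_) zero_lt_one
    · refine ContinuousOn.intervalIntegrable ?_
      rw [uIcc_of_le zero_le_one]
      exact Complex.continuous_im.comp_continuousOn hc
    · rw [smul_eq_mul]
      exact im_div_pos (rhombusDir_mul_conj_im_pos hh hζ j)
  intro H
  rw [H] at hpos
  simp at hpos

theorem rhombusIntegral_inv_mul_of_notMem {h : ℝ} (hh : 0 < h) {f : ℂ → ℂ}
    (hf : ContinuousOn f (closedRhombus h)) (hd : DifferentiableOn ℂ f (openRhombus h)) {ζ : ℂ}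
    (hζ : ζ ∉ closedRhombus h) : rhombusIntegral h (fun w => (w - ζ)⁻¹ * f w) = 0 := by
  have hne : ∀ w ∈ closedRhombus h, w - ζ ≠ 0 := fun w hw H => hζ (sub_eq_zero.1 H ▸ hw)
  refine rhombusIntegral_eq_zero hh ?_ ?_
  · exact ContinuousOn.mul ((by fun_prop : ContinuousOn (fun w => w - ζ) _).inv₀ hne) hf
  · refine DifferentiableOn.mul (DifferentiableOn.fun_inv (by fun_prop) fun w hw => ?_) hd
    exact hne w (openRhombus_subset_closedRhombus h hw)

theorem continuousOn_inv_sub_rhombusBoundary {h : ℝ} {ζ : ℂ} (hζ : ζ ∉ rhombusBoundary h) :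
    ContinuousOn (fun w => (w - ζ)⁻¹) (rhombusBoundary h) :=
  ContinuousOn.inv₀ (by fun_prop) fun _ hw H => hζ (sub_eq_zero.1 H ▸ hw)

theorem isCompact_rhombusBoundary {h : ℝ} (hh : 0 < h) : IsCompact (rhombusBoundary h) :=
  (isCompact_closedRhombus hh).of_isClosed_subset (isClosed_rhombusBoundary h)
    (rhombusBoundary_subset_closedRhombus h)

/-- **Cauchy's formula** for the rhombus, up to the value of the winding number. -/
theorem rhombusIntegral_inv_mul_of_mem {h : ℝ} (hh : 0 < h) {f : ℂ → ℂ}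
    (hf : ContinuousOn f (closedRhombus h)) (hd : DifferentiableOn ℂ f (openRhombus h)) {ζ : ℂ}
    (hζ : ζ ∈ openRhombus h) : rhombusIntegral h (fun w => (w - ζ)⁻¹ * f w) =
      rhombusIntegral h (fun w => (w - ζ)⁻¹) * f ζ := by
  have hO : openRhombus h ∈ 𝓝 ζ := (isOpen_openRhombus h).mem_nhds hζ
  -- The difference quotient of f at ζ has a removable singularity, so Cauchy's theorem applies to
  -- it.
  have h0 : rhombusIntegral h (dslope f ζ) = 0 := by
    refine rhombusIntegral_eq_zero hh ?_ ((Complex.differentiableOn_dslope hO).2 hd)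
    exact (continuousOn_dslope (mem_of_superset hO (openRhombus_subset_closedRhombus h))).2
      ⟨hf, hd.differentiableAt hO⟩
  have hB := notMem_rhombusBoundary_of_mem_openRhombus hζ
  have hc1 : ContinuousOn (fun w => (w - ζ)⁻¹ * f w) (rhombusBoundary h) :=
    (continuousOn_inv_sub_rhombusBoundary hB).mul
      (hf.mono (rhombusBoundary_subset_closedRhombus h))
  have hc2 : ContinuousOn (fun w => (w - ζ)⁻¹ * f ζ) (rhombusBoundary h) :=
    (continuousOn_inv_sub_rhombusBoundary hB).mul continuousOn_const
  obtain ⟨C₁, hC₁⟩ := (isCompact_rhombusBoundary hh).exists_bound_of_continuousOn hc1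
  obtain ⟨C₂, hC₂⟩ := (isCompact_rhombusBoundary hh).exists_bound_of_continuousOn hc2
  have h1 := rhombusIntegral_sub hh (hc1.mono sdiff_subset) (fun w hw => hC₁ w hw.1)
    (hc2.mono sdiff_subset) (fun w hw => hC₂ w hw.1)
  rw [rhombusIntegral_congr hh (g₂ := dslope f ζ), h0] at h1
  · rw [sub_eq_zero.1 h1.symm]
    exact rhombusIntegral_smul_const h (fun w => (w - ζ)⁻¹) (f ζ)
  · intro w hw
    have hne : w ≠ ζ := fun H => hB (H ▸ hw.1)
    rw [dslope_of_ne _ hne, slope_def_module, smul_eq_mul, mul_sub]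

theorem flatFn_conj (p : ℕ) (w : ℂ) :
    flatFn p ((starRingEnd ℂ) w) = (starRingEnd ℂ) (flatFn p w) := by
  by_cases h1 : w = 1
  · simp [h1, flatFn_one]
  by_cases h2 : w = -1
  · simp [h2, flatFn_neg_one]
  rw [flatFn_of_ne h1 h2, flatFn_of_ne, ← Complex.exp_conj]
  · simp
  · intro H
    exact h1 (by simpa using congrArg (starRingEnd ℂ) H)
  · intro H
    exact h2 (by simpa using congrArg (starRingEnd ℂ) H)

/-! ### Local resolvents and their extensions -/

section Resolvent

variable {X : Type*} [NormedAddCommGroup X] [NormedSpace ℂ X] {A : X →L[ℂ] X}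

theorem sub_apply_resolvent {z : ℂ} (hz : z ∉ spectrum ℂ A) (x : X) :
    z • resolvent A z x - A (resolvent A z x) = x := by
  have h := Ring.mul_inverse_cancel _ (spectrum.notMem_iff.1 hz)
  simpa [resolvent, ContinuousLinearMap.algebraMap_apply] using DFunLike.congr_fun h x

theorem resolvent_apply_sub {z : ℂ} (hz : z ∉ spectrum ℂ A) (x : X) :
    resolvent A z (z • x - A x) = x := by
  have h := Ring.inverse_mul_cancel _ (spectrum.notMem_iff.1 hz)
  simpa [resolvent, ContinuousLinearMap.algebraMap_apply] using DFunLike.congr_fun h x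

theorem resolvent_apply_resolvent {z w : ℂ} (hz : z ∉ spectrum ℂ A) (hw : w ∉ spectrum ℂ A)
    (x : X) :
    (w - z) • resolvent A z (resolvent A w x) = resolvent A z x - resolvent A w x := by
  have h1 : resolvent A z (w • resolvent A w x - A (resolvent A w x)) = resolvent A z x := by
    rw [sub_apply_resolvent hw x]
  have h2 := resolvent_apply_sub hz (resolvent A w x)
  rw [map_sub, map_smul] at h1 h2
  rw [← h1, sub_smul]
  nth_rewrite 5 [← h2]
  abel

/-- `F` is a holomorphic extension of the local resolvent `z ↦ (z - A)⁻¹ x` to the complement of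
`E`. -/
def ExtendsResolvent (A : X →L[ℂ] X) (E : Set ℂ) (x : X) (F : ℂ → X) : Prop :=
  DifferentiableOn ℂ F Eᶜ ∧ ∀ z ∉ spectrum ℂ A, F z = resolvent A z x

/-- Near `z`, every extended local resolvent is bounded in terms of the norm of the vector. -/
def LocallyControlled (A : X →L[ℂ] X) (E : Set ℂ) (z : ℂ) : Prop :=
  ∃ C : ℝ, ∀ᶠ ζ in 𝓝 z, ∀ x F, ExtendsResolvent A E x F → ‖F ζ‖ ≤ C * ‖x‖

theorem ExtendsResolvent.sub {E : Set ℂ} {x y : X} {F G : ℂ → X} (hF : ExtendsResolvent A E x F)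
    (hG : ExtendsResolvent A E y G) : ExtendsResolvent A E (x - y) (F - G) :=
  ⟨hF.1.sub hG.1, fun z hz => by rw [Pi.sub_apply, hF.2 z hz, hG.2 z hz, map_sub]⟩

/-- The constant in `LocallyControlled` is chosen before the vector and its extension, so finitely
many neighbourhoods give one constant for all of them. -/
theorem IsCompact.exists_bound_of_locallyControlled {E K : Set ℂ} (hK : IsCompact K)
    (h : ∀ z ∈ K, LocallyControlled A E z) :
    ∃ C : ℝ, ∀ ζ ∈ K, ∀ x F, ExtendsResolvent A E x F → ‖F ζ‖ ≤ C * ‖x‖ := by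
  refine hK.induction_on (p := fun S => ∃ C : ℝ, ∀ ζ ∈ S, ∀ x F, ExtendsResolvent A E x F →
    ‖F ζ‖ ≤ C * ‖x‖) ⟨0, by simp⟩ (fun s t hst ⟨C, hC⟩ => ⟨C, fun ζ hζ => hC ζ (hst hζ)⟩) ?_ ?_
  · rintro s t ⟨C, hC⟩ ⟨D, hD⟩
    refine ⟨max C D, fun ζ hζ x F hF => ?_⟩
    rcases hζ with hζ | hζ
    · exact (hC ζ hζ x F hF).trans (by gcongr; exact le_max_left _ _)
    · exact (hD ζ hζ x F hF).trans (by gcongr; exact le_max_right _ _)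
  · intro z hz
    obtain ⟨C, hC⟩ := h z hz
    exact ⟨_, mem_nhdsWithin_of_mem_nhds hC, C, fun ζ hζ => hζ⟩

variable [CompleteSpace X]

theorem differentiableAt_resolvent_apply {z : ℂ} (hz : z ∉ spectrum ℂ A) (x : X) :
    DifferentiableAt ℂ (fun z => resolvent A z x) z := by
  have h := (spectrum.hasDerivAt_resolvent_const_left (a := A) (k := z)
    (by simpa [spectrum] using hz)).differentiableAt
  exact ((ContinuousLinearMap.apply ℂ X x).differentiableAt).comp z h

theorem isOpen_compl_spectrum : IsOpen (spectrum ℂ A)ᶜ := (spectrum.isClosed A).isOpen_compl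

theorem continuousOn_resolvent_apply (x : X) :
    ContinuousOn (fun z => resolvent A z x) (spectrum ℂ A)ᶜ := fun _ hz =>
  (differentiableAt_resolvent_apply hz x).continuousAt.continuousWithinAt

/-- If every local resolvent has a limit at `l`, then `l` is not in the spectrum. -/
theorem notMem_spectrum_of_tendsto {l : ℂ} (hl : l ∈ closure (spectrum ℂ A)ᶜ)
    (H : ∀ x : X, ∃ y, Tendsto (fun z => resolvent A z x) (𝓝[(spectrum ℂ A)ᶜ] l) (𝓝 y)) :
    l ∉ spectrum ℂ A := by
  have hne : (𝓝[(spectrum ℂ A)ᶜ] l).NeBot := mem_closure_iff_nhdsWithin_neBot.1 hl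
  have hid : Tendsto (fun z : ℂ => z) (𝓝[(spectrum ℂ A)ᶜ] l) (𝓝 l) := nhdsWithin_le_nhds
  rw [spectrum.notMem_iff, ContinuousLinearMap.isUnit_iff_bijective]
  have happ : ∀ x, (algebraMap ℂ (X →L[ℂ] X) l - A) x = l • x - A x := fun x => by
    simp [ContinuousLinearMap.algebraMap_apply]
  constructor
  · rw [injective_iff_map_eq_zero]
    intro x hx
    rw [happ] at hx
    obtain ⟨y, hy⟩ := H x
    -- If Ax = lx, then (z - l)(z - A)⁻¹x = x for all regular z. A finite limit of the local
    -- resolvent forces x = 0.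
    have h1 := (hid.sub_const l).smul hy
    rw [sub_self, zero_smul] at h1
    refine tendsto_nhds_unique (tendsto_const_nhds.congr' ?_) h1
    filter_upwards [self_mem_nhdsWithin] with z hz
    have := resolvent_apply_sub hz x
    rw [show z • x - A x = (z - l) • x by rw [sub_smul]; rw [sub_eq_zero.1 hx], map_smul] at this
    exact this.symm
  · intro x
    obtain ⟨y, hy⟩ := H x
    -- The limit y of the local resolvent solves (l - A)y = x.
    refine ⟨y, ?_⟩
    rw [happ]
    have h1 := (hid.smul hy).sub ((A.continuous.tendsto y).comp hy)
    refine tendsto_nhds_unique h1 (tendsto_const_nhds.congr' ?_)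
    filter_upwards [self_mem_nhdsWithin] with z hz
    exact (sub_apply_resolvent hz x).symm

theorem locallyControlled_of_notMem_spectrum {z : ℂ} (hz : z ∉ spectrum ℂ A) (E : Set ℂ) :
    LocallyControlled A E z := by
  have h := (spectrum.hasDerivAt_resolvent_const_left (a := A) (k := z)
    (by simpa [spectrum] using hz)).continuousAt.norm
  refine ⟨‖resolvent A z‖ + 1, ?_⟩
  filter_upwards [isOpen_compl_spectrum.mem_nhds hz, h.eventually_lt_const (lt_add_one _)] with
    ζ h1 h2 x F hF
  rw [hF.2 ζ h1]
  exact (ContinuousLinearMap.le_opNorm _ _).trans (by gcongr)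

/-- This is the maximum principle. `V` may contain any part of the spectrum off `E`, because an
extension F is holomorphic there; no growth assumption inside `V` is needed. -/
theorem locallyControlled_of_frontier {E V : Set ℂ} (hV : IsOpen V) (hVb : Bornology.IsBounded V)
    (hVE : closure V ⊆ Eᶜ) (h : ∀ z ∈ frontier V, LocallyControlled A E z) {z : ℂ} (hz : z ∈ V) :
    LocallyControlled A E z := by
  have hK : IsCompact (frontier V) := (hVb.isCompact_closure).of_isClosed_subset isClosed_frontier
    frontier_subset_closure
  obtain ⟨C, hC⟩ := hK.exists_bound_of_locallyControlled h
  refine ⟨C, ?_⟩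
  filter_upwards [hV.mem_nhds hz] with ζ hζ x F hF
  refine Complex.norm_le_of_forall_mem_frontier_norm_le hVb
    ⟨hF.1.mono (subset_closure.trans hVE), hF.1.continuousOn.mono hVE⟩
    (fun w hw => hC w hw x F hF) (subset_closure hζ)

/-- The difference of two extensions extends the local resolvent of the difference vector. Local
control thus turns norm convergence of vectors into locally uniform convergence of their extensions,
and the limit is holomorphic. -/
theorem isClosed_setOf_extendsResolvent {E : Set ℂ} (hE : IsClosed E)
    (hEσ : E ⊆ spectrum ℂ A) (h : ∀ z ∉ E, LocallyControlled A E z) :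
    IsClosed {x : X | ∃ F, ExtendsResolvent A E x F} := by
  refine IsSeqClosed.isClosed fun x y hx hy => ?_
  choose F hF using hx
  have hlim : ∀ z ∉ E, ∃ l, Tendsto (fun n => F n z) atTop (𝓝 l) := by
    intro z hz
    obtain ⟨C, hC⟩ := h z hz
    have hz' := hC.self_of_nhds
    refine cauchySeq_tendsto_of_complete (Metric.cauchySeq_iff.2 fun ε hε => ?_)
    obtain ⟨N, hN⟩ := Metric.cauchySeq_iff.1 hy.cauchySeq (ε / (|C| + 1)) (by positivity)
    refine ⟨N, fun m hm n hn => ?_⟩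
    have h1 := hN m hm n hn
    rw [dist_eq_norm, lt_div_iff₀ (by positivity)] at h1
    rw [dist_eq_norm]
    refine (hz' _ _ ((hF m).sub (hF n))).trans_lt (lt_of_le_of_lt ?_ h1)
    rw [mul_comm]
    gcongr
    linarith [le_abs_self C]
  choose! G hG using hlim
  have hunif : TendstoLocallyUniformlyOn F G atTop Eᶜ := by
    rw [Metric.tendstoLocallyUniformlyOn_iff]
    intro ε hε z hz
    obtain ⟨C, hC⟩ := h z hz
    refine ⟨_, inter_mem_nhdsWithin _ hC, ?_⟩
    have hy0 : Tendsto (fun n => C * ‖y - x n‖) atTop (𝓝 0) := by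
      simpa using ((hy.const_sub y).norm).const_mul C
    filter_upwards [hy0.eventually_lt_const hε] with n hn ζ hζ
    rw [dist_eq_norm]
    refine lt_of_le_of_lt ?_ hn
    refine le_of_tendsto_of_tendsto (((hG ζ hζ.1).sub_const (F n ζ)).norm)
      (((hy.sub_const (x n)).norm).const_mul C) (Eventually.of_forall fun m => ?_)
    exact hζ.2 _ _ ((hF m).sub (hF n))
  refine ⟨G, hunif.differentiableOn (Eventually.of_forall fun n => (hF n).1) hE.isOpen_compl,
    fun z hz => ?_⟩
  refine tendsto_nhds_unique (hG z fun H => hz (hEσ H)) ?_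
  simp only [fun n => (hF n).2 z hz]
  exact ((resolvent A z).continuous.tendsto y).comp hy

/-! ### The tamed resolvent on a rhombus -/

section Rhombus

variable {m d : ℂ} {h : ℝ} {p : ℕ} {C : ℝ}

/-- Extended local resolvents are controlled inside a rhombus on whose boundary the resolvent is
tamed by the flat function. -/
theorem locallyControlled_of_rhombus {E : Set ℂ} (hd : d ≠ 0) (hh : 0 < h) (hp0 : p ≠ 0)
    (hp : 4 * p * h ≤ 1)
    (hσ : ∀ w ∈ rhombusBoundary h \ {1, -1}, m + d * w ∉ spectrum ℂ A)
    (hC : ∀ w ∈ rhombusBoundary h \ {1, -1}, ‖flatFn p w‖ * ‖resolvent A (m + d * w)‖ ≤ C)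
    (hE : ∀ w ∈ closedRhombus h, m + d * w ∉ E) {w₀ : ℂ} (hw₀ : w₀ ∈ openRhombus h) :
    LocallyControlled A E (m + d * w₀) := by
  have hO := (isOpen_openRhombus h).mem_nhds hw₀
  -- The product of the flat function with F vanishes at ±1 and is bounded by C‖x‖ on the rest of
  -- the boundary, where F is the resolvent. The maximum principle carries the bound inside. The
  -- flat function has no zeros there, so it can be divided out locally.
  have hbound : ∀ x F, ExtendsResolvent A E x F → ∀ w ∈ openRhombus h,
      ‖flatFn p w‖ * ‖F (m + d * w)‖ ≤ |C| * ‖x‖ := by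
    intro x F hF w hw
    rw [← norm_smul]
    refine Complex.norm_le_of_forall_mem_frontier_norm_le
      (f := fun w => flatFn p w • F (m + d * w)) (U := openRhombus h)
      ((isCompact_closedRhombus hh).isBounded.subset (openRhombus_subset_closedRhombus h))
      ⟨?_, ?_⟩ (fun w hw => ?_) (subset_closure hw)
    · refine (differentiableOn_flatFn h p).smul (hF.1.comp (by fun_prop) fun w hw => ?_)
      exact hE w (openRhombus_subset_closedRhombus h hw)
    · refine ContinuousOn.mono ?_ (closure_openRhombus_subset h)
      exact (continuousOn_flatFn hp0 hp hh).smul (hF.1.continuousOn.comp (by fun_prop) hE)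
    · have hwB := frontier_openRhombus_subset h hw
      by_cases h1 : w ∈ ({1, -1} : Set ℂ)
      · have : flatFn p w = 0 := by
          rcases h1 with rfl | rfl
          · exact flatFn_one p
          · exact flatFn_neg_one p
        rw [this, zero_smul, norm_zero]
        positivity
      · rw [norm_smul, hF.2 _ (hσ w ⟨hwB, h1⟩)]
        calc _ ≤ ‖flatFn p w‖ * (‖resolvent A (m + d * w)‖ * ‖x‖) := by
              gcongr; exact ContinuousLinearMap.le_opNorm _ _
          _ ≤ C * ‖x‖ := by
              rw [← mul_assoc]; gcongr; exact hC w ⟨hwB, h1⟩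
          _ ≤ |C| * ‖x‖ := by gcongr; exact le_abs_self C
  have hne := ne_of_mem_openRhombus hw₀
  have hf0 : 0 < ‖flatFn p w₀‖ := norm_pos_iff.2 (flatFn_ne_zero hne.1 hne.2)
  have hev : ∀ᶠ w in 𝓝 w₀, w ∈ openRhombus h ∧ ‖flatFn p w₀‖ / 2 < ‖flatFn p w‖ :=
    Filter.Eventually.and hO ((differentiableAt_flatFn hne.1
      hne.2).continuousAt.norm.eventually_const_lt (half_lt_self hf0))
  have htend : Tendsto (fun z => (z - m) / d) (𝓝 (m + d * w₀)) (𝓝 w₀) := by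
    have : Continuous fun z : ℂ => (z - m) / d := by fun_prop
    convert this.tendsto (m + d * w₀) using 2
    field_simp
    ring
  refine ⟨|C| / (‖flatFn p w₀‖ / 2), ?_⟩
  filter_upwards [htend.eventually hev] with z hz x F hF
  have h1 := hbound x F hF _ hz.1
  rw [show m + d * ((z - m) / d) = z by field_simp; ring] at h1
  rw [div_mul_eq_mul_div, le_div_iff₀ (by positivity), mul_comm]
  refine le_trans ?_ h1
  gcongr
  exact hz.2.le

/-- The vector obtained by integrating the tamed resolvent along the boundary of the rhombus. -/
noncomputable def rhombusVector (A : X →L[ℂ] X) (m d : ℂ) (h : ℝ) (p : ℕ) (x : X) : X :=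
  rhombusIntegral h fun w => flatFn p w • resolvent A (m + d * w) x

theorem continuousOn_flatFn_smul_resolvent (hh : 0 < h) (hp0 : p ≠ 0) (hp : 4 * p * h ≤ 1)
    (hσ : ∀ w ∈ rhombusBoundary h \ {1, -1}, m + d * w ∉ spectrum ℂ A) (x : X) :
    ContinuousOn (fun w => flatFn p w • resolvent A (m + d * w) x)
      (rhombusBoundary h \ {1, -1}) := by
  refine ((continuousOn_flatFn hp0 hp hh).mono fun w hw =>
    rhombusBoundary_subset_closedRhombus h hw.1).smul ?_
  exact (continuousOn_resolvent_apply x).comp (f := fun w => m + d * w) (by fun_prop) hσ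

theorem norm_flatFn_smul_resolvent_le
    (hC : ∀ w ∈ rhombusBoundary h \ {1, -1}, ‖flatFn p w‖ * ‖resolvent A (m + d * w)‖ ≤ C)
    (x : X) : ∀ w ∈ rhombusBoundary h \ {1, -1},
      ‖flatFn p w • resolvent A (m + d * w) x‖ ≤ C * ‖x‖ := by
  intro w hw
  rw [norm_smul]
  calc _ ≤ ‖flatFn p w‖ * (‖resolvent A (m + d * w)‖ * ‖x‖) := by
        gcongr; exact ContinuousLinearMap.le_opNorm _ _
    _ ≤ C * ‖x‖ := by rw [← mul_assoc]; gcongr; exact hC w hw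

/-- This is the resolvent identity under the integral sign. The scalar coefficient is a Cauchy
integral of the flat function: it vanishes for ζ outside the rhombus and is a nonzero number for ζ
inside. The other term is a Cauchy transform, holomorphic off the boundary. -/
theorem smul_resolvent_rhombusVector (hd : d ≠ 0) (hh : 0 < h) (hp0 : p ≠ 0) (hp : 4 * p * h ≤ 1)
    (hσ : ∀ w ∈ rhombusBoundary h \ {1, -1}, m + d * w ∉ spectrum ℂ A)
    (hC : ∀ w ∈ rhombusBoundary h \ {1, -1}, ‖flatFn p w‖ * ‖resolvent A (m + d * w)‖ ≤ C)
    {ζ : ℂ} (hζ : ζ ∉ rhombusBoundary h) (hζσ : m + d * ζ ∉ spectrum ℂ A) (x : X) :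
    d • resolvent A (m + d * ζ) (rhombusVector A m d h p x) =
      rhombusIntegral h (fun w => (w - ζ)⁻¹ * flatFn p w) • resolvent A (m + d * ζ) x -
      rhombusIntegral h (fun w => (w - ζ)⁻¹ • flatFn p w • resolvent A (m + d * w) x) := by
  have hc := continuousOn_flatFn_smul_resolvent hh hp0 hp hσ x
  have hb := norm_flatFn_smul_resolvent_le hC x
  have hinv := continuousOn_inv_sub_rhombusBoundary hζ
  have hcf : ContinuousOn (fun w => (w - ζ)⁻¹ * flatFn p w) (rhombusBoundary h) :=
    hinv.mul ((continuousOn_flatFn hp0 hp hh).mono (rhombusBoundary_subset_closedRhombus h))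
  obtain ⟨C₁, hC₁⟩ := (isCompact_rhombusBoundary hh).exists_bound_of_continuousOn hinv
  obtain ⟨C₂, hC₂⟩ := (isCompact_rhombusBoundary hh).exists_bound_of_continuousOn hcf
  rw [← map_smul, ← rhombusIntegral_smul_const, ← rhombusIntegral_sub hh
    (C₁ := C₂ * ‖resolvent A (m + d * ζ) x‖) (C₂ := C₁ * (C * ‖x‖))]
  · rw [map_smul, rhombusVector, ContinuousLinearMap.map_rhombusIntegral _ hh hc hb]
    rw [show ∀ y : X, d • y = (d • ContinuousLinearMap.id ℂ X) y from fun y => rfl,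
      ContinuousLinearMap.map_rhombusIntegral _ hh (C := ‖resolvent A (m + d * ζ)‖ * (C * ‖x‖))]
    · refine rhombusIntegral_congr hh fun w hw => ?_
      have hne : w - ζ ≠ 0 := fun H => hζ (sub_eq_zero.1 H ▸ hw.1)
      have hid := resolvent_apply_resolvent hζσ (hσ w hw) x
      rw [show m + d * w - (m + d * ζ) = d * (w - ζ) by ring] at hid
      change d • resolvent A (m + d * ζ) (flatFn p w • resolvent A (m + d * w) x) = _
      have : resolvent A (m + d * w) x = resolvent A (m + d * ζ) x -
        (d * (w - ζ)) • resolvent A (m + d * ζ) (resolvent A (m + d * w) x) := by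
        rw [hid]; abel
      rw [smul_smul _ _ (resolvent A (m + d * w) x)]
      nth_rewrite 2 [this]
      rw [smul_sub, sub_sub_cancel, smul_smul, map_smul, smul_smul]
      congr 1
      field_simp
    · exact (resolvent A (m + d * ζ)).continuous.comp_continuousOn hc
    · intro w hw
      exact (ContinuousLinearMap.le_opNorm _ _).trans (by gcongr; exact hb w hw)
  · exact (hcf.mono sdiff_subset).smul continuousOn_const
  · intro w hw
    rw [norm_smul]
    gcongr
    exact hC₂ w hw.1
  · exact (hinv.mono sdiff_subset).smul hc
  · intro w hw
    rw [norm_smul]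
    exact mul_le_mul (hC₁ w hw.1) (hb w hw) (norm_nonneg _) ((norm_nonneg _).trans (hC₁ w hw.1))

/-- The local resolvent of `rhombusVector` extends off the part of the spectrum inside the
rhombus. -/
theorem exists_extendsResolvent_rhombusVector (hd : d ≠ 0) (hh : 0 < h) (hp0 : p ≠ 0)
    (hp : 4 * p * h ≤ 1)
    (hσ : ∀ w ∈ rhombusBoundary h \ {1, -1}, m + d * w ∉ spectrum ℂ A)
    (hC : ∀ w ∈ rhombusBoundary h \ {1, -1}, ‖flatFn p w‖ * ‖resolvent A (m + d * w)‖ ≤ C)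
    {E : Set ℂ} (hE : ∀ w ∈ closedRhombus h, m + d * w ∈ spectrum ℂ A → m + d * w ∈ E) (x : X) :
    ∃ F, ExtendsResolvent A E (rhombusVector A m d h p x) F := by
  classical
  set G : ℂ → X := fun ζ =>
    rhombusIntegral h (fun w => (w - ζ)⁻¹ • flatFn p w • resolvent A (m + d * w) x) with hG
  have hc := continuousOn_flatFn_smul_resolvent hh hp0 hp hσ x
  have hb := norm_flatFn_smul_resolvent_le hC x
  set y := rhombusVector A m d h p x with hy
  -- Outside the rhombus the coefficient of the resolvent of x vanishes, and the local resolvent of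
  -- y is a Cauchy transform. That transform also makes sense at spectral points outside the rhombus
  -- and provides the extension there.
  have hext : ∀ z, (z - m) / d ∉ closedRhombus h → z ∉ spectrum ℂ A →
      resolvent A z y = -(d⁻¹ • G ((z - m) / d)) := by
    intro z hz hzσ
    have hzz : m + d * ((z - m) / d) = z := by field_simp; ring
    have h1 := smul_resolvent_rhombusVector hd hh hp0 hp hσ hC
      (fun H => hz (rhombusBoundary_subset_closedRhombus h H)) (by rwa [hzz]) x
    rw [hzz, rhombusIntegral_inv_mul_of_notMem hh (continuousOn_flatFn hp0 hp hh)
      (differentiableOn_flatFn h p) hz, zero_smul, zero_sub] at h1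
    rw [← smul_neg, ← h1, smul_smul, inv_mul_cancel₀ hd, one_smul]
  refine ⟨fun z => if z ∈ spectrum ℂ A then -(d⁻¹ • G ((z - m) / d)) else resolvent A z y,
    fun z hz => DifferentiableAt.differentiableWithinAt ?_, fun z hz => if_neg hz⟩
  by_cases hzσ : z ∈ spectrum ℂ A
  · have hz' : (z - m) / d ∉ closedRhombus h := by
      intro H
      have hzz : m + d * ((z - m) / d) = z := by field_simp; ring
      have := hE _ H
      rw [hzz] at this
      exact hz (this hzσ)
    have hopen : ∀ᶠ ζ in 𝓝 z, (ζ - m) / d ∉ closedRhombus h :=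
      (by fun_prop : Continuous fun ζ : ℂ => (ζ - m) / d).continuousAt.eventually
        ((isClosed_closedRhombus h).isOpen_compl.mem_nhds hz')
    have hd1 : DifferentiableAt ℂ (fun z => -(d⁻¹ • G ((z - m) / d))) z := by
      refine DifferentiableAt.fun_neg (DifferentiableAt.fun_const_smul ?_ _)
      have := differentiableAt_rhombusIntegral_inv_smul hh hc hb
        (fun H => hz' (rhombusBoundary_subset_closedRhombus h H))
      exact this.comp z (f := fun z : ℂ => (z - m) / d) (by fun_prop)
    refine hd1.congr_of_eventuallyEq ?_
    filter_upwards [hopen] with ζ hζ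
    split_ifs with h1
    · rfl
    · exact hext ζ hζ h1
  · refine (differentiableAt_resolvent_apply hzσ y).congr_of_eventuallyEq ?_
    filter_upwards [isOpen_compl_spectrum.mem_nhds hzσ] with ζ hζ
    exact if_neg hζ

/-- If a spectral value inside the rhombus is approximable by regular points, then some
`rhombusVector` is nonzero. -/
theorem exists_rhombusVector_ne_zero (hd : d ≠ 0) (hh : 0 < h) (hp0 : p ≠ 0)
    (hp : 4 * p * h ≤ 1)
    (hσ : ∀ w ∈ rhombusBoundary h \ {1, -1}, m + d * w ∉ spectrum ℂ A)
    (hC : ∀ w ∈ rhombusBoundary h \ {1, -1}, ‖flatFn p w‖ * ‖resolvent A (m + d * w)‖ ≤ C)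
    {w₀ : ℂ} (hw₀ : w₀ ∈ openRhombus h) (hs : m + d * w₀ ∈ spectrum ℂ A)
    (hcl : m + d * w₀ ∈ closure (spectrum ℂ A)ᶜ) :
    ∃ x, rhombusVector A m d h p x ≠ 0 := by
  -- If all these vectors vanish, the identity inside the rhombus expresses the local resolvent of
  -- every x as a Cauchy transform divided by a nonvanishing continuous function. It then has a
  -- limit at the given spectral point.
  by_contra! H
  refine notMem_spectrum_of_tendsto hcl (fun x => ?_) hs
  have hc := continuousOn_flatFn_smul_resolvent hh hp0 hp hσ x
  have hb := norm_flatFn_smul_resolvent_le hC x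
  set G : ℂ → X := fun ζ =>
    rhombusIntegral h (fun w => (w - ζ)⁻¹ • flatFn p w • resolvent A (m + d * w) x) with hG
  set c : ℂ → ℂ := fun ζ => rhombusIntegral h (fun w => (w - ζ)⁻¹) with hcdef
  have hB := notMem_rhombusBoundary_of_mem_openRhombus hw₀
  have hGc : ContinuousAt G w₀ :=
    (differentiableAt_rhombusIntegral_inv_smul hh hc hb hB).continuousAt
  have hcc : ContinuousAt c w₀ := by
    have := (differentiableAt_rhombusIntegral_inv_smul hh (g := fun _ => (1 : ℂ)) (C := 1)
      continuousOn_const (fun _ _ => by simp) hB).continuousAt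
    simpa only [smul_eq_mul, mul_one] using this
  have hne := ne_of_mem_openRhombus hw₀
  have hfc : ContinuousAt (flatFn p) w₀ := (differentiableAt_flatFn hne.1 hne.2).continuousAt
  have hcont : ContinuousAt (fun ζ => (c ζ * flatFn p ζ)⁻¹ • G ζ) w₀ :=
    ((hcc.mul hfc).inv₀ (mul_ne_zero (rhombusIntegral_inv_ne_zero hh hw₀)
      (flatFn_ne_zero hne.1 hne.2))).smul hGc
  have htend : Tendsto (fun z => (z - m) / d) (𝓝 (m + d * w₀)) (𝓝 w₀) := by
    have : Continuous fun z : ℂ => (z - m) / d := by fun_prop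
    convert this.tendsto (m + d * w₀) using 2
    field_simp
    ring
  refine ⟨_, ((hcont.tendsto.comp htend).mono_left nhdsWithin_le_nhds).congr' ?_⟩
  filter_upwards [self_mem_nhdsWithin, nhdsWithin_le_nhds
    (htend.eventually ((isOpen_openRhombus h).mem_nhds hw₀))] with z hz hzO
  have hzz : m + d * ((z - m) / d) = z := by field_simp; ring
  have h1 := smul_resolvent_rhombusVector hd hh hp0 hp hσ hC
    (notMem_rhombusBoundary_of_mem_openRhombus hzO) (by rwa [hzz]) x
  have hne' := ne_of_mem_openRhombus hzO
  rw [hzz, H x, map_zero, smul_zero, rhombusIntegral_inv_mul_of_mem hh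
    (continuousOn_flatFn hp0 hp hh) (differentiableOn_flatFn h p) hzO, eq_comm, sub_eq_zero] at h1
  change (c ((z - m) / d) * flatFn p ((z - m) / d))⁻¹ • G ((z - m) / d) = _
  rw [hG]
  simp only
  rw [← h1, smul_smul, inv_mul_cancel₀, one_smul]
  exact mul_ne_zero (rhombusIntegral_inv_ne_zero hh hzO) (flatFn_ne_zero hne'.1 hne'.2)

end Rhombus

end Resolvent

/-! ### Rhombi over short chords of the arc -/

section Geometry

/-- The midpoint of a chord of a curve. -/
noncomputable def chordMid (γ : ℝ → ℂ) (t₁ t₂ : ℝ) : ℂ := (γ t₁ + γ t₂) / 2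

/-- Half of the difference of the endpoints of a chord of a curve. -/
noncomputable def chordHalf (γ : ℝ → ℂ) (t₁ t₂ : ℝ) : ℂ := (γ t₂ - γ t₁) / 2

/-- The rhombus over the chord from `γ t₁` to `γ t₂` lies in `B`, encloses the subarc between these
points, meets the set `σ` only there, and its edges are transversal to the curve. -/
structure RhombusFits (σ : Set ℂ) (γ : ℝ → ℂ) (h : ℝ) (B : Set ℂ) (t₁ t₂ : ℝ) : Prop where
  half_ne : chordHalf γ t₁ t₂ ≠ 0
  mem_nhd : ∀ w ∈ closedRhombus h, chordMid γ t₁ t₂ + chordHalf γ t₁ t₂ * w ∈ B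
  mem_arc : ∀ w ∈ closedRhombus h, chordMid γ t₁ t₂ + chordHalf γ t₁ t₂ * w ∈ σ →
    ∃ t ∈ Icc t₁ t₂, γ t = chordMid γ t₁ t₂ + chordHalf γ t₁ t₂ * w
  mem_rhombus : ∀ t ∈ Ioo t₁ t₂, ∃ w ∈ openRhombus h,
    γ t = chordMid γ t₁ t₂ + chordHalf γ t₁ t₂ * w
  notMem_boundary : ∀ w ∈ rhombusBoundary h \ {1, -1},
    chordMid γ t₁ t₂ + chordHalf γ t₁ t₂ * w ∉ σ
  transversal : ∀ e f : ℝ, |e| = 1 → |f| = 1 → ∀ t ∈ Icc t₁ t₂,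
    ¬ ∃ r : ℝ, chordHalf γ t₁ t₂ * (f * h * Complex.I - e) = r • deriv γ t

/-- Both D and d are multiples of g up to relative error ε. The two errors add up to 2ε|τ||g|, and ε
≤ 1/2 gives |d| ≥ |g|L/4, hence the factor 4. -/
theorem norm_div_sub_le {D d g : ℂ} {τ L ε : ℝ} (hg : g ≠ 0) (hL : 0 < L)
    (hε : ε ≤ 1 / 2) (h1 : ‖D - τ * g‖ ≤ ε * ‖g‖ * |τ|)
    (h2 : ‖d - (L / 2 : ℝ) * g‖ ≤ ε * ‖g‖ * (L / 2)) :
    d ≠ 0 ∧ ‖D / d - (2 * τ / L : ℝ)‖ ≤ 4 * ε * |2 * τ / L| := by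
  have hg' : 0 < ‖g‖ := norm_pos_iff.2 hg
  have hd : ‖g‖ * (L / 4) ≤ ‖d‖ := by
    have h3 : ‖((L / 2 : ℝ) : ℂ) * g‖ = L / 2 * ‖g‖ := by
      rw [norm_mul, Complex.norm_real, Real.norm_of_nonneg (by positivity)]
    have h4 := norm_sub_norm_le (((L / 2 : ℝ) : ℂ) * g) (((L / 2 : ℝ) : ℂ) * g - d)
    rw [sub_sub_cancel, norm_sub_rev (((L / 2 : ℝ) : ℂ) * g) d, h3] at h4
    have h5 : ε * ‖g‖ * (L / 2) ≤ 1 / 2 * ‖g‖ * (L / 2) := by gcongr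
    linarith
  have hd0 : 0 < ‖d‖ := lt_of_lt_of_le (by positivity) hd
  have hd1 : d ≠ 0 := norm_pos_iff.1 hd0
  have hε0 : 0 ≤ ε := by
    by_contra! H
    have : ε * ‖g‖ * (L / 2) < 0 := by
      have : 0 < ‖g‖ * (L / 2) := by positivity
      nlinarith
    linarith [norm_nonneg (d - ((L / 2 : ℝ) : ℂ) * g)]
  refine ⟨hd1, ?_⟩
  have hL' : (L : ℂ) ≠ 0 := by exact_mod_cast hL.ne'
  have e1 : D / d - (2 * τ / L : ℝ) =
      ((D - τ * g) - (2 * τ / L : ℝ) * (d - (L / 2 : ℝ) * g)) / d := by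
    push_cast
    field_simp
    ring
  rw [e1, norm_div, div_le_iff₀ hd0]
  have e2 : |2 * τ / L| = 2 * |τ| / L := by
    rw [abs_div, abs_mul, abs_of_pos hL, abs_two]
  calc ‖(D - τ * g) - (2 * τ / L : ℝ) * (d - (L / 2 : ℝ) * g)‖
      ≤ ‖D - τ * g‖ + ‖((2 * τ / L : ℝ) : ℂ) * (d - (L / 2 : ℝ) * g)‖ := norm_sub_le _ _
    _ ≤ ε * ‖g‖ * |τ| + |2 * τ / L| * (ε * ‖g‖ * (L / 2)) := by
        rw [norm_mul, Complex.norm_real, Real.norm_eq_abs]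
        gcongr
    _ = 4 * ε * |2 * τ / L| * (‖g‖ * (L / 4)) := by rw [e2]; field_simp; ring
    _ ≤ 4 * ε * |2 * τ / L| * ‖d‖ := by gcongr

theorem abs_im_lt_of_norm_sub_le {u : ℂ} {a h η : ℝ} (hh : 0 < h) (hη : η < h * (1 - η))
    (ha : 0 < a) (hu : ‖u - a‖ ≤ η * |a|) : |u.im| < h * u.re := by
  rw [abs_of_pos ha] at hu
  have h1 := (Complex.abs_re_le_norm (u - a)).trans hu
  have h2 := (Complex.abs_im_le_norm (u - a)).trans hu
  simp only [Complex.sub_re, Complex.sub_im, Complex.ofReal_re, Complex.ofReal_im,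
    sub_zero] at h1 h2
  have h3 := (abs_le.1 h1).1
  have h4 : h * (a - η * a) ≤ h * u.re := by
    apply mul_le_mul_of_nonneg_left _ hh.le
    linarith
  nlinarith

theorem re_neg_of_norm_sub_le {u : ℂ} {a η : ℝ} (hη : η < 1) (ha : a < 0)
    (hu : ‖u - a‖ ≤ η * |a|) : u.re < 0 := by
  rw [abs_of_neg ha] at hu
  have h1 := (Complex.abs_re_le_norm (u - a)).trans hu
  simp only [Complex.sub_re, Complex.ofReal_re] at h1
  have h3 := (abs_le.1 h1).2
  nlinarith

/-- The edges of the rhombus have slope ±h, whereas u is so close to the positive axis that its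
slope is smaller than h in absolute value. -/
theorem not_exists_smul_eq {u : ℂ} {a h η e f : ℝ} (hh : 0 < h) (hη : η < h * (1 - η)) (ha : 0 < a)
    (hu : ‖u - a‖ ≤ η * |a|) (he : |e| = 1) (hf : |f| = 1) :
    ¬ ∃ r : ℝ, (f * h * Complex.I - e : ℂ) = r * u := by
  rintro ⟨r, hr⟩
  have h1 := abs_im_lt_of_norm_sub_le hh hη ha hu
  have hre := congrArg Complex.re hr
  have him := congrArg Complex.im hr
  simp at hre him
  have h2 : |u.re| * |r| = 1 := by rw [mul_comm, ← abs_mul, ← hre, abs_neg, he]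
  have h3 : |r| * |u.im| = h := by rw [← abs_mul, ← him, abs_mul, hf, one_mul, abs_of_pos hh]
  have hr0 : 0 < |r| := by
    rw [abs_pos]; rintro rfl; simp at h2
  have h4 := mul_lt_mul_of_pos_left h1 hr0
  have h5 := le_abs_self u.re
  nlinarith [mul_pos hh hr0]

/-- The rhombus over a short chord of a nearly straight curve. -/
theorem chord_rhombus {γ : ℝ → ℂ} {S : Set ℝ} {g : ℂ} {h ε : ℝ} (hh : 0 < h)
    (hh1 : h ≤ 1) (hε : 16 * ε ≤ h) (hε0 : 0 < ε) (hg : g ≠ 0)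
    (hS : ∀ s ∈ S, ∀ t ∈ S, ‖γ t - γ s - (t - s : ℝ) * g‖ ≤ ε * ‖g‖ * |t - s|)
    (hS' : ∀ t ∈ S, ‖deriv γ t - g‖ ≤ ε * ‖g‖) {t₁ t₂ : ℝ} (h1 : t₁ ∈ S) (h2 : t₂ ∈ S)
    (h12 : t₁ < t₂) :
    chordHalf γ t₁ t₂ ≠ 0 ∧
    (∀ t ∈ S, t ∈ Ioo t₁ t₂ → (γ t - chordMid γ t₁ t₂) / chordHalf γ t₁ t₂ ∈ openRhombus h) ∧
    (∀ t ∈ S, (γ t - chordMid γ t₁ t₂) / chordHalf γ t₁ t₂ ∈ closedRhombus h → t ∈ Icc t₁ t₂) ∧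
    (∀ e f : ℝ, |e| = 1 → |f| = 1 → ∀ t ∈ S,
      ¬ ∃ r : ℝ, chordHalf γ t₁ t₂ * (f * h * Complex.I - e) = r • deriv γ t) := by
  set L := t₂ - t₁ with hL
  have hL0 : 0 < L := sub_pos.2 h12
  set d := chordHalf γ t₁ t₂ with hd
  -- From 16ε ≤ h ≤ 1: the left side is at most h/4 and the right side at least 3h/4.
  have hη : 4 * ε < h * (1 - 4 * ε) := by nlinarith
  have hη1 : 4 * ε < 1 := by linarith
  have hdg : ‖d - (L / 2 : ℝ) * g‖ ≤ ε * ‖g‖ * (L / 2) := by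
    have := hS t₁ h1 t₂ h2
    rw [abs_of_pos hL0] at this
    have e : d - (L / 2 : ℝ) * g = (γ t₂ - γ t₁ - (L : ℝ) * g) / 2 := by
      rw [hd, chordHalf]; push_cast; ring
    rw [e, norm_div, Complex.norm_ofNat]
    linarith
  have key : ∀ s ∈ S, ∀ t ∈ S, d ≠ 0 ∧
      ‖(γ t - γ s) / d - (2 * (t - s) / L : ℝ)‖ ≤ 4 * ε * |2 * (t - s) / L| := fun s hs t ht =>
    norm_div_sub_le hg hL0 (by linarith) (hS s hs t ht) hdg
  have hd0 : d ≠ 0 := (key t₁ h1 t₁ h1).1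
  -- In the coordinate w of the rhombus, 1 + w and 1 - w are the chords to the two ends divided by
  -- d. Membership in the rhombus is a sector condition on these, and they are nearly the real
  -- numbers 2(t - t₁)/L and 2(t₂ - t)/L.
  have e1 : ∀ t, 1 + (γ t - chordMid γ t₁ t₂) / d = (γ t - γ t₁) / d := by
    intro t
    have : γ t - γ t₁ = d + (γ t - chordMid γ t₁ t₂) := by rw [hd, chordHalf, chordMid]; ring
    rw [this, add_div, div_self hd0]
  have e2 : ∀ t, 1 - (γ t - chordMid γ t₁ t₂) / d = (γ t₂ - γ t) / d := by
    intro t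
    have : γ t₂ - γ t = d - (γ t - chordMid γ t₁ t₂) := by rw [hd, chordHalf, chordMid]; ring
    rw [this, sub_div d, div_self hd0]
  have r1 : ∀ t, 1 + ((γ t - chordMid γ t₁ t₂) / d).re = ((γ t - γ t₁) / d).re := fun t => by
    rw [← e1]; simp
  have r2 : ∀ t, 1 - ((γ t - chordMid γ t₁ t₂) / d).re = ((γ t₂ - γ t) / d).re := fun t => by
    rw [← e2]; simp
  have i1 : ∀ t, ((γ t - chordMid γ t₁ t₂) / d).im = ((γ t - γ t₁) / d).im := fun t => by
    rw [← e1]; simp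
  have i2 : ∀ t, |((γ t - chordMid γ t₁ t₂) / d).im| = |((γ t₂ - γ t) / d).im| := fun t => by
    rw [← e2]; simp
  refine ⟨hd0, fun t ht htt => ?_, fun t ht hw => ?_, fun e f he hf t ht => ?_⟩
  · rw [mem_openRhombus_iff hh]
    constructor
    · rw [r1, i1]
      refine abs_im_lt_of_norm_sub_le hh hη ?_ (key t₁ h1 t ht).2
      have := sub_pos.2 htt.1
      positivity
    · rw [r2, i2]
      refine abs_im_lt_of_norm_sub_le hh hη ?_ (key t ht t₂ h2).2
      have := sub_pos.2 htt.2
      positivity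
  · rw [mem_closedRhombus_iff hh] at hw
    by_contra H
    rw [mem_Icc, not_and_or, not_le, not_le] at H
    rcases H with H | H
    · have := re_neg_of_norm_sub_le hη1 (div_neg_of_neg_of_pos (by linarith) hL0)
        (key t₁ h1 t ht).2
      rw [r1] at hw
      nlinarith [hw.1, abs_nonneg ((γ t - chordMid γ t₁ t₂) / d).im]
    · have := re_neg_of_norm_sub_le hη1 (div_neg_of_neg_of_pos (by linarith) hL0)
        (key t ht t₂ h2).2
      rw [r2] at hw
      nlinarith [hw.2, abs_nonneg ((γ t - chordMid γ t₁ t₂) / d).im]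
  · rintro ⟨r, hr⟩
    -- The derivative is treated as a displacement over unit time.
    have hk := (norm_div_sub_le (D := deriv γ t) (τ := 1) hg hL0 (by linarith)
      (by simpa using hS' t ht) hdg).2
    refine not_exists_smul_eq hh hη (by positivity) hk he hf ⟨r, ?_⟩
    rw [mul_div_assoc', eq_div_iff hd0, mul_comm _ d, hr, Complex.real_smul]

/-- A Jordan arc does not return to the vicinity of its points. -/
theorem IsSmoothJordanArc.exists_dist_lt {γ : ℝ → ℂ} (hγ : IsSmoothJordanArc γ) {t₀ : ℝ}
    (ht₀ : t₀ ∈ Ioo (0 : ℝ) 1) {δ : ℝ} (hδ : 0 < δ) :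
    ∃ ε > 0, ∀ t ∈ Ioo (0 : ℝ) 1, dist (γ t) (γ t₀) < ε → |t - t₀| < δ := by
  have h1 := hγ.isEmbedding.toIsInducing.nhds_eq_comap ⟨t₀, ht₀⟩
  have h2 : {t : Ioo (0 : ℝ) 1 | |(t : ℝ) - t₀| < δ} ∈ 𝓝 (⟨t₀, ht₀⟩ : Ioo (0 : ℝ) 1) := by
    refine IsOpen.mem_nhds (isOpen_lt (by fun_prop) (by fun_prop)) ?_
    simpa using hδ
  rw [h1, (nhds_basis_ball.comap _).mem_iff] at h2
  obtain ⟨ε, hε, hsub⟩ := h2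
  exact ⟨ε, hε, fun t ht hd => hsub (a := ⟨t, ht⟩) hd⟩

theorem IsSmoothJordanArc.injOn {γ : ℝ → ℂ} (hγ : IsSmoothJordanArc γ) :
    InjOn γ (Ioo 0 1) := fun s hs t ht h => by
  have := hγ.isEmbedding.injective (a₁ := ⟨s, hs⟩) (a₂ := ⟨t, ht⟩) h
  simpa using this

theorem IsSmoothJordanArc.continuousOn {γ : ℝ → ℂ} (hγ : IsSmoothJordanArc γ) :
    ContinuousOn γ (Ioo 0 1) := hγ.contDiffOn.continuousOn

/-- Near each of its points a smooth arc is nearly straight. -/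
theorem IsSmoothJordanArc.exists_nearly_straight {γ : ℝ → ℂ} (hγ : IsSmoothJordanArc γ) {t₀ : ℝ}
    (ht₀ : t₀ ∈ Ioo (0 : ℝ) 1) {ε : ℝ} (hε : 0 < ε) :
    ∃ δ > 0, Ioo (t₀ - δ) (t₀ + δ) ⊆ Ioo 0 1 ∧
      (∀ s ∈ Ioo (t₀ - δ) (t₀ + δ), ∀ t ∈ Ioo (t₀ - δ) (t₀ + δ),
        ‖γ t - γ s - (t - s : ℝ) * deriv γ t₀‖ ≤ ε * ‖deriv γ t₀‖ * |t - s|) ∧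
      ∀ t ∈ Ioo (t₀ - δ) (t₀ + δ), ‖deriv γ t - deriv γ t₀‖ ≤ ε * ‖deriv γ t₀‖ := by
  have hO : Ioo (0 : ℝ) 1 ∈ 𝓝 t₀ := isOpen_Ioo.mem_nhds ht₀
  have hg : 0 < ‖deriv γ t₀‖ := norm_pos_iff.2 (hγ.deriv_ne_zero t₀ ht₀)
  have hcd : ContDiffAt ℝ 1 γ t₀ := hγ.contDiffOn.contDiffAt hO
  -- Strict differentiability is needed because the estimate compares two arbitrary nearby points,
  -- not one point with t₀.
  have hstrict : HasStrictDerivAt γ (deriv γ t₀) t₀ := hcd.hasStrictDerivAt one_ne_zero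
  have hc : 0 < ε * ‖deriv γ t₀‖ := by positivity
  have h1 := (hasStrictFDerivAt_iff_isLittleO.1 hstrict.hasStrictFDerivAt).def hc
  have hderiv : ContinuousAt (deriv γ) t₀ :=
    (hγ.contDiffOn.continuousOn_deriv_of_isOpen isOpen_Ioo le_rfl).continuousAt hO
  have h2 : ∀ᶠ t in 𝓝 t₀, ‖deriv γ t - deriv γ t₀‖ ≤ ε * ‖deriv γ t₀‖ := by
    have := hderiv.eventually (closedBall_mem_nhds (deriv γ t₀) hc)
    simpa only [mem_closedBall, dist_eq_norm] using this
  rw [nhds_prod_eq] at h1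
  obtain ⟨P, hP, Q, hQ, hPQ⟩ := Filter.eventually_prod_iff.1 h1
  obtain ⟨δ, hδ, hsub⟩ := Metric.mem_nhds_iff.1 (inter_mem (inter_mem hP hQ) (inter_mem h2 hO))
  rw [Real.ball_eq_Ioo] at hsub
  refine ⟨δ, hδ, fun t ht => (hsub ht).2.2, fun s hs t ht => ?_, fun t ht => (hsub ht).2.1⟩
  have := hPQ (hsub ht).1.1 (hsub hs).1.2
  simpa using this

/-- Near t₀ the arc is nearly straight, the embedding property keeps the rest of the arc away, and
the exposing disk keeps away the rest of σ. A single δ serves all chords, so rhombi are available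
both over the chosen subarc and over the pieces of the arc beside it. -/
theorem IsSmoothJordanArc.exists_rhombusFits {σ : Set ℂ} {γ : ℝ → ℂ} (hγ : IsSmoothJordanArc γ)
    {c : ℂ} {r : ℝ} (hσ : ball c r ∩ σ = γ '' Ioo 0 1) {t₀ : ℝ} (ht₀ : t₀ ∈ Ioo (0 : ℝ) 1)
    {h : ℝ} (hh : 0 < h) (hh1 : h ≤ 1) {ε₀ : ℝ} (hε₀ : 0 < ε₀) :
    ∃ δ > 0, ∃ ρ > 0, Ioo (t₀ - δ) (t₀ + δ) ⊆ Ioo 0 1 ∧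
      closedBall (γ t₀) ρ ∩ σ ⊆ γ '' Ioo (t₀ - δ) (t₀ + δ) ∧
      (∀ t ∈ Ioo (t₀ - δ) (t₀ + δ), γ t ∈ ball (γ t₀) ε₀) ∧
      ∀ t₁ ∈ Ioo (t₀ - δ) (t₀ + δ), ∀ t₂ ∈ Ioo (t₀ - δ) (t₀ + δ), t₁ < t₂ →
        RhombusFits σ γ h (ball (γ t₀) ε₀) t₁ t₂ := by
  obtain ⟨δ₁, hδ₁, hδ₁S, hA, hB⟩ := hγ.exists_nearly_straight ht₀ (ε := h / 16) (by positivity)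
  obtain ⟨ε₁, hε₁, hret⟩ := hγ.exists_dist_lt ht₀ hδ₁
  have hmemσ : γ t₀ ∈ ball c r := by
    have : γ t₀ ∈ ball c r ∩ σ := hσ ▸ mem_image_of_mem γ ht₀
    exact this.1
  obtain ⟨ε₂, hε₂, hball⟩ := Metric.isOpen_iff.1 isOpen_ball _ hmemσ
  have hσ' : ∀ z ∈ σ, dist z (γ t₀) < ε₂ → ∃ t ∈ Ioo (0 : ℝ) 1, γ t = z := fun z hz hd => by
    have : z ∈ ball c r ∩ σ := ⟨hball hd, hz⟩
    rwa [hσ] at this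
  -- The three radii ensure the prescribed ball, no return of the arc, and inclusion in the exposing
  -- disk.
  set ε := min ε₀ (min ε₁ ε₂) with hεdef
  have hε : 0 < ε := by positivity
  have hcont : ContinuousAt γ t₀ := hγ.continuousOn.continuousAt (isOpen_Ioo.mem_nhds ht₀)
  obtain ⟨δ₂, hδ₂, hδ₂c⟩ := Metric.continuousAt_iff.1 hcont (ε / 2) (by positivity)
  set δ := min δ₁ δ₂ with hδdef
  have hδ : 0 < δ := by positivity
  have hsub : Ioo (t₀ - δ) (t₀ + δ) ⊆ Ioo (t₀ - δ₁) (t₀ + δ₁) :=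
    Ioo_subset_Ioo (by linarith [min_le_left δ₁ δ₂]) (by linarith [min_le_left δ₁ δ₂])
  have hclose : ∀ t ∈ Ioo (t₀ - δ) (t₀ + δ), dist (γ t) (γ t₀) < ε / 2 := fun t ht => by
    refine hδ₂c ?_
    rw [← mem_ball, Real.ball_eq_Ioo]
    exact Ioo_subset_Ioo (by linarith [min_le_right δ₁ δ₂]) (by linarith [min_le_right δ₁ δ₂]) ht
  obtain ⟨ε₃, hε₃, hret₃⟩ := hγ.exists_dist_lt ht₀ hδ
  refine ⟨δ, hδ, min ε₂ ε₃ / 2, by positivity, hsub.trans hδ₁S, ?_, ?_, ?_⟩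
  · rintro z ⟨hz, hzσ⟩
    have hz' : dist z (γ t₀) < min ε₂ ε₃ := lt_of_le_of_lt hz (half_lt_self (by positivity))
    obtain ⟨t, ht, rfl⟩ := hσ' z hzσ (hz'.trans_le (min_le_left _ _))
    refine ⟨t, ?_, rfl⟩
    have := hret₃ t ht (hz'.trans_le (min_le_right _ _))
    rw [abs_lt] at this
    exact ⟨by linarith, by linarith⟩
  · intro t ht
    have := hclose t ht
    have h2 : ε ≤ ε₀ := min_le_left _ _
    rw [mem_ball]
    linarith
  · intro t₁ h1 t₂ h2 h12
    obtain ⟨g1, g2, g3, g4⟩ := chord_rhombus hh hh1 (by linarith) (by positivity)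
      (hγ.deriv_ne_zero t₀ ht₀) hA hB (hsub h1) (hsub h2) h12
    set m := chordMid γ t₁ t₂ with hm
    set d := chordHalf γ t₁ t₂ with hd
    have hnear : ∀ w ∈ closedRhombus h, dist (m + d * w) (γ t₀) < ε := by
      intro w hw
      have hw1 := norm_le_one_of_mem_closedRhombus hh hh1 hw
      have c1 := hclose t₁ h1
      have c2 := hclose t₂ h2
      rw [dist_eq_norm] at *
      -- Both coefficients have modulus at most 1 because |w| ≤ 1, and both endpoints are within ε/2
      -- of γ t₀.
      have e : m + d * w - γ t₀ = ((1 - w) / 2) * (γ t₁ - γ t₀) + ((1 + w) / 2) * (γ t₂ - γ t₀) := by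
        rw [hm, hd, chordMid, chordHalf]; ring
      have n1 : ‖(1 - w) / 2‖ ≤ 1 := by
        rw [norm_div, Complex.norm_ofNat]
        have := norm_sub_le 1 w
        rw [norm_one] at this
        linarith
      have n2 : ‖(1 + w) / 2‖ ≤ 1 := by
        rw [norm_div, Complex.norm_ofNat]
        have := norm_add_le 1 w
        rw [norm_one] at this
        linarith
      rw [e]
      refine (norm_add_le _ _).trans_lt ?_
      rw [norm_mul, norm_mul]
      have m1 := mul_le_mul_of_nonneg_right n1 (norm_nonneg (γ t₁ - γ t₀))
      have m2 := mul_le_mul_of_nonneg_right n2 (norm_nonneg (γ t₂ - γ t₀))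
      linarith
    have hback : ∀ w, (m + d * w - m) / d = w := fun w => by
      rw [add_sub_cancel_left, mul_div_cancel_left₀ _ g1]
    have harc : ∀ w ∈ closedRhombus h, m + d * w ∈ σ → ∃ t ∈ Icc t₁ t₂, γ t = m + d * w := by
      intro w hw hws
      have hn := hnear w hw
      obtain ⟨t, ht, hte⟩ := hσ' _ hws
        (hn.trans_le ((min_le_right _ _).trans (min_le_right _ _)))
      rw [← hte] at hn
      have h3 := hret t ht (hn.trans_le ((min_le_right _ _).trans (min_le_left _ _)))
      rw [abs_lt] at h3
      refine ⟨t, g3 t ⟨by linarith, by linarith⟩ ?_, hte⟩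
      rw [hte, hback]
      exact hw
    have hconv : Icc t₁ t₂ ⊆ Ioo (t₀ - δ₁) (t₀ + δ₁) := fun t ht =>
      ⟨(hsub h1).1.trans_le ht.1, ht.2.trans_lt (hsub h2).2⟩
    refine ⟨g1, fun w hw => ?_, harc, fun t ht => ?_, fun w hw hws => ?_, fun e f he hf t ht =>
      g4 e f he hf t (hconv ht)⟩
    · exact (hnear w hw).trans_le (min_le_left _ _)
    · refine ⟨_, g2 t (hconv (Ioo_subset_Icc_self ht)) ht, ?_⟩
      rw [mul_div_cancel₀ _ g1]
      ring
    · obtain ⟨t, ht, hte⟩ := harc w (rhombusBoundary_subset_closedRhombus h hw.1) hws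
      rcases ht.1.eq_or_lt with rfl | ht1
      · refine hw.2 (Or.inr ?_)
        have : d * (w + 1) = 0 := by
          have : γ t₁ = m - d := by rw [hm, hd, chordMid, chordHalf]; ring
          rw [this] at hte
          linear_combination -hte
        have := (mul_eq_zero.1 this).resolve_left g1
        exact eq_neg_of_add_eq_zero_left this
      rcases ht.2.eq_or_lt with rfl | ht2
      · refine hw.2 (Or.inl ?_)
        have : d * (w - 1) = 0 := by
          have : γ t = m + d := by rw [hm, hd, chordMid, chordHalf]; ring
          rw [this] at hte
          linear_combination -hte
        have := (mul_eq_zero.1 this).resolve_left g1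
        exact sub_eq_zero.1 this
      have := g2 t (hconv ht) ⟨ht1, ht2⟩
      rw [hte, hback] at this
      exact notMem_rhombusBoundary_of_mem_openRhombus this hw.1

end Geometry

/-! ### The complex operator with an exposed arc -/

section Abstract

variable {X : Type*} [NormedAddCommGroup X] [NormedSpace ℂ X] {A : X →L[ℂ] X}

/-- Exponential growth of order `k` of the resolvent along the transversal segments that meet the
spectrum only in one point of the arc `γ`, as long as they do not cross the real axis. -/
def TransversalGrowth (A : X →L[ℂ] X) (γ : ℝ → ℂ) (k : ℕ) : Prop :=
  ∀ t ∈ Ioo (0 : ℝ) 1, ∀ a c : ℂ, γ t ∈ segment ℝ a c →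
    (¬ ∃ r : ℝ, c - a = r • deriv γ t) → segment ℝ a c ∩ spectrum ℂ A = {γ t} →
    (∀ z ∈ segment ℝ a c, 0 ≤ z.im * (γ t).im) →
    ∃ K : ℝ, 0 ≤ K ∧ ∀ z ∈ segment ℝ a c, z ≠ γ t →
      ‖resolvent A z‖ ≤ 2 * Real.exp (K * (‖z - γ t‖ ^ k)⁻¹)

/-- Unlike in `rhombusEdge`, each edge starts at a vertex ±1: those lie on the arc, and growth is
measured by the distance from them. -/
theorem mem_rhombusBoundary_of_edge {h e f s : ℝ} (hh : 0 < h) (he : |e| = 1) (hf : |f| = 1)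
    (hs : s ∈ Icc (0 : ℝ) 1) :
    (e : ℂ) + s * (f * h * Complex.I - e) ∈ rhombusBoundary h := by
  have h1 : |e - e * s| = 1 - s := by
    rw [show e - e * s = e * (1 - s) by ring, abs_mul, he, one_mul,
      abs_of_nonneg (by linarith [hs.2])]
  simp [rhombusBoundary, abs_mul, hf, abs_of_pos hh, abs_of_nonneg hs.1, ← sub_eq_add_neg, h1,
    mul_comm]

theorem exists_edge_of_mem_rhombusBoundary {h : ℝ} (hh : 0 < h) {w : ℂ}
    (hw : w ∈ rhombusBoundary h) : ∃ e f : ℝ, (e = 1 ∨ e = -1) ∧ (f = 1 ∨ f = -1) ∧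
      ∃ s ∈ Icc (0 : ℝ) 1, w = (e : ℂ) + s * (f * h * Complex.I - e) := by
  have h1 : |w.im| = h * (1 - |w.re|) := hw
  have h2 : 0 ≤ 1 - |w.re| := nonneg_of_mul_nonneg_right (h1 ▸ abs_nonneg _) hh
  obtain ⟨e, he, he'⟩ : ∃ e : ℝ, (e = 1 ∨ e = -1) ∧ w.re = e * |w.re| := by
    rcases abs_cases w.re with ⟨h, _⟩ | ⟨h, _⟩
    · exact ⟨1, Or.inl rfl, by rw [h, one_mul]⟩
    · exact ⟨-1, Or.inr rfl, by rw [h]; ring⟩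
  obtain ⟨f, hf, hf'⟩ : ∃ f : ℝ, (f = 1 ∨ f = -1) ∧ w.im = f * |w.im| := by
    rcases abs_cases w.im with ⟨h, _⟩ | ⟨h, _⟩
    · exact ⟨1, Or.inl rfl, by rw [h, one_mul]⟩
    · exact ⟨-1, Or.inr rfl, by rw [h]; ring⟩
  refine ⟨e, f, he, hf, 1 - |w.re|, ⟨h2, by linarith [abs_nonneg w.re]⟩, ?_⟩
  apply Complex.ext
  · simp
    linarith
  · simp
    rw [h1] at hf'
    linarith

/-- The growth condition makes the tamed resolvent bounded along a fitting rhombus. -/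
theorem TransversalGrowth.exists_bound {γ : ℝ → ℂ} {k : ℕ} (hA : TransversalGrowth A γ k)
    {h : ℝ} (hh : 0 < h) (hp : 4 * (k + 1 : ℕ) * h ≤ 1) {B : Set ℂ} {t₁ t₂ : ℝ}
    (h1 : t₁ ∈ Ioo (0 : ℝ) 1) (h2 : t₂ ∈ Ioo (0 : ℝ) 1) (h12 : t₁ < t₂)
    (hfit : RhombusFits (spectrum ℂ A) γ h B t₁ t₂)
    (hσ₁ : γ t₁ ∈ spectrum ℂ A) (hσ₂ : γ t₂ ∈ spectrum ℂ A)
    (hB₁ : ∀ z ∈ B, 0 ≤ z.im * (γ t₁).im) (hB₂ : ∀ z ∈ B, 0 ≤ z.im * (γ t₂).im) :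
    ∃ C, ∀ w ∈ rhombusBoundary h \ {1, -1}, ‖flatFn (k + 1) w‖ *
      ‖resolvent A (chordMid γ t₁ t₂ + chordHalf γ t₁ t₂ * w)‖ ≤ C := by
  set m := chordMid γ t₁ t₂ with hm
  set d := chordHalf γ t₁ t₂ with hd
  have hd0 : 0 < ‖d‖ := norm_pos_iff.2 hfit.half_ne
  have key : ∀ e f : ℝ, (e = 1 ∨ e = -1) → (f = 1 ∨ f = -1) → ∃ C, ∀ s ∈ Ioc (0 : ℝ) 1,
      ‖flatFn (k + 1) ((e : ℂ) + s * (f * h * Complex.I - e))‖ *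
      ‖resolvent A (m + d * ((e : ℂ) + s * (f * h * Complex.I - e)))‖ ≤ C := by
    intro e f he hf
    have he' : |e| = 1 := by rcases he with rfl | rfl <;> simp
    have hf' : |f| = 1 := by rcases hf with rfl | rfl <;> simp
    obtain ⟨t, ht, hts, htγ, htσ, htB⟩ : ∃ t ∈ Ioo (0 : ℝ) 1, t ∈ Icc t₁ t₂ ∧ γ t = m + d * e ∧
        γ t ∈ spectrum ℂ A ∧ ∀ z ∈ B, 0 ≤ z.im * (γ t).im := by
      rcases he with rfl | rfl
      · refine ⟨t₂, h2, ⟨h12.le, le_rfl⟩, ?_, hσ₂, hB₂⟩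
        rw [hm, hd, chordMid, chordHalf]; push_cast; ring
      · refine ⟨t₁, h1, ⟨le_rfl, h12.le⟩, ?_, hσ₁, hB₁⟩
        rw [hm, hd, chordMid, chordHalf]; push_cast; ring
    have hseg : ∀ z ∈ segment ℝ (γ t) (m + d * (f * h * Complex.I)), ∃ s ∈ Icc (0 : ℝ) 1,
        z = m + d * ((e : ℂ) + s * (f * h * Complex.I - e)) := by
      intro z hz
      rw [segment_eq_image'] at hz
      obtain ⟨s, hs, rfl⟩ := hz
      refine ⟨s, hs, ?_⟩
      simp only [Complex.real_smul]
      rw [htγ]; ring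
    have hmem : ∀ s ∈ Icc (0 : ℝ) 1, m + d * ((e : ℂ) + s * (f * h * Complex.I - e)) ∈
        segment ℝ (γ t) (m + d * (f * h * Complex.I)) := by
      intro s hs
      rw [segment_eq_image']
      refine ⟨s, hs, ?_⟩
      simp only [Complex.real_smul]
      rw [htγ]; ring
    have hnotv : ∀ s ∈ Ioc (0 : ℝ) 1,
        (e : ℂ) + s * (f * h * Complex.I - e) ∉ ({1, -1} : Set ℂ) := by
      intro s hs H
      have him : ((e : ℂ) + s * (f * h * Complex.I - e)).im = 0 := by
        rcases H with H | H <;> rw [H] <;> simp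
      have hs0 := hs.1.ne'
      rcases hf with rfl | rfl <;> simp [hs0, hh.ne'] at him
    have hbd := fun s hs => mem_rhombusBoundary_of_edge (e := e) (f := f) (s := s) hh he' hf' hs
    -- The growth condition is applied to a single edge, a closed segment ending on the arc.
    obtain ⟨K, hK0, hK⟩ := hA t ht (γ t) (m + d * (f * h * Complex.I)) (left_mem_segment _ _ _)
      (by
        have := hfit.transversal e f he' hf' t hts
        rw [htγ, show m + d * (f * h * Complex.I) - (m + d * e) =
          d * (f * h * Complex.I - e) by ring]
        exact this)
      (by
        refine Subset.antisymm ?_ (singleton_subset_iff.2 ⟨left_mem_segment _ _ _, htσ⟩)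
        rintro z ⟨hz, hzσ⟩
        obtain ⟨s, hs, rfl⟩ := hseg z hz
        rcases hs.1.eq_or_lt with rfl | hs0
        · rw [mem_singleton_iff, htγ]; simp
        · exact absurd hzσ (hfit.notMem_boundary _ ⟨hbd s hs, hnotv s ⟨hs0, hs.2⟩⟩))
      (by
        intro z hz
        obtain ⟨s, hs, rfl⟩ := hseg z hz
        exact htB _ (hfit.mem_nhd _ (rhombusBoundary_subset_closedRhombus h (hbd s hs))))
    -- Distances in the coordinate w are scaled by |d|, which is absorbed in the constant.
    set K' := K * (‖d‖ ^ k)⁻¹ with hK'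
    refine ⟨2 * Real.exp (K' * (2 * K') ^ k), fun s hs => ?_⟩
    have hs' : s ∈ Icc (0 : ℝ) 1 := Ioc_subset_Icc_self hs
    set w := (e : ℂ) + s * (f * h * Complex.I - e) with hw
    have hdiff : m + d * w - γ t = d * (w - e) := by rw [htγ]; ring
    have hR := hK (m + d * w) (hmem s hs') (by
      intro H
      exact hfit.notMem_boundary w ⟨hbd s hs', hnotv s hs⟩ (H ▸ htσ))
    rw [hdiff, norm_mul, mul_pow, mul_inv, ← mul_assoc, ← hK'] at hR
    have hwc := rhombusBoundary_subset_closedRhombus h (hbd s hs')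
    have hF : ‖flatFn (k + 1) w‖ ≤ Real.exp (-((‖w - e‖ ^ (k + 1))⁻¹ / 2)) := by
      rcases he with rfl | rfl
      · have := norm_flatFn_le_right hp hh hwc
        rwa [norm_sub_rev, ← Complex.ofReal_one] at this
      · have := norm_flatFn_le_left hp hh hwc
        rw [show w - ((-1 : ℝ) : ℂ) = 1 + w by push_cast; ring]
        exact this
    calc _ ≤ Real.exp (-((‖w - e‖ ^ (k + 1))⁻¹ / 2)) *
          (2 * Real.exp (K' * (‖w - e‖ ^ k)⁻¹)) := by gcongr
      _ = 2 * (Real.exp (K' * (‖w - e‖ ^ k)⁻¹) * Real.exp (-((‖w - e‖ ^ (k + 1))⁻¹ / 2))) := by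
          ring
      _ ≤ _ := by
          gcongr
          exact exp_mul_exp_le K' (by positivity) k (norm_nonneg _)
  choose! C hC using key
  refine ⟨max (max (C 1 1) (C 1 (-1))) (max (C (-1) 1) (C (-1) (-1))), fun w hw => ?_⟩
  obtain ⟨e, f, he, hf, s, hs, rfl⟩ := exists_edge_of_mem_rhombusBoundary hh hw.1
  have hs0 : s ≠ 0 := by
    rintro rfl
    refine hw.2 ?_
    rcases he with rfl | rfl <;> simp
  refine (hC e f he hf s ⟨lt_of_le_of_ne hs.1 hs0.symm, hs.2⟩).trans ?_
  rcases he with rfl | rfl <;> rcases hf with rfl | rfl <;> simp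

variable [CompleteSpace X]

/-- The closed set `γ([t₁, t₂])` together with its mirror image. -/
def conjSubarc (γ : ℝ → ℂ) (t₁ t₂ : ℝ) : Set ℂ :=
  γ '' Icc t₁ t₂ ∪ starRingEnd ℂ '' (γ '' Icc t₁ t₂)

theorem isClosed_conjSubarc {γ : ℝ → ℂ} {t₁ t₂ : ℝ} (h : ContinuousOn γ (Icc t₁ t₂)) :
    IsClosed (conjSubarc γ t₁ t₂) := by
  have h1 : IsCompact (γ '' Icc t₁ t₂) := isCompact_Icc.image_of_continuousOn h
  exact (h1.union (h1.image Complex.continuous_conj)).isClosed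

theorem conj_mem_conjSubarc {γ : ℝ → ℂ} {t₁ t₂ : ℝ} {z : ℂ} (hz : z ∈ conjSubarc γ t₁ t₂) :
    (starRingEnd ℂ) z ∈ conjSubarc γ t₁ t₂ := by
  rcases hz with hz | ⟨w, hw, rfl⟩
  · exact Or.inr ⟨z, hz, rfl⟩
  · rw [Complex.conj_conj]; exact Or.inl hw

/-- Every arc has a point near which it either stays real or stays in one half-plane. -/
theorem exists_point_one_sided (γ : ℝ → ℂ) : ∃ t₀ ∈ Ioo (0 : ℝ) 1, ∃ ε > 0,
    (∀ t ∈ Ioo (0 : ℝ) 1, γ t ∈ ball (γ t₀) ε → ∀ z ∈ ball (γ t₀) ε, 0 ≤ z.im * (γ t).im) ∧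
    ∀ t ∈ Ioo (0 : ℝ) 1, γ t ∈ ball (γ t₀) ε → (starRingEnd ℂ) (γ t) ∈ ball (γ t₀) ε →
      (starRingEnd ℂ) (γ t) = γ t := by
  by_cases H : ∀ t ∈ Ioo (0 : ℝ) 1, (γ t).im = 0
  · refine ⟨1 / 2, by norm_num, 1, one_pos, fun t ht _ z _ => by rw [H t ht, mul_zero],
      fun t ht _ _ => Complex.conj_eq_iff_im.2 (H t ht)⟩
  · push Not at H
    obtain ⟨t₀, ht₀, h0⟩ := H
    -- The disk about γ t₀ with this radius stays strictly on one side of the real axis.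
    have hsq : ∀ z ∈ ball (γ t₀) |(γ t₀).im|, 0 < z.im * (γ t₀).im := by
      intro z hz
      rw [mem_ball, dist_eq_norm] at hz
      have h1 := (Complex.abs_im_le_norm (z - γ t₀)).trans_lt hz
      rw [Complex.sub_im, abs_lt] at h1
      rcases lt_or_gt_of_ne h0 with h2 | h2
      · rw [abs_of_neg h2] at h1
        exact mul_pos_of_neg_of_neg (by linarith) h2
      · rw [abs_of_pos h2] at h1
        exact mul_pos (by linarith) h2
    refine ⟨t₀, ht₀, |(γ t₀).im|, abs_pos.2 h0, fun t _ h1 z hz => ?_, fun t _ h1 h2 => ?_⟩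
    · have a1 := mul_pos (hsq _ h1) (hsq z hz)
      have a2 : 0 < (γ t₀).im ^ 2 := by positivity
      by_contra! H
      nlinarith
    · have a1 := hsq _ h1
      have a2 := hsq _ h2
      rw [Complex.conj_im] at a2
      linarith

/-- A bounded operator with a symmetric spectrum that has an exposed arc near which the resolvent
grows at most exponentially: the vectors whose local resolvent extends off a suitable subarc and its
mirror image form a closed set that is neither `{0}` nor the whole space. -/
theorem exists_subarc {γ : ℝ → ℂ} (hγ : IsSmoothJordanArc γ) {c : ℂ} {r : ℝ}
    (hσ : ball c r ∩ spectrum ℂ A = γ '' Ioo 0 1)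
    (hconj : ∀ z ∈ spectrum ℂ A, (starRingEnd ℂ) z ∈ spectrum ℂ A)
    (hnorm : ∀ z, ‖resolvent A ((starRingEnd ℂ) z)‖ ≤ ‖resolvent A z‖) {k : ℕ}
    (hA : TransversalGrowth A γ k) :
    ∃ t₁ t₂ : ℝ, 0 < t₁ ∧ t₁ < t₂ ∧ t₂ < 1 ∧
      IsClosed {x : X | ∃ F, ExtendsResolvent A (conjSubarc γ t₁ t₂) x F} ∧
      (∃ x : X, x ≠ 0 ∧ ∃ F, ExtendsResolvent A (conjSubarc γ t₁ t₂) x F) ∧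
      ∃ x : X, ¬ ∃ F, ExtendsResolvent A (conjSubarc γ t₁ t₂) x F := by
  obtain ⟨t₀, ht₀, ε₀, hε₀, hside, hreal⟩ := exists_point_one_sided γ
  set h : ℝ := 1 / (4 * (k + 1 : ℕ)) with hh_def
  have hh : 0 < h := by positivity
  have hp : 4 * (k + 1 : ℕ) * h ≤ 1 := by
    rw [hh_def, mul_one_div_cancel (by positivity)]
  have hh1 : h ≤ 1 := by
    rw [hh_def, div_le_one (by positivity)]
    push_cast
    linarith [(Nat.cast_nonneg k : (0 : ℝ) ≤ k)]
  have hp0 : k + 1 ≠ 0 := Nat.succ_ne_zero k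
  obtain ⟨δ, hδ, ρ, hρ, hS, hρS, hSε, hfit⟩ := hγ.exists_rhombusFits hσ ht₀ hh hh1 hε₀
  set S := Ioo (t₀ - δ) (t₀ + δ) with hSdef
  have hγσ : ∀ t ∈ Ioo (0 : ℝ) 1, γ t ∈ spectrum ℂ A := fun t ht => by
    have : γ t ∈ ball c r ∩ spectrum ℂ A := hσ ▸ mem_image_of_mem γ ht
    exact this.2
  -- A C¹ arc has Hausdorff dimension at most 1, so its complement is dense in the plane. In the
  -- exposing disk the spectrum is only the arc.
  have hcl : ∀ t ∈ Ioo (0 : ℝ) 1, γ t ∈ closure (spectrum ℂ A)ᶜ := by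
    intro t ht
    have hdense : Dense (γ '' Ioo 0 1)ᶜ := by
      refine hγ.contDiffOn.dense_compl_image_of_dimH_lt_finrank (convex_Ioo 0 1) Subset.rfl ?_
      refine lt_of_le_of_lt (dimH_mono (subset_univ _)) ?_
      rw [Real.dimH_univ, Complex.finrank_real_complex]
      norm_num
    have hball : γ t ∈ ball c r := by
      have : γ t ∈ ball c r ∩ spectrum ℂ A := hσ ▸ mem_image_of_mem γ ht
      exact this.1
    refine closure_mono ?_ (hdense.open_subset_closure_inter isOpen_ball hball)
    rintro z ⟨hz1, hz2⟩ hz3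
    exact hz2 (hσ ▸ ⟨hz1, hz3⟩)
  have hbound : ∀ t₁ ∈ S, ∀ t₂ ∈ S, t₁ < t₂ → ∃ C, ∀ w ∈ rhombusBoundary h \ {1, -1},
      ‖flatFn (k + 1) w‖ * ‖resolvent A (chordMid γ t₁ t₂ + chordHalf γ t₁ t₂ * w)‖ ≤ C :=
    fun t₁ h1 t₂ h2 h12 => hA.exists_bound hh hp (hS h1) (hS h2) h12 (hfit t₁ h1 t₂ h2 h12)
      (hγσ _ (hS h1)) (hγσ _ (hS h2)) (hside _ (hS h1) (hSε _ h1)) (hside _ (hS h2) (hSε _ h2))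
  have hcont : ContinuousAt γ t₀ := hγ.continuousOn.continuousAt (isOpen_Ioo.mem_nhds ht₀)
  obtain ⟨δ', hδ', hδ'c⟩ := Metric.continuousAt_iff.1 hcont ρ hρ
  set μ := min δ δ' / 2 with hμ
  have hμ0 : 0 < μ := by positivity
  have hμδ : μ < δ := by
    have := min_le_left δ δ'
    linarith
  have hμδ' : μ < δ' := by
    have := min_le_right δ δ'
    linarith
  set t₁ := t₀ - μ with ht₁
  set t₂ := t₀ + μ with ht₂
  have h12 : t₁ < t₂ := by linarith
  have hIS : Icc t₁ t₂ ⊆ S := fun t ht => ⟨by linarith [ht.1], by linarith [ht.2]⟩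
  have h1S : t₁ ∈ S := hIS ⟨le_rfl, h12.le⟩
  have h2S : t₂ ∈ S := hIS ⟨h12.le, le_rfl⟩
  have hJball : ∀ t ∈ Icc t₁ t₂, γ t ∈ ball (γ t₀) ρ := fun t ht => by
    refine hδ'c ?_
    rw [Real.dist_eq, abs_lt]
    exact ⟨by linarith [ht.1], by linarith [ht.2]⟩
  set E := conjSubarc γ t₁ t₂ with hE
  have hEclosed : IsClosed E := isClosed_conjSubarc (hγ.continuousOn.mono (hIS.trans hS))
  have hEσ : E ⊆ spectrum ℂ A := by
    rintro z (⟨t, ht, rfl⟩ | ⟨_, ⟨t, ht, rfl⟩, rfl⟩)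
    · exact hγσ t (hS (hIS ht))
    · exact hconj _ (hγσ t (hS (hIS ht)))
  -- The mirror image of the subarc cannot meet the nearby arc, except where the arc is real and the
  -- reflection does nothing.
  have hEarc : ∀ t ∈ S, γ t ∈ E → t ∈ Icc t₁ t₂ := by
    rintro t ht (⟨s, hs, hst⟩ | ⟨_, ⟨s, hs, rfl⟩, hst⟩)
    · exact hγ.injOn (hS (hIS hs)) (hS ht) hst ▸ hs
    · have h3 := hreal s (hS (hIS hs)) (hSε s (hIS hs)) (hst ▸ hSε t ht)
      rw [h3] at hst
      exact hγ.injOn (hS (hIS hs)) (hS ht) hst ▸ hs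
  have hctrl : ∀ t ∈ S, t ∉ Icc t₁ t₂ → LocallyControlled A E (γ t) ∧
      LocallyControlled A E ((starRingEnd ℂ) (γ t)) := by
    intro t ht htI
    -- A parameter interval about t that avoids the chosen subarc: its rhombus meets the spectrum
    -- only off `E`.
    obtain ⟨a, ha, b, hb, hat, htb, hdisj⟩ : ∃ a ∈ S, ∃ b ∈ S, a < t ∧ t < b ∧
        ∀ s ∈ Icc a b, s ∉ Icc t₁ t₂ := by
      rw [mem_Icc, not_and_or, not_le, not_le] at htI
      rcases htI with H | H
      · refine ⟨(t₀ - δ + t) / 2, ⟨by linarith [ht.1], by linarith [ht.1, ht.2]⟩, (t + t₁) / 2,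
          ⟨by linarith [ht.1], by linarith⟩, by linarith [ht.1], by linarith, fun s hs hs' => ?_⟩
        linarith [hs.2, hs'.1]
      · refine ⟨(t₂ + t) / 2, ⟨by linarith, by linarith [ht.2]⟩, (t + (t₀ + δ)) / 2,
          ⟨by linarith [ht.1], by linarith [ht.2]⟩, by linarith, by linarith [ht.2],
          fun s hs hs' => ?_⟩
        linarith [hs.1, hs'.2]
    have hab : a < b := hat.trans htb
    have hf := hfit a ha b hb hab
    obtain ⟨C, hC⟩ := hbound a ha b hb hab
    obtain ⟨w, hw, hwt⟩ := hf.mem_rhombus t ⟨hat, htb⟩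
    have hEdisj : ∀ w ∈ closedRhombus h, chordMid γ a b + chordHalf γ a b * w ∉ E := by
      intro w hw hwE
      obtain ⟨s, hs, hsw⟩ := hf.mem_arc w hw (hEσ hwE)
      rw [← hsw] at hwE
      exact hdisj s hs (hEarc s ⟨ha.1.trans_le hs.1, hs.2.trans_lt hb.2⟩ hwE)
    refine ⟨?_, ?_⟩
    · rw [hwt]
      exact locallyControlled_of_rhombus hf.half_ne hh hp0 hp hf.notMem_boundary hC hEdisj hw
    · have hflip : ∀ w, (starRingEnd ℂ) (chordMid γ a b) + (starRingEnd ℂ) (chordHalf γ a b) * w =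
          (starRingEnd ℂ) (chordMid γ a b + chordHalf γ a b * (starRingEnd ℂ) w) := fun w => by
        simp
      have hv : ∀ w ∈ rhombusBoundary h \ {1, -1},
          (starRingEnd ℂ) w ∈ rhombusBoundary h \ {1, -1} := by
        rintro w ⟨hw1, hw2⟩
        refine ⟨conj_mem_rhombusBoundary hw1, fun H => hw2 ?_⟩
        rcases H with H | H
        · exact Or.inl (by simpa using congrArg (starRingEnd ℂ) H)
        · refine Or.inr ?_
          have H' : (starRingEnd ℂ) w = -1 := H
          simpa using congrArg (starRingEnd ℂ) H'
      -- The mirrored rhombus inherits the bound from the symmetry of the spectrum, of the resolvent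
      -- norm and of the flat function.
      have := locallyControlled_of_rhombus (A := A) (E := E) (h := h) (p := k + 1) (C := C)
        (m := (starRingEnd ℂ) (chordMid γ a b)) (d := (starRingEnd ℂ) (chordHalf γ a b))
        (w₀ := (starRingEnd ℂ) w)
        (by simpa using hf.half_ne) hh hp0 hp ?_ ?_ ?_ (conj_mem_openRhombus hw)
      · rw [hflip, Complex.conj_conj, ← hwt] at this
        exact this
      · intro w hw H
        rw [hflip] at H
        have := hconj _ H
        rw [Complex.conj_conj] at this
        exact hf.notMem_boundary _ (hv w hw) this
      · intro w hw
        rw [hflip]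
        refine le_trans ?_ (hC _ (hv w hw))
        rw [flatFn_conj, RCLike.norm_conj]
        gcongr
        exact hnorm _
      · intro w hw H
        rw [hflip] at H
        have := conj_mem_conjSubarc H
        rw [Complex.conj_conj] at this
        exact hEdisj _ (conj_mem_closedRhombus hw) this
  have hball1 : ∀ z ∈ closedBall (γ t₀) ρ, z ∉ E → LocallyControlled A E z := by
    intro z hz hzE
    by_cases hzσ : z ∈ spectrum ℂ A
    · obtain ⟨t, ht, rfl⟩ := hρS ⟨hz, hzσ⟩
      exact (hctrl t ht fun H => hzE (Or.inl ⟨t, H, rfl⟩)).1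
    · exact locallyControlled_of_notMem_spectrum hzσ E
  have hball2 : ∀ z ∈ closedBall ((starRingEnd ℂ) (γ t₀)) ρ, z ∉ E → LocallyControlled A E z := by
    intro z hz hzE
    by_cases hzσ : z ∈ spectrum ℂ A
    · have hz' : (starRingEnd ℂ) z ∈ closedBall (γ t₀) ρ := by
        rw [mem_closedBall, ← Complex.dist_conj_conj, Complex.conj_conj]
        exact hz
      obtain ⟨t, ht, htz⟩ := hρS ⟨hz', hconj z hzσ⟩
      have hzt : z = (starRingEnd ℂ) (γ t) := by rw [htz, Complex.conj_conj]
      rw [hzt]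
      exact (hctrl t ht fun H => hzE (Or.inr ⟨γ t, ⟨t, H, rfl⟩, hzt.symm⟩)).2
    · exact locallyControlled_of_notMem_spectrum hzσ E
  have hEball : E ⊆ ball (γ t₀) ρ ∪ ball ((starRingEnd ℂ) (γ t₀)) ρ := by
    rintro z (⟨t, ht, rfl⟩ | ⟨_, ⟨t, ht, rfl⟩, rfl⟩)
    · exact Or.inl (hJball t ht)
    · refine Or.inr ?_
      rw [mem_ball, Complex.dist_conj_conj]
      exact hJball t ht
  have hall : ∀ z ∉ E, LocallyControlled A E z := by
    intro z hz
    by_cases hz1 : z ∈ closedBall (γ t₀) ρ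
    · exact hball1 z hz1 hz
    by_cases hz2 : z ∈ closedBall ((starRingEnd ℂ) (γ t₀)) ρ
    · exact hball2 z hz2 hz
    -- Away from the two disks the spectrum is arbitrary. The maximum principle is applied to a
    -- large disk minus the two closed disks: a frontier point lies either in one of these, off `E`,
    -- or outside the large disk and hence off the spectrum.
    obtain ⟨R, hR⟩ := ((spectrum.isCompact A).isBounded.union
      (Bornology.isBounded_singleton (x := z))).subset_ball 0
    have hV2 : closure (ball 0 R ∩ ((closedBall (γ t₀) ρ)ᶜ ∩
        (closedBall ((starRingEnd ℂ) (γ t₀)) ρ)ᶜ)) ⊆ Eᶜ := by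
      have : closure (ball 0 R ∩ ((closedBall (γ t₀) ρ)ᶜ ∩
          (closedBall ((starRingEnd ℂ) (γ t₀)) ρ)ᶜ)) ⊆
          (ball (γ t₀) ρ ∪ ball ((starRingEnd ℂ) (γ t₀)) ρ)ᶜ := by
        refine closure_minimal ?_ (isOpen_ball.union isOpen_ball).isClosed_compl
        rintro w ⟨-, hw1, hw2⟩ (hw | hw)
        · exact hw1 (ball_subset_closedBall hw)
        · exact hw2 (ball_subset_closedBall hw)
      exact this.trans (compl_subset_compl.2 hEball)
    have hVo : IsOpen (ball 0 R ∩ ((closedBall (γ t₀) ρ)ᶜ ∩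
        (closedBall ((starRingEnd ℂ) (γ t₀)) ρ)ᶜ)) :=
      isOpen_ball.inter (isClosed_closedBall.isOpen_compl.inter isClosed_closedBall.isOpen_compl)
    refine locallyControlled_of_frontier hVo (isBounded_ball.subset inter_subset_left) hV2 ?_
      ⟨hR (Or.inr rfl), hz1, hz2⟩
    intro w hw
    have hwE : w ∉ E := hV2 (frontier_subset_closure hw)
    rw [hVo.frontier_eq] at hw
    by_cases h1 : w ∈ closedBall (γ t₀) ρ
    · exact hball1 w h1 hwE
    by_cases h2 : w ∈ closedBall ((starRingEnd ℂ) (γ t₀)) ρ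
    · exact hball2 w h2 hwE
    refine locallyControlled_of_notMem_spectrum (fun H => hw.2 ⟨hR (Or.inl H), h1, h2⟩) E
  refine ⟨t₁, t₂, (hS h1S).1, h12, (hS h2S).2, isClosed_setOf_extendsResolvent hEclosed hEσ hall,
    ?_, ?_⟩
  · have hf := hfit t₁ h1S t₂ h2S h12
    obtain ⟨C, hC⟩ := hbound t₁ h1S t₂ h2S h12
    obtain ⟨w, hw, hwt⟩ := hf.mem_rhombus t₀ ⟨by linarith, by linarith⟩
    obtain ⟨x, hx⟩ := exists_rhombusVector_ne_zero (A := A) hf.half_ne hh hp0 hp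
      hf.notMem_boundary hC hw (hwt ▸ hγσ t₀ ht₀) (hwt ▸ hcl t₀ ht₀)
    refine ⟨_, hx, exists_extendsResolvent_rhombusVector hf.half_ne hh hp0 hp
      hf.notMem_boundary hC (fun w hw hwσ => ?_) x⟩
    obtain ⟨t, ht, htw⟩ := hf.mem_arc w hw hwσ
    exact Or.inl ⟨t, ht, htw⟩
  · by_contra! H
    -- A parameter in `S` before the subarc: the arc point there is spectral but not in `E`.
    have h3S : (t₀ - δ + t₁) / 2 ∈ S := ⟨by linarith, by linarith⟩
    have h3E : γ ((t₀ - δ + t₁) / 2) ∉ E := fun h => by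
      have := (hEarc _ h3S h).1
      linarith
    refine notMem_spectrum_of_tendsto (hcl _ (hS h3S)) (fun x => ?_) (hγσ _ (hS h3S))
    obtain ⟨F, hF⟩ := H x
    have hFc : ContinuousAt F (γ ((t₀ - δ + t₁) / 2)) :=
      hF.1.continuousOn.continuousAt (hEclosed.isOpen_compl.mem_nhds h3E)
    refine ⟨_, (hFc.tendsto.mono_left nhdsWithin_le_nhds).congr' ?_⟩
    filter_upwards [self_mem_nhdsWithin] with z hz
    exact hF.2 z hz

end Abstract

/-! ### Left multiplication -/

section LeftMul

variable {ι H : Type*} [NormedAddCommGroup H] [NormedSpace ℝ H] [Module ℍ[ℝ]ᵐᵒᵖ H]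
  [QInnerProductSpace H] [CompleteSpace H]

namespace QHilbertBasis

theorem leftMul_apply (b : QHilbertBasis ι H) (s : ℍ[ℝ]) (x : H) :
    b.leftMul s x = b.coords.symm (s • b.coords x) := rfl

theorem leftMul_neg (b : QHilbertBasis ι H) (s : ℍ[ℝ]) (x : H) :
    b.leftMul (-s) x = -b.leftMul s x := by
  simp [leftMul_apply, neg_smul]

theorem leftMul_sub (b : QHilbertBasis ι H) (s t : ℍ[ℝ]) (x : H) :
    b.leftMul (s - t) x = b.leftMul s x - b.leftMul t x := by
  simp [leftMul_apply, sub_smul]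

theorem leftMul_leftMul (b : QHilbertBasis ι H) (s t : ℍ[ℝ]) (x : H) :
    b.leftMul s (b.leftMul t x) = b.leftMul (s * t) x := by
  simp [leftMul_apply, mul_smul]

theorem leftMul_real_smul (b : QHilbertBasis ι H) (r : ℝ) (s : ℍ[ℝ]) (x : H) :
    b.leftMul (r • s) x = r • b.leftMul s x := by
  simp [leftMul_apply]

theorem leftMul_smul_right (b : QHilbertBasis ι H) (r : ℝ) (s : ℍ[ℝ]) (x : H) :
    b.leftMul s (r • x) = r • b.leftMul s x :=
  (b.leftMul s).map_smul_of_tower r x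

theorem leftMul_coe (b : QHilbertBasis ι H) (r : ℝ) (x : H) :
    b.leftMul (r : ℍ[ℝ]) x = r • x := by
  have h : (r : ℍ[ℝ]) = r • (1 : ℍ[ℝ]) := by
    rw [← Quaternion.coe_mul_eq_smul, mul_one]
  rw [h, leftMul_real_smul, leftMul_apply, one_smul, LinearIsometryEquiv.symm_apply_apply]

theorem norm_leftMul_le (b : QHilbertBasis ι H) (s : ℍ[ℝ]) (x : H) :
    ‖b.leftMul s x‖ ≤ ‖s‖ * ‖x‖ := by
  rw [leftMul_apply, LinearIsometryEquiv.norm_map]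
  refine (norm_smul_le s (b.coords x)).trans ?_
  rw [LinearIsometryEquiv.norm_map]

end QHilbertBasis

end LeftMul

/-! ### Slices and classes -/

section Slices

theorem mul_self_of_mem_imagUnits {J : ℍ[ℝ]} (hJ : J ∈ imagUnits) : J * J = -1 := by
  have h1 : star J = -J := by
    rw [Quaternion.star_eq_neg]
    exact hJ.1
  have h2 := Quaternion.self_mul_star J
  rw [h1, Quaternion.normSq_eq_norm_mul_self, hJ.2] at h2
  rw [mul_neg] at h2
  rw [← neg_neg (J * J), h2]
  simp

theorem neg_mem_imagUnits {J : ℍ[ℝ]} (hJ : J ∈ imagUnits) : -J ∈ imagUnits :=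
  ⟨by simpa using hJ.1, by simpa using hJ.2⟩

theorem re_slice {J : ℍ[ℝ]} (hJ : J ∈ imagUnits) (u v : ℝ) : ((u : ℍ[ℝ]) + v • J).re = u := by
  simp [hJ.1]

theorem im_slice {J : ℍ[ℝ]} (hJ : J ∈ imagUnits) (u v : ℝ) :
    ((u : ℍ[ℝ]) + v • J).im = v • J := by
  have h : J.im = J := by
    conv_rhs => rw [← Quaternion.re_add_im J, hJ.1]
    simp
  rw [Quaternion.im_add, Quaternion.im_smul, h]
  simp

theorem norm_im_slice {J : ℍ[ℝ]} (hJ : J ∈ imagUnits) (u v : ℝ) :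
    ‖((u : ℍ[ℝ]) + v • J).im‖ = |v| := by
  rw [im_slice hJ, norm_smul, hJ.2, mul_one, Real.norm_eq_abs]

theorem norm_sq_eq_re_im (q : ℍ[ℝ]) : ‖q‖ ^ 2 = q.re ^ 2 + ‖q.im‖ ^ 2 := by
  rw [sq, sq ‖q.im‖, ← Quaternion.normSq_eq_norm_mul_self, ← Quaternion.normSq_eq_norm_mul_self,
    Quaternion.normSq_def', Quaternion.normSq_def']
  simp
  ring

theorem norm_sq_slice {J : ℍ[ℝ]} (hJ : J ∈ imagUnits) (u v : ℝ) :
    ‖(u : ℍ[ℝ]) + v • J‖ ^ 2 = u ^ 2 + v ^ 2 := by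
  rw [norm_sq_eq_re_im, re_slice hJ, norm_im_slice hJ, sq_abs]

theorem mem_qClass_iff {I : ℍ[ℝ]} (hI : I ∈ imagUnits) {p q : ℍ[ℝ]} :
    p ∈ qClass q ↔ p.re = q.re ∧ ‖p.im‖ = ‖q.im‖ := by
  constructor
  · rintro ⟨J, hJ, rfl⟩
    exact ⟨re_slice hJ _ _, by rw [norm_im_slice hJ, abs_norm]⟩
  · rintro ⟨h1, h2⟩
    by_cases h0 : ‖p.im‖ = 0
    · refine ⟨I, hI, ?_⟩
      rw [← h2, ← h1, h0, zero_smul, add_zero]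
      conv_lhs => rw [← Quaternion.re_add_im p, norm_eq_zero.1 h0, add_zero]
    · refine ⟨‖p.im‖⁻¹ • p.im, ⟨by simp, ?_⟩, ?_⟩
      · rw [norm_smul, norm_inv, norm_norm, inv_mul_cancel₀ h0]
      · rw [← h2, ← h1, smul_smul, mul_inv_cancel₀ h0, one_smul, Quaternion.re_add_im]

theorem re_toSlice {I : ℍ[ℝ]} (hI : I ∈ imagUnits) (z : ℂ) : (toSlice I z).re = z.re :=
  re_slice hI _ _

theorem norm_im_toSlice {I : ℍ[ℝ]} (hI : I ∈ imagUnits) (z : ℂ) :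
    ‖(toSlice I z).im‖ = |z.im| := norm_im_slice hI _ _

theorem norm_toSlice {I : ℍ[ℝ]} (hI : I ∈ imagUnits) (z : ℂ) : ‖toSlice I z‖ = ‖z‖ := by
  have h : ‖toSlice I z‖ ^ 2 = ‖z‖ ^ 2 := by
    rw [toSlice, norm_sq_slice hI, Complex.sq_norm, Complex.normSq_apply]; ring
  exact (pow_left_inj₀ (norm_nonneg _) (norm_nonneg _) two_ne_zero).1 h

theorem norm_eq_norm_of_class {p : ℍ[ℝ]} {z : ℂ} (h1 : p.re = z.re) (h2 : ‖p.im‖ = |z.im|) :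
    ‖p‖ = ‖z‖ := by
  have h : ‖p‖ ^ 2 = ‖z‖ ^ 2 := by
    rw [norm_sq_eq_re_im, h1, h2, sq_abs, Complex.sq_norm, Complex.normSq_apply]; ring
  exact (pow_left_inj₀ (norm_nonneg _) (norm_nonneg _) two_ne_zero).1 h

theorem toSlice_injective {I : ℍ[ℝ]} (hI : I ∈ imagUnits) : Function.Injective (toSlice I) := by
  intro z w h
  have h1 := re_toSlice hI z
  rw [h, re_toSlice hI w] at h1
  refine Complex.ext h1.symm ?_
  have hI0 : I ≠ 0 := by
    rintro rfl
    simpa using hI.2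
  unfold toSlice at h
  rw [h1] at h
  exact smul_left_injective ℝ hI0 (add_left_cancel h)

theorem mem_axialCompletion_iff {I : ℍ[ℝ]} (hI : I ∈ imagUnits) {A : Set ℂ} {p : ℍ[ℝ]} :
    p ∈ axialCompletion (toSlice I '' A) ↔ ∃ z ∈ A, p.re = z.re ∧ ‖p.im‖ = |z.im| := by
  simp only [axialCompletion, mem_iUnion, mem_image, exists_prop, exists_exists_and_eq_and,
    mem_qClass_iff hI, re_toSlice hI, norm_im_toSlice hI]

/-- A class meets every slice in a conjugate pair. This is why the mirror image of the subarc enters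
on the complex side. -/
theorem slice_mem_axialCompletion_iff {I J : ℍ[ℝ]} (hI : I ∈ imagUnits) (hJ : J ∈ imagUnits)
    {γ : ℝ → ℂ} {t₁ t₂ : ℝ} {u v : ℝ} :
    (u : ℍ[ℝ]) + v • J ∈ axialCompletion (toSlice I '' (γ '' Icc t₁ t₂)) ↔
      (⟨u, v⟩ : ℂ) ∈ conjSubarc γ t₁ t₂ := by
  rw [mem_axialCompletion_iff hI, re_slice hJ, norm_im_slice hJ]
  constructor
  · rintro ⟨z, hz, h1, h2⟩
    rcases abs_eq_abs.1 h2 with h3 | h3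
    · left
      rwa [show (⟨u, v⟩ : ℂ) = z from Complex.ext h1 h3]
    · exact Or.inr ⟨z, hz, Complex.ext h1.symm (by simp [h3])⟩
  · rintro (h | ⟨z, hz, h⟩)
    · exact ⟨_, h, rfl, rfl⟩
    · refine ⟨z, hz, ?_, ?_⟩
      · have := congrArg Complex.re h
        simpa using this.symm
      · have := congrArg Complex.im h
        simp only [Complex.conj_im] at this
        rw [← this, abs_neg]

theorem eq_of_mem_qClass {I : ℍ[ℝ]} (hI : I ∈ imagUnits) {z w : ℂ} (h : 0 ≤ z.im * w.im)
    (hzw : toSlice I z ∈ qClass (toSlice I w)) : z = w := by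
  rw [mem_qClass_iff hI, re_toSlice hI, re_toSlice hI, norm_im_toSlice hI,
    norm_im_toSlice hI] at hzw
  refine Complex.ext hzw.1 ?_
  rcases abs_eq_abs.1 hzw.2 with h1 | h1
  · exact h1
  · have : w.im = 0 := by
      rw [h1] at h
      nlinarith [sq_nonneg w.im]
    rw [h1, this, neg_zero]

/-- Members of the two classes differ by at least the distance of the points (Re, |Im|) in the
closed half-plane. This is |z - w| only if z and w are on the same side of the real axis, hence the
sign condition. -/
theorem norm_sub_le_classDist {I : ℍ[ℝ]} (hI : I ∈ imagUnits) {z w : ℂ} {s : ℍ[ℝ]}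
    (hs : s ∈ qClass (toSlice I z)) (h : 0 ≤ z.im * w.im) :
    ‖z - w‖ ≤ classDist s (toSlice I w) := by
  rw [mem_qClass_iff hI, re_toSlice hI, norm_im_toSlice hI] at hs
  refine le_csInf ?_ ?_
  · exact ⟨_, s, (mem_qClass_iff hI).2 ⟨rfl, rfl⟩, toSlice I w,
      (mem_qClass_iff hI).2 ⟨rfl, rfl⟩, rfl⟩
  · rintro _ ⟨p, hp, q, hq, rfl⟩
    rw [mem_qClass_iff hI] at hp hq
    rw [re_toSlice hI, norm_im_toSlice hI] at hq
    rw [hs.1, hs.2] at hp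
    have h1 : ‖z - w‖ ^ 2 ≤ ‖p - q‖ ^ 2 := by
      rw [norm_sq_eq_re_im, Complex.sq_norm, Complex.normSq_apply, Quaternion.re_sub,
        Quaternion.im_sub, hp.1, hq.1]
      have h2 := abs_norm_sub_norm_le p.im q.im
      rw [hp.2, hq.2] at h2
      have h3 : (|z.im| - |w.im|) ^ 2 ≤ ‖p.im - q.im‖ ^ 2 := by
        rw [← sq_abs]
        gcongr
      have h4 : (|z.im| - |w.im|) ^ 2 = (z.im - w.im) ^ 2 := by
        have h5 : |z.im| * |w.im| = z.im * w.im := by rw [← abs_mul, abs_of_nonneg h]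
        nlinarith [sq_abs z.im, sq_abs w.im]
      simp only [Complex.sub_re, Complex.sub_im]
      nlinarith
    exact (pow_le_pow_iff_left₀ (norm_nonneg _) (norm_nonneg _) two_ne_zero).1 h1

end Slices

/-! ### The complex operator underlying a right linear operator -/

section RightComplex

variable {H : Type*} [NormedAddCommGroup H] [NormedSpace ℝ H] [Module ℍ[ℝ]ᵐᵒᵖ H]
  [QInnerProductSpace H]

/-- The inclusion of the complex numbers in the opposite quaternions. -/
noncomputable def complexToQuaternionOp : ℂ →+* ℍ[ℝ]ᵐᵒᵖ :=
  (Quaternion.ofComplex : ℂ →ₐ[ℝ] ℍ[ℝ]).toRingHom.toOpposite fun z w => by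
    change Quaternion.ofComplex z * Quaternion.ofComplex w =
      Quaternion.ofComplex w * Quaternion.ofComplex z
    rw [← map_mul, mul_comm, map_mul]

theorem norm_coeComplex (z : ℂ) : ‖(z : ℍ[ℝ])‖ = ‖z‖ := by
  have h : ‖(z : ℍ[ℝ])‖ ^ 2 = ‖z‖ ^ 2 := by
    rw [sq, ← Quaternion.normSq_eq_norm_mul_self, Quaternion.normSq_def', Complex.sq_norm,
      Complex.normSq_apply]
    simp
    ring
  exact (pow_left_inj₀ (norm_nonneg _) (norm_nonneg _) two_ne_zero).1 h

/-- The complex structure on a right quaternionic space given by right multiplication with complex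
numbers. -/
noncomputable abbrev rightComplexModule : Module ℂ H :=
  Module.compHom H complexToQuaternionOp

/-- The complex normed space underlying a right quaternionic inner product space. -/
noncomputable abbrev rightComplexNormedSpace : NormedSpace ℂ H where
  toModule := rightComplexModule
  norm_smul_le z x := by
    change ‖x <• (z : ℍ[ℝ])‖ ≤ _
    rw [QInnerProductSpace.norm_rsmul, norm_coeComplex, mul_comm]

attribute [local instance] rightComplexNormedSpace

theorem rightComplex_smul_def (z : ℂ) (x : H) : z • x = x <• (z : ℍ[ℝ]) := rfl

theorem rightComplex_ofReal_smul (r : ℝ) (x : H) : (r : ℂ) • x = r • x := by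
  rw [rightComplex_smul_def, Quaternion.coeComplex_coe, QInnerProductSpace.rsmul_coe]

theorem rightComplex_isScalarTower : IsScalarTower ℝ ℂ H :=
  ⟨fun r z x => by rw [Complex.real_smul, mul_smul, rightComplex_ofReal_smul]⟩

attribute [local instance] rightComplex_isScalarTower

/-- A bounded right linear operator as a complex linear operator. -/
noncomputable def toComplexCLM (T : H →L[ℍ[ℝ]ᵐᵒᵖ] H) : H →L[ℂ] H where
  toFun := T
  map_add' := T.map_add
  map_smul' z x := T.map_smul (complexToQuaternionOp z) x
  cont := T.continuous

theorem toComplexCLM_apply (T : H →L[ℍ[ℝ]ᵐᵒᵖ] H) (x : H) : toComplexCLM T x = T x := rfl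

theorem map_complex_smul (T : H →L[ℍ[ℝ]ᵐᵒᵖ] H) (z : ℂ) (x : H) : T (z • x) = z • T x :=
  (toComplexCLM T).map_smul z x

/-- The quaternionic unit `j`. -/
def quaternionJ : ℍ[ℝ] := ⟨0, 0, 1, 0⟩

theorem re_quaternionJ : quaternionJ.re = 0 := rfl

theorem imI_quaternionJ : quaternionJ.imI = 0 := rfl

theorem imJ_quaternionJ : quaternionJ.imJ = 1 := rfl

theorem imK_quaternionJ : quaternionJ.imK = 0 := rfl

/-- Because zj = jz̄, right multiplication by j is conjugate linear. Being isometric and commuting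
with right linear operators, it yields the symmetry of spectrum and resolvent norm. -/
theorem smul_rsmul_quaternionJ (z : ℂ) (x : H) :
    (z • x) <• quaternionJ = (starRingEnd ℂ) z • (x <• quaternionJ) := by
  rw [rightComplex_smul_def, rightComplex_smul_def, smul_smul, smul_smul, ← MulOpposite.op_mul,
    ← MulOpposite.op_mul]
  congr 2
  ext <;> simp [re_quaternionJ, imI_quaternionJ, imJ_quaternionJ, imK_quaternionJ]

theorem quaternionJ_mul_self : quaternionJ * quaternionJ = -1 := by
  ext <;> simp [re_quaternionJ, imI_quaternionJ, imJ_quaternionJ, imK_quaternionJ]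

theorem rsmul_quaternionJ_rsmul {M : Type*} [AddCommGroup M] [Module ℍ[ℝ]ᵐᵒᵖ M] (x : M) :
    (x <• quaternionJ) <• quaternionJ = -x := by
  rw [smul_smul, ← MulOpposite.op_mul, quaternionJ_mul_self]
  simp

theorem norm_rsmul_quaternionJ (x : H) : ‖x <• quaternionJ‖ = ‖x‖ := by
  have h : ‖quaternionJ‖ * ‖quaternionJ‖ = 1 := by
    rw [← norm_mul, quaternionJ_mul_self, norm_neg, norm_one]
  have h2 : ‖quaternionJ‖ = 1 := by nlinarith [norm_nonneg quaternionJ]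
  rw [QInnerProductSpace.norm_rsmul, h2, mul_one]

theorem pseudoResolventInv_apply (T : H →L[ℍ[ℝ]ᵐᵒᵖ] H) (s : ℍ[ℝ]) (x : H) :
    pseudoResolventInv T s x = T (T x) - (2 * s.re) • T x + ‖s‖ ^ 2 • x := by
  simp [pseudoResolventInv, pow_two]

/-- The factorization of `T² - 2 Re(s) T + |s|²`. -/
theorem pseudoResolventInv_eq (T : H →L[ℍ[ℝ]ᵐᵒᵖ] H) {s : ℍ[ℝ]} {z : ℂ} (h1 : s.re = z.re)
    (h2 : ‖s‖ = ‖z‖) (x : H) :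
    z • ((starRingEnd ℂ) z • x - T x) - T ((starRingEnd ℂ) z • x - T x) =
      pseudoResolventInv T s x := by
  rw [pseudoResolventInv_apply, map_sub, map_complex_smul, smul_sub, smul_smul, Complex.mul_conj,
    h1, h2, Complex.normSq_eq_norm_sq, rightComplex_ofReal_smul]
  have h3 : z • T x + (starRingEnd ℂ) z • T x = (2 * z.re) • T x := by
    rw [← add_smul, Complex.add_conj, rightComplex_ofReal_smul]
  rw [← h3]
  abel

theorem bijective_iff_notMem_spectrum [CompleteSpace H] (A : H →L[ℂ] H) (z : ℂ) :
    z ∉ spectrum ℂ A ↔ Function.Bijective fun x => z • x - A x := by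
  rw [spectrum.notMem_iff, ContinuousLinearMap.isUnit_iff_bijective]
  have : ⇑(algebraMap ℂ (H →L[ℂ] H) z - A) = fun x => z • x - A x := by
    ext x
    simp [ContinuousLinearMap.algebraMap_apply]
  rw [this]

theorem pseudoResolvent_congr (T : H →L[ℍ[ℝ]ᵐᵒᵖ] H) {s t : ℍ[ℝ]} (h1 : s.re = t.re)
    (h2 : ‖s‖ = ‖t‖) : pseudoResolvent T s = pseudoResolvent T t := by
  unfold pseudoResolvent pseudoResolventInv
  rw [h1, h2]

theorem pseudoResolventInv_pseudoResolvent {T : H →L[ℍ[ℝ]ᵐᵒᵖ] H} {s : ℍ[ℝ]}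
    (hs : s ∉ sSpectrum T) (x : H) : pseudoResolventInv T s (pseudoResolvent T s x) = x :=
  DFunLike.congr_fun (Ring.mul_inverse_cancel _ (not_not.1 hs)) x

theorem pseudoResolvent_pseudoResolventInv {T : H →L[ℍ[ℝ]ᵐᵒᵖ] H} {s : ℍ[ℝ]}
    (hs : s ∉ sSpectrum T) (x : H) : pseudoResolvent T s (pseudoResolventInv T s x) = x :=
  DFunLike.congr_fun (Ring.inverse_mul_cancel _ (not_not.1 hs)) x

/-- A real linear operator commuting with `T` commutes with the pseudo-resolvent. -/
theorem pseudoResolvent_comm {T : H →L[ℍ[ℝ]ᵐᵒᵖ] H} {s : ℍ[ℝ]} (hs : s ∉ sSpectrum T)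
    (L : H →L[ℝ] H) (hL : ∀ x, L (T x) = T (L x)) (x : H) :
    pseudoResolvent T s (L x) = L (pseudoResolvent T s x) := by
  have h : pseudoResolventInv T s (L (pseudoResolvent T s x)) = L x := by
    have h1 := congrArg L (pseudoResolventInv_pseudoResolvent hs x)
    rw [pseudoResolventInv_apply] at h1 ⊢
    rw [← h1]
    simp [hL]
  rw [← h, pseudoResolvent_pseudoResolventInv hs]

theorem pseudoResolvent_map {T : H →L[ℍ[ℝ]ᵐᵒᵖ] H} {s : ℍ[ℝ]} (hs : s ∉ sSpectrum T) (x : H) :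
    pseudoResolvent T s (T x) = T (pseudoResolvent T s x) :=
  pseudoResolvent_comm hs (T.restrictScalars ℝ) (fun _ => rfl) x

theorem resolvent_conj_apply {T : H →L[ℍ[ℝ]ᵐᵒᵖ] H} {z : ℂ}
    (hz : z ∉ spectrum ℂ (toComplexCLM T)) (hz' : (starRingEnd ℂ) z ∉ spectrum ℂ (toComplexCLM T))
    (x : H) :
    resolvent (toComplexCLM T) ((starRingEnd ℂ) z) (x <• quaternionJ) =
      resolvent (toComplexCLM T) z x <• quaternionJ := by
  rw [← resolvent_apply_sub hz' (resolvent (toComplexCLM T) z x <• quaternionJ)]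
  congr 1
  have h1 := sub_apply_resolvent hz x
  rw [toComplexCLM_apply] at h1
  rw [toComplexCLM_apply, map_smul, ← smul_rsmul_quaternionJ, ← smul_sub, h1]

variable [CompleteSpace H]

theorem conj_notMem_spectrum {T : H →L[ℍ[ℝ]ᵐᵒᵖ] H} {z : ℂ}
    (hz : z ∉ spectrum ℂ (toComplexCLM T)) :
    (starRingEnd ℂ) z ∉ spectrum ℂ (toComplexCLM T) := by
  rw [bijective_iff_notMem_spectrum] at hz ⊢
  have key : ∀ x : H, (starRingEnd ℂ) z • (x <• quaternionJ) - toComplexCLM T (x <• quaternionJ) =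
      (z • x - toComplexCLM T x) <• quaternionJ := fun x => by
    rw [toComplexCLM_apply, toComplexCLM_apply, map_smul, ← smul_rsmul_quaternionJ, smul_sub]
  have hinv : ∀ x : H, (-(x <• quaternionJ)) <• quaternionJ = x := fun x => by
    rw [smul_neg, rsmul_quaternionJ_rsmul, neg_neg]
  constructor
  · intro x y hxy
    beta_reduce at hxy
    rw [← hinv x, ← hinv y, key, key] at hxy
    have h1 := congrArg (fun w : H => w <• quaternionJ) hxy
    simp only [rsmul_quaternionJ_rsmul, neg_inj] at h1
    have h2 := hz.1 h1
    have h3 : x <• quaternionJ = y <• quaternionJ := neg_inj.1 h2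
    rw [← hinv x, ← hinv y, h3]
  · intro y
    obtain ⟨x, hx⟩ := hz.2 (-(y <• quaternionJ))
    refine ⟨x <• quaternionJ, ?_⟩
    beta_reduce at hx ⊢
    rw [key, hx, hinv]

theorem conj_mem_spectrum {T : H →L[ℍ[ℝ]ᵐᵒᵖ] H} {z : ℂ}
    (hz : z ∈ spectrum ℂ (toComplexCLM T)) :
    (starRingEnd ℂ) z ∈ spectrum ℂ (toComplexCLM T) := by
  by_contra H
  have := conj_notMem_spectrum H
  rw [Complex.conj_conj] at this
  exact this hz

theorem norm_resolvent_conj_le (T : H →L[ℍ[ℝ]ᵐᵒᵖ] H) (z : ℂ) :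
    ‖resolvent (toComplexCLM T) ((starRingEnd ℂ) z)‖ ≤ ‖resolvent (toComplexCLM T) z‖ := by
  by_cases hz : z ∈ spectrum ℂ (toComplexCLM T)
  · have h := conj_mem_spectrum hz
    rw [spectrum.mem_iff] at h
    rw [resolvent, Ring.inverse_non_unit _ h, norm_zero]
    exact norm_nonneg _
  · refine ContinuousLinearMap.opNorm_le_bound _ (norm_nonneg _) fun x => ?_
    have h := resolvent_conj_apply hz (conj_notMem_spectrum hz) (-(x <• quaternionJ))
    rw [smul_neg, rsmul_quaternionJ_rsmul, neg_neg] at h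
    rw [h, norm_rsmul_quaternionJ]
    refine (ContinuousLinearMap.le_opNorm _ _).trans ?_
    rw [norm_neg, norm_rsmul_quaternionJ]

/-- The algebraic inverse is right linear, and it is continuous because it agrees with the bounded
inverse of the complex operator. -/
theorem isUnit_iff_bijective_of_rightLinear (P : H →L[ℍ[ℝ]ᵐᵒᵖ] H) :
    IsUnit P ↔ Function.Bijective P := by
  constructor
  · rintro ⟨u, rfl⟩
    refine Function.bijective_iff_has_inverse.2 ⟨((u⁻¹ : (H →L[ℍ[ℝ]ᵐᵒᵖ] H)ˣ) : H →L[ℍ[ℝ]ᵐᵒᵖ] H),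
      fun x => ?_, fun x => ?_⟩
    · exact DFunLike.congr_fun u.inv_mul x
    · exact DFunLike.congr_fun u.mul_inv x
  · intro hP
    have hP' : Function.Bijective (toComplexCLM P) := hP
    obtain ⟨u, hu⟩ := (ContinuousLinearMap.isUnit_iff_bijective (f := toComplexCLM P)).2 hP'
    let e : H ≃ₗ[ℍ[ℝ]ᵐᵒᵖ] H := LinearEquiv.ofBijective (P : H →ₗ[ℍ[ℝ]ᵐᵒᵖ] H) hP
    have hPe : ∀ x, P x = e x := fun _ => rfl
    have he : ∀ x, e.symm x = ((u⁻¹ : (H →L[ℂ] H)ˣ) : H →L[ℂ] H) x := by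
      intro x
      rw [LinearEquiv.symm_apply_eq, ← hPe]
      have := DFunLike.congr_fun u.mul_inv x
      rw [hu] at this
      exact this.symm
    let Q : H →L[ℍ[ℝ]ᵐᵒᵖ] H := ⟨e.symm, by
      have : Continuous (fun x => ((u⁻¹ : (H →L[ℂ] H)ˣ) : H →L[ℂ] H) x) :=
        ContinuousLinearMap.continuous _
      exact this.congr fun x => (he x).symm⟩
    refine ⟨⟨P, Q, ?_, ?_⟩, rfl⟩
    · ext x
      exact e.apply_symm_apply x
    · ext x
      exact e.symm_apply_apply x

/-- The slices of the `S`-spectrum are the spectrum of the complex operator. -/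
theorem mem_sSpectrum_iff {T : H →L[ℍ[ℝ]ᵐᵒᵖ] H} {s : ℍ[ℝ]} {z : ℂ} (h1 : s.re = z.re)
    (h2 : ‖s‖ = ‖z‖) : s ∈ sSpectrum T ↔ z ∈ spectrum ℂ (toComplexCLM T) := by
  rw [← not_iff_not]
  change ¬¬ IsUnit _ ↔ _
  rw [not_not, isUnit_iff_bijective_of_rightLinear]
  -- With the factors in either order, a bijective composite makes z - A surjective as the outer
  -- factor and injective as the inner one.
  have e1 : ⇑(pseudoResolventInv T s) = (fun x => z • x - toComplexCLM T x) ∘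
      (fun x => (starRingEnd ℂ) z • x - toComplexCLM T x) := by
    funext x
    exact (pseudoResolventInv_eq T h1 h2 x).symm
  have e2 : ⇑(pseudoResolventInv T s) = (fun x => (starRingEnd ℂ) z • x - toComplexCLM T x) ∘
      (fun x => z • x - toComplexCLM T x) := by
    funext x
    have := pseudoResolventInv_eq T (s := s) (z := (starRingEnd ℂ) z) (by simpa using h1)
      (by simpa using h2) x
    rw [Complex.conj_conj] at this
    exact this.symm
  constructor
  · intro h
    rw [bijective_iff_notMem_spectrum]
    refine ⟨?_, ?_⟩
    · rw [e2] at h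
      exact h.1.of_comp
    · rw [e1] at h
      exact h.2.of_comp
  · intro h
    rw [e1]
    exact ((bijective_iff_notMem_spectrum _ _).1 h).comp
      ((bijective_iff_notMem_spectrum _ _).1 (conj_notMem_spectrum h))

/-- The complex resolvent in terms of the pseudo-resolvent. -/
theorem resolvent_eq_pseudoResolvent {T : H →L[ℍ[ℝ]ᵐᵒᵖ] H} {s : ℍ[ℝ]} {z : ℂ} (h1 : s.re = z.re)
    (h2 : ‖s‖ = ‖z‖) (hz : z ∉ spectrum ℂ (toComplexCLM T)) (x : H) :
    resolvent (toComplexCLM T) z x =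
      (starRingEnd ℂ) z • pseudoResolvent T s x - T (pseudoResolvent T s x) := by
  have hs : s ∉ sSpectrum T := fun H => hz ((mem_sSpectrum_iff h1 h2).1 H)
  have h3 := pseudoResolventInv_eq T h1 h2 (pseudoResolvent T s x)
  rw [pseudoResolventInv_pseudoResolvent hs] at h3
  have h4 := resolvent_apply_sub hz
    ((starRingEnd ℂ) z • pseudoResolvent T s x - T (pseudoResolvent T s x))
  rw [toComplexCLM_apply, h3] at h4
  exact h4

end RightComplex

/-! ### Slice hyperholomorphic versus holomorphic extensions -/

section Translation

variable {ι H : Type*} [NormedAddCommGroup H] [NormedSpace ℝ H] [Module ℍ[ℝ]ᵐᵒᵖ H]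
  [QInnerProductSpace H]

attribute [local instance] rightComplexNormedSpace rightComplex_isScalarTower

theorem norm_apply_le_rightOpNorm (A : H →L[ℍ[ℝ]ᵐᵒᵖ] H) (x : H) :
    ‖A x‖ ≤ rightOpNorm A * ‖x‖ :=
  (A.restrictScalars ℝ).le_opNorm x

theorem star_slice {J : ℍ[ℝ]} (hJ : J ∈ imagUnits) (u v : ℝ) :
    star ((u : ℍ[ℝ]) + v • J) = (u : ℍ[ℝ]) - v • J := by
  have h1 : star J = -J := by
    rw [Quaternion.star_eq_neg]
    exact hJ.1
  rw [star_add, Quaternion.star_coe, Quaternion.star_smul, h1, smul_neg, sub_eq_add_neg]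

/-- `α + i β` with real differentiable `α`, `β` that satisfy the Cauchy-Riemann equations and extend
the components of the right `S`-resolvent applied to `x`. -/
def HasPairExtension (T : H →L[ℍ[ℝ]ᵐᵒᵖ] H) (I : ℍ[ℝ]) (E : Set ℂ) (x : H) : Prop :=
  ∃ α β : ℝ × ℝ → H,
    (∀ u v : ℝ, (⟨u, v⟩ : ℂ) ∉ E →
      α (u, -v) = α (u, v) ∧ β (u, -v) = -β (u, v) ∧
      DifferentiableAt ℝ α (u, v) ∧ DifferentiableAt ℝ β (u, v) ∧
      fderiv ℝ α (u, v) (1, 0) - fderiv ℝ β (u, v) (0, 1) = 0 ∧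
      fderiv ℝ α (u, v) (0, 1) + fderiv ℝ β (u, v) (1, 0) = 0) ∧
    ∀ u v : ℝ, (u : ℍ[ℝ]) + v • I ∉ sSpectrum T →
      α (u, v) = u • pseudoResolvent T ((u : ℍ[ℝ]) + v • I) x -
        T (pseudoResolvent T ((u : ℍ[ℝ]) + v • I) x) ∧
      β (u, v) = -(v • pseudoResolvent T ((u : ℍ[ℝ]) + v • I) x)

/-- Only real linearity of `L` is assumed, so this covers both operators commuting with `T` and
right multiplication by an arbitrary quaternion, which is not complex linear in general. -/
theorem HasPairExtension.map {T : H →L[ℍ[ℝ]ᵐᵒᵖ] H} {I : ℍ[ℝ]} {E : Set ℂ} {x : H}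
    (h : HasPairExtension T I E x) (L : H →L[ℝ] H) (hL : ∀ x, L (T x) = T (L x)) :
    HasPairExtension T I E (L x) := by
  obtain ⟨α, β, h1, h2⟩ := h
  refine ⟨fun p => L (α p), fun p => L (β p), fun u v huv => ?_, fun u v huv => ?_⟩
  · obtain ⟨a1, a2, a3, a4, a5, a6⟩ := h1 u v huv
    have e1 : fderiv ℝ (fun p => L (α p)) (u, v) = L.comp (fderiv ℝ α (u, v)) :=
      (L.hasFDerivAt.comp (u, v) a3.hasFDerivAt).fderiv
    have e2 : fderiv ℝ (fun p => L (β p)) (u, v) = L.comp (fderiv ℝ β (u, v)) :=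
      (L.hasFDerivAt.comp (u, v) a4.hasFDerivAt).fderiv
    refine ⟨congrArg L a1, (congrArg L a2).trans (map_neg L _), L.differentiableAt.comp _ a3,
      L.differentiableAt.comp _ a4, ?_, ?_⟩
    · rw [e1, e2, ContinuousLinearMap.comp_apply, ContinuousLinearMap.comp_apply, ← map_sub, a5,
        map_zero]
    · rw [e1, e2, ContinuousLinearMap.comp_apply, ContinuousLinearMap.comp_apply, ← map_add, a6,
        map_zero]
  · obtain ⟨a1, a2⟩ := h2 u v huv
    beta_reduce
    rw [a1, a2, map_sub, map_neg, map_smul, map_smul, hL, pseudoResolvent_comm huv L hL]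
    exact ⟨rfl, rfl⟩

theorem HasPairExtension.add {T : H →L[ℍ[ℝ]ᵐᵒᵖ] H} {I : ℍ[ℝ]} {E : Set ℂ} {x y : H}
    (hx : HasPairExtension T I E x) (hy : HasPairExtension T I E y) :
    HasPairExtension T I E (x + y) := by
  obtain ⟨α, β, h1, h2⟩ := hx
  obtain ⟨α', β', h1', h2'⟩ := hy
  refine ⟨α + α', β + β', fun u v huv => ?_, fun u v huv => ?_⟩
  · obtain ⟨a1, a2, a3, a4, a5, a6⟩ := h1 u v huv
    obtain ⟨b1, b2, b3, b4, b5, b6⟩ := h1' u v huv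
    rw [fderiv_add a3 b3, fderiv_add a4 b4]
    refine ⟨by simp [a1, b1], by simp [a2, b2, add_comm], a3.add b3, a4.add b4, ?_, ?_⟩
    · have : ∀ p q r s : H, p + q - (r + s) = (p - r) + (q - s) := fun p q r s => by abel
      simp only [add_apply]
      rw [this, a5, b5, add_zero]
    · have : ∀ p q r s : H, p + q + (r + s) = (p + r) + (q + s) := fun p q r s => by abel
      simp only [add_apply]
      rw [this, a6, b6, add_zero]
  · obtain ⟨a1, a2⟩ := h2 u v huv
    obtain ⟨b1, b2⟩ := h2' u v huv
    simp only [Pi.add_apply, a1, a2, b1, b2, map_add, smul_add]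
    exact ⟨by abel, by abel⟩

theorem HasPairExtension.zero (T : H →L[ℍ[ℝ]ᵐᵒᵖ] H) (I : ℍ[ℝ]) (E : Set ℂ) :
    HasPairExtension T I E 0 :=
  ⟨0, 0, fun u v _ => by simp, fun u v _ => by simp⟩

theorem pseudoResolvent_slice_congr (T : H →L[ℍ[ℝ]ᵐᵒᵖ] H) {J J' : ℍ[ℝ]} (hJ : J ∈ imagUnits)
    (hJ' : J' ∈ imagUnits) (u : ℝ) {v v' : ℝ} (hv : v ^ 2 = v' ^ 2) :
    pseudoResolvent T ((u : ℍ[ℝ]) + v • J) = pseudoResolvent T ((u : ℍ[ℝ]) + v' • J') := by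
  refine pseudoResolvent_congr T (by rw [re_slice hJ, re_slice hJ']) ?_
  refine (pow_left_inj₀ (norm_nonneg _) (norm_nonneg _) two_ne_zero).1 ?_
  rw [norm_sq_slice hJ, norm_sq_slice hJ', hv]

variable [CompleteSpace H]

theorem leftMul_unit_injective (b : QHilbertBasis ι H) {J : ℍ[ℝ]} (hJ : J ∈ imagUnits) {x y : H}
    (h : b.leftMul J x = b.leftMul J y) : x = y := by
  have h1 := congrArg (b.leftMul J) h
  rw [b.leftMul_leftMul, b.leftMul_leftMul, mul_self_of_mem_imagUnits hJ, b.leftMul_neg,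
    b.leftMul_neg, neg_inj] at h1
  simpa [QHilbertBasis.leftMul_apply] using h1

theorem leftSResolvent_apply (b : QHilbertBasis ι H) (T : H →L[ℍ[ℝ]ᵐᵒᵖ] H) {J : ℍ[ℝ]}
    (hJ : J ∈ imagUnits) (u v : ℝ) (x : H) :
    leftSResolvent b T ((u : ℍ[ℝ]) + v • J) x =
      (u • pseudoResolvent T ((u : ℍ[ℝ]) + v • J) x - pseudoResolvent T ((u : ℍ[ℝ]) + v • J) (T x))
      - v • pseudoResolvent T ((u : ℍ[ℝ]) + v • J) (b.leftMul J x) := by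
  change -(pseudoResolvent T ((u : ℍ[ℝ]) + v • J) (T x - b.leftMul (star ((u : ℍ[ℝ]) + v • J)) x))
    = _
  rw [star_slice hJ, b.leftMul_sub, b.leftMul_coe, b.leftMul_real_smul, map_sub, map_sub,
    (pseudoResolvent T _).map_smul_of_tower u, (pseudoResolvent T _).map_smul_of_tower v]
  abel

theorem rightSResolvent_apply (b : QHilbertBasis ι H) (T : H →L[ℍ[ℝ]ᵐᵒᵖ] H) {J : ℍ[ℝ]}
    (hJ : J ∈ imagUnits) (u v : ℝ) (x : H) :
    rightSResolvent b T ((u : ℍ[ℝ]) + v • J) x =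
      (u • pseudoResolvent T ((u : ℍ[ℝ]) + v • J) x - T (pseudoResolvent T ((u : ℍ[ℝ]) + v • J) x))
      - v • b.leftMul J (pseudoResolvent T ((u : ℍ[ℝ]) + v • J) x) := by
  change -(T (pseudoResolvent T ((u : ℍ[ℝ]) + v • J) x) -
    b.leftMul (star ((u : ℍ[ℝ]) + v • J)) (pseudoResolvent T ((u : ℍ[ℝ]) + v • J) x)) = _
  rw [star_slice hJ, b.leftMul_sub, b.leftMul_coe, b.leftMul_real_smul]
  abel

/-- Bounds for the left `S`-resolvent on a class give bounds for the complex resolvent. -/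
theorem norm_resolvent_le_of_leftSResolvent (b : QHilbertBasis ι H) {T : H →L[ℍ[ℝ]ᵐᵒᵖ] H}
    {I : ℍ[ℝ]} (hI : I ∈ imagUnits) {z : ℂ} (hz : z ∉ spectrum ℂ (toComplexCLM T)) {C : ℝ}
    (hC : ∀ s ∈ qClass (toSlice I z), rightOpNorm (leftSResolvent b T s) ≤ C) :
    ‖resolvent (toComplexCLM T) z‖ ≤ 2 * C := by
  obtain ⟨u, v⟩ := z
  set s : ℍ[ℝ] := (u : ℍ[ℝ]) + v • I with hs
  set Q := pseudoResolvent T s with hQ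
  have hsz : toSlice I ⟨u, v⟩ = s := rfl
  have hre : s.re = u := re_slice hI u v
  have hn : ‖s‖ = ‖(⟨u, v⟩ : ℂ)‖ := norm_toSlice hI ⟨u, v⟩
  have hsσ : s ∉ sSpectrum T := fun H => hz ((mem_sSpectrum_iff hre hn).1 H)
  have h1 : ∀ x : H, ‖(u • Q x - Q (T x)) - v • Q (b.leftMul I x)‖ ≤ C * ‖x‖ := by
    intro x
    rw [← leftSResolvent_apply b T hI u v x]
    refine (norm_apply_le_rightOpNorm _ x).trans ?_
    gcongr
    exact hC _ ((mem_qClass_iff hI).2 ⟨rfl, rfl⟩)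
  -- The point u - vI lies in the same class. Half the sum and half the difference of the two
  -- resolvents bound the components separately.
  have h2 : ∀ x : H, ‖(u • Q x - Q (T x)) + v • Q (b.leftMul I x)‖ ≤ C * ‖x‖ := by
    intro x
    have hI' := neg_mem_imagUnits hI
    have := leftSResolvent_apply b T hI' u v x
    rw [pseudoResolvent_slice_congr T hI' hI u (v := v) (v' := v) rfl, b.leftMul_neg, map_neg,
      smul_neg v (pseudoResolvent T _ _), sub_neg_eq_add] at this
    rw [← this]
    refine (norm_apply_le_rightOpNorm _ x).trans ?_
    gcongr
    refine hC _ ((mem_qClass_iff hI).2 ⟨?_, ?_⟩)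
    · rw [re_slice hI', re_toSlice hI]
    · rw [norm_im_slice hI', norm_im_toSlice hI]
  have h3 : ∀ x : H, ‖u • Q x - Q (T x)‖ ≤ C * ‖x‖ := by
    intro x
    have e : (2 : ℝ) • (u • Q x - Q (T x)) = ((u • Q x - Q (T x)) - v • Q (b.leftMul I x)) +
        ((u • Q x - Q (T x)) + v • Q (b.leftMul I x)) := by rw [two_smul]; abel
    have := norm_add_le ((u • Q x - Q (T x)) - v • Q (b.leftMul I x))
      ((u • Q x - Q (T x)) + v • Q (b.leftMul I x))
    rw [← e, norm_smul, Real.norm_ofNat] at this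
    linarith [h1 x, h2 x]
  have h4 : ∀ x : H, ‖v • Q (b.leftMul I x)‖ ≤ C * ‖x‖ := by
    intro x
    have e : (2 : ℝ) • (v • Q (b.leftMul I x)) = ((u • Q x - Q (T x)) + v • Q (b.leftMul I x)) -
        ((u • Q x - Q (T x)) - v • Q (b.leftMul I x)) := by rw [two_smul]; abel
    have := norm_sub_le ((u • Q x - Q (T x)) + v • Q (b.leftMul I x))
      ((u • Q x - Q (T x)) - v • Q (b.leftMul I x))
    rw [← e, norm_smul, Real.norm_ofNat] at this
    linarith [h1 x, h2 x]
  have hC0 : 0 ≤ C := (norm_nonneg _).trans (hC s ((mem_qClass_iff hI).2 ⟨rfl, rfl⟩))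
  have h5 : ∀ x : H, ‖v • Q x‖ ≤ C * ‖x‖ := by
    intro x
    -- Left multiplication by -I undoes the one by I without increasing the norm.
    have h6 := h4 (b.leftMul (-I) x)
    rw [b.leftMul_leftMul, mul_neg, mul_self_of_mem_imagUnits hI, neg_neg] at h6
    have h7 : b.leftMul 1 x = x := by simp [QHilbertBasis.leftMul_apply]
    rw [h7] at h6
    refine h6.trans ?_
    have := b.norm_leftMul_le (-I) x
    rw [norm_neg, hI.2, one_mul] at this
    gcongr
  refine ContinuousLinearMap.opNorm_le_bound _ (by positivity) fun x => ?_
  rw [resolvent_eq_pseudoResolvent hre hn hz]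
  have e : (starRingEnd ℂ) (⟨u, v⟩ : ℂ) • Q x - T (Q x) =
      (u • Q x - Q (T x)) - Complex.I • (v • Q x) := by
    have : (starRingEnd ℂ) (⟨u, v⟩ : ℂ) = (u : ℂ) - Complex.I * (v : ℂ) := by
      apply Complex.ext <;> simp
    rw [this, sub_smul, mul_smul, rightComplex_ofReal_smul, rightComplex_ofReal_smul, hQ,
      pseudoResolvent_map hsσ]
    abel
  rw [e]
  refine (norm_sub_le _ _).trans ?_
  rw [norm_smul, Complex.norm_I, one_mul]
  linarith [h3 x, h5 x]

/-- The values at u + vI and u - vI determine α and β, so the components of an extension are those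
of the right S-resolvent off the spectrum. Conversely a pair (α, β) defines f on all slices at once.
-/
theorem exists_slice_extension_iff (b : QHilbertBasis ι H) {T : H →L[ℍ[ℝ]ᵐᵒᵖ] H} {I : ℍ[ℝ]}
    (hI : I ∈ imagUnits) {γ : ℝ → ℂ} {t₁ t₂ : ℝ}
    (hE : conjSubarc γ t₁ t₂ ⊆ spectrum ℂ (toComplexCLM T)) (x : H) :
    (∃ f : ℍ[ℝ] → H,
      IsLeftSliceHyperholomorphicOn b f (axialCompletion (toSlice I '' (γ '' Icc t₁ t₂)))ᶜ ∧
      ∀ s ∉ sSpectrum T, f s = rightSResolvent b T s x) ↔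
    HasPairExtension T I (conjSubarc γ t₁ t₂) x := by
  have hU : ∀ {J : ℍ[ℝ]}, J ∈ imagUnits → ∀ u v : ℝ, ((u : ℍ[ℝ]) + v • J ∈
      (axialCompletion (toSlice I '' (γ '' Icc t₁ t₂)))ᶜ ↔ (⟨u, v⟩ : ℂ) ∉ conjSubarc γ t₁ t₂) :=
    fun hJ u v => not_congr (slice_mem_axialCompletion_iff hI hJ)
  have hσ : ∀ {J : ℍ[ℝ]}, J ∈ imagUnits → ∀ u v : ℝ, ((u : ℍ[ℝ]) + v • J ∉ sSpectrum T ↔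
      (⟨u, v⟩ : ℂ) ∉ spectrum ℂ (toComplexCLM T)) := fun hJ u v =>
    not_congr (mem_sSpectrum_iff (re_slice hJ u v) (norm_toSlice hJ ⟨u, v⟩))
  constructor
  · rintro ⟨f, ⟨α, β, hαβ⟩, hf⟩
    refine ⟨α, β, fun u v huv => (hαβ u v I hI ((hU hI u v).2 huv)).2, fun u v huv => ?_⟩
    have hz := (hσ hI u v).1 huv
    have hI' := neg_mem_imagUnits hI
    have a1 := (hαβ u v I hI ((hU hI u v).2 fun H => hz (hE H))).1
    have a2 := (hαβ u v (-I) hI' ((hU hI' u v).2 fun H => hz (hE H))).1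
    rw [hf _ huv, rightSResolvent_apply b T hI] at a1
    rw [hf _ ((hσ hI' u v).2 hz), rightSResolvent_apply b T hI',
      pseudoResolvent_slice_congr T hI' hI u (v := v) (v' := v) rfl, b.leftMul_neg, b.leftMul_neg,
      smul_neg, sub_neg_eq_add, ← sub_eq_add_neg] at a2
    set y := pseudoResolvent T ((u : ℍ[ℝ]) + v • I) x with hy
    have a3 : α (u, v) = u • y - T y := by
      have e : (2 : ℝ) • α (u, v) = (2 : ℝ) • (u • y - T y) := by
        rw [two_smul, two_smul]
        calc α (u, v) + α (u, v) = (α (u, v) + b.leftMul I (β (u, v))) +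
              (α (u, v) - b.leftMul I (β (u, v))) := by abel
          _ = _ := by rw [← a1, ← a2]; abel
      exact smul_right_injective H (two_ne_zero (α := ℝ)) e
    refine ⟨a3, leftMul_unit_injective b hI ?_⟩
    rw [map_neg, b.leftMul_smul_right]
    rw [a3, sub_eq_add_neg, add_right_inj] at a1
    exact a1.symm
  · rintro ⟨α, β, h1, h2⟩
    -- At real p in the domain the unit degenerates to 0, which is harmless because the odd function
    -- β vanishes there.
    refine ⟨fun p => α (p.re, ‖p.im‖) + b.leftMul (‖p.im‖⁻¹ • p.im) (β (p.re, ‖p.im‖)),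
      ⟨α, β, fun u v J hJ huv => ⟨?_, h1 u v ((hU hJ u v).1 huv)⟩⟩, fun s hs => ?_⟩
    · obtain ⟨a1, a2, -⟩ := h1 u v ((hU hJ u v).1 huv)
      beta_reduce
      rw [re_slice hJ, norm_im_slice hJ, im_slice hJ]
      rcases lt_trichotomy v 0 with hv | rfl | hv
      · rw [abs_of_neg hv, a1, a2, smul_smul, map_neg, ← b.leftMul_neg, ← neg_smul,
          show -((-v)⁻¹ * v) = 1 by
            rw [inv_neg, neg_mul, neg_neg, inv_mul_cancel₀ hv.ne], one_smul]
      · have hβ : β (u, 0) = 0 := by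
          rw [neg_zero] at a2
          have : (2 : ℝ) • β (u, 0) = 0 := by
            rw [two_smul]
            nth_rewrite 1 [a2]
            exact neg_add_cancel _
          exact (smul_eq_zero.1 this).resolve_left two_ne_zero
        rw [abs_zero, hβ, map_zero, map_zero]
      · rw [abs_of_pos hv, smul_smul, inv_mul_cancel₀ hv.ne', one_smul]
    · obtain ⟨u, v, J, hJ, hv, rfl⟩ : ∃ (u v : ℝ) (J : ℍ[ℝ]), J ∈ imagUnits ∧ 0 ≤ v ∧
          s = (u : ℍ[ℝ]) + v • J := by
        obtain ⟨J, hJ, hsJ⟩ : s ∈ qClass s := (mem_qClass_iff hI).2 ⟨rfl, rfl⟩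
        exact ⟨_, _, J, hJ, norm_nonneg _, hsJ⟩
      obtain ⟨a1, a2⟩ := h2 u v ((hσ hI u v).2 ((hσ hJ u v).1 hs))
      beta_reduce
      rw [re_slice hJ, norm_im_slice hJ, im_slice hJ, abs_of_nonneg hv, a1, a2, map_neg,
        b.leftMul_smul_right, b.leftMul_real_smul, b.leftMul_real_smul, smul_smul, smul_smul,
        rightSResolvent_apply b T hJ,
        pseudoResolvent_slice_congr T hI hJ u (v := v) (v' := v) rfl, ← sub_eq_add_neg]
      congr 2
      rcases hv.eq_or_lt with h0 | h0
      · rw [← h0, mul_zero]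
      · rw [mul_inv_cancel₀ h0.ne', one_mul]

theorem extendsResolvent_of_pair {T : H →L[ℍ[ℝ]ᵐᵒᵖ] H} {I : ℍ[ℝ]} (hI : I ∈ imagUnits) {E : Set ℂ}
    {x : H} (h : HasPairExtension T I E x) : ∃ F, ExtendsResolvent (toComplexCLM T) E x F := by
  obtain ⟨α, β, h1, h2⟩ := h
  refine ⟨fun z => α (z.re, z.im) + Complex.I • β (z.re, z.im), fun z hz => ?_, fun z hz => ?_⟩
  · refine DifferentiableAt.differentiableWithinAt ?_
    obtain ⟨-, -, a3, a4, a5, a6⟩ := h1 z.re z.im hz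
    have hp : HasFDerivAt (fun z : ℂ => (z.re, z.im)) (Complex.reCLM.prod Complex.imCLM) z :=
      (Complex.reCLM.prod Complex.imCLM).hasFDerivAt
    have hα := a3.hasFDerivAt.comp z hp
    have hβ := a4.hasFDerivAt.comp z hp
    set iL : H →L[ℝ] H := (Complex.I • ContinuousLinearMap.id ℂ H).restrictScalars ℝ with hiL
    have hF : HasFDerivAt (fun z : ℂ => α (z.re, z.im) + Complex.I • β (z.re, z.im))
        ((fderiv ℝ α (z.re, z.im)).comp (Complex.reCLM.prod Complex.imCLM) +
          iL.comp ((fderiv ℝ β (z.re, z.im)).comp (Complex.reCLM.prod Complex.imCLM))) z :=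
      hα.add (iL.hasFDerivAt.comp z hβ)
    -- D is the u-derivative of α + iβ; the Cauchy-Riemann system says that the real derivative is w
    -- ↦ wD.
    set D := fderiv ℝ α (z.re, z.im) (1, 0) + Complex.I • fderiv ℝ β (z.re, z.im) (1, 0) with hD
    refine (hasFDerivAt_of_restrictScalars ℝ hF
      (f' := ContinuousLinearMap.toSpanSingleton ℂ D) ?_).differentiableAt
    have hlin : ∀ (L : ℝ × ℝ →L[ℝ] H) (a c : ℝ), L (a, c) = a • L (1, 0) + c • L (0, 1) := by
      intro L a c
      rw [← map_smul, ← map_smul, ← map_add]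
      simp
    ext w
    have e1 : fderiv ℝ α (z.re, z.im) (0, 1) = -fderiv ℝ β (z.re, z.im) (1, 0) :=
      eq_neg_of_add_eq_zero_left a6
    have e2 : fderiv ℝ β (z.re, z.im) (0, 1) = fderiv ℝ α (z.re, z.im) (1, 0) :=
      (sub_eq_zero.1 a5).symm
    change w • D = fderiv ℝ α (z.re, z.im) (w.re, w.im) +
      Complex.I • fderiv ℝ β (z.re, z.im) (w.re, w.im)
    rw [hlin _ w.re w.im, hlin (fderiv ℝ β _) w.re w.im, e1, e2, hD]
    simp only [← rightComplex_ofReal_smul]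
    conv_lhs => rw [← Complex.re_add_im w]
    simp only [smul_add, add_smul, smul_neg, smul_smul]
    have e3 : (w.im : ℂ) * Complex.I * Complex.I = -w.im := by
      rw [mul_assoc, Complex.I_mul_I, mul_neg_one]
    rw [add_mul, e3, add_smul, neg_smul, mul_comm Complex.I (w.re : ℂ), mul_comm Complex.I (w.im : ℂ)]
    abel
  · obtain ⟨u, v⟩ := z
    have hre : ((u : ℍ[ℝ]) + v • I).re = u := re_slice hI u v
    have hn : ‖(u : ℍ[ℝ]) + v • I‖ = ‖(⟨u, v⟩ : ℂ)‖ := norm_toSlice hI ⟨u, v⟩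
    obtain ⟨a1, a2⟩ := h2 u v fun H => hz ((mem_sSpectrum_iff hre hn).1 H)
    rw [resolvent_eq_pseudoResolvent hre hn hz]
    beta_reduce
    rw [a1, a2]
    have : (starRingEnd ℂ) (⟨u, v⟩ : ℂ) = (u : ℂ) - Complex.I * (v : ℂ) := by
      apply Complex.ext <;> simp
    rw [this, sub_smul, mul_smul, rightComplex_ofReal_smul, rightComplex_ofReal_smul, smul_neg]
    abel

/-- The pair consists of the parts of F that are even and odd in v, namely α = (F(z) + F(z̄))/2 and
β = -i(F(z) - F(z̄))/2. The symmetry of `E` makes F(z̄) available. -/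
theorem pair_of_extendsResolvent {T : H →L[ℍ[ℝ]ᵐᵒᵖ] H} {I : ℍ[ℝ]} (hI : I ∈ imagUnits) {E : Set ℂ}
    (hEo : IsClosed E) (hE : ∀ z ∈ E, (starRingEnd ℂ) z ∈ E) {x : H} {F : ℂ → H}
    (hF : ExtendsResolvent (toComplexCLM T) E x F) : HasPairExtension T I E x := by
  have hE' : ∀ z ∉ E, (starRingEnd ℂ) z ∉ E := fun z hz H => hz (by simpa using hE _ H)
  set e : ℝ × ℝ →L[ℝ] ℂ := Complex.equivRealProdCLM.symm.toContinuousLinearMap with he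
  set e' : ℝ × ℝ →L[ℝ] ℂ := Complex.conjCLE.toContinuousLinearMap.comp e with he'
  have e_apply : ∀ u v : ℝ, e (u, v) = ⟨u, v⟩ := fun u v => by
    apply Complex.ext <;> simp [he]
  have e'_apply : ∀ u v : ℝ, e' (u, v) = (starRingEnd ℂ) ⟨u, v⟩ := fun u v => by
    rw [he', ContinuousLinearMap.comp_apply, e_apply]; rfl
  set iL : H →L[ℝ] H := (Complex.I • ContinuousLinearMap.id ℂ H).restrictScalars ℝ with hiL
  have iL_apply : ∀ y, iL y = Complex.I • y := fun _ => rfl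
  refine ⟨fun p => (1 / 2 : ℝ) • (F (e p) + F (e' p)),
    fun p => -((1 / 2 : ℝ) • iL (F (e p) - F (e' p))), fun u v huv => ?_, fun u v huv => ?_⟩
  · have hd : ∀ z ∉ E, HasFDerivAt F
        ((ContinuousLinearMap.toSpanSingleton ℂ (deriv F z)).restrictScalars ℝ) z := fun z hz =>
      ((hF.1.differentiableAt (hEo.isOpen_compl.mem_nhds hz)).hasDerivAt.hasFDerivAt).restrictScalars
        ℝ
    have d1 : HasFDerivAt (fun p => F (e p)) (((ContinuousLinearMap.toSpanSingleton ℂ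
        (deriv F ⟨u, v⟩)).restrictScalars ℝ).comp e) (u, v) := by
      have := hd _ huv
      rw [← e_apply] at this ⊢
      exact this.comp (u, v) e.hasFDerivAt
    have d2 : HasFDerivAt (fun p => F (e' p)) (((ContinuousLinearMap.toSpanSingleton ℂ
        (deriv F ((starRingEnd ℂ) ⟨u, v⟩))).restrictScalars ℝ).comp e') (u, v) := by
      have := hd _ (hE' _ huv)
      rw [← e'_apply] at this ⊢
      exact this.comp (u, v) e'.hasFDerivAt
    have hα := (d1.add d2).const_smul (1 / 2 : ℝ)
    have hβ := ((iL.hasFDerivAt.comp (u, v) (d1.sub d2)).const_smul (1 / 2 : ℝ)).neg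
    have hα' : fderiv ℝ (fun p => (1 / 2 : ℝ) • (F (e p) + F (e' p))) (u, v) = _ := hα.fderiv
    have hβ' : fderiv ℝ (fun p => -((1 / 2 : ℝ) • iL (F (e p) - F (e' p)))) (u, v) = _ := hβ.fderiv
    have hconj : e (u, -v) = e' (u, v) := by
      rw [e_apply, e'_apply]; apply Complex.ext <;> simp
    have hconj' : e' (u, -v) = e (u, v) := by
      rw [e_apply, e'_apply]; apply Complex.ext <;> simp
    have s1 : e (1, 0) = 1 := by rw [e_apply]; rfl
    have s2 : e (0, 1) = Complex.I := by rw [e_apply]; rfl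
    have s3 : e' (1, 0) = 1 := by rw [e'_apply]; apply Complex.ext <;> simp
    have s4 : e' (0, 1) = -Complex.I := by rw [e'_apply]; apply Complex.ext <;> simp
    refine ⟨?_, ?_, hα.differentiableAt, hβ.differentiableAt, ?_, ?_⟩
    · beta_reduce
      rw [hconj, hconj', add_comm]
    · beta_reduce
      rw [hconj, hconj', ← neg_sub (F (e (u, v))), map_neg, smul_neg]
    · rw [hα', hβ']
      simp only [smul_apply, add_apply, ContinuousLinearMap.comp_apply,
        ContinuousLinearMap.coe_restrictScalars', ContinuousLinearMap.toSpanSingleton_apply,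
        neg_apply, sub_apply, s1, s2, s3, s4, iL_apply, one_smul, smul_sub, smul_add, neg_smul,
        smul_smul, smul_neg, Complex.I_mul_I]
      abel
    · rw [hα', hβ']
      simp only [smul_apply, add_apply, ContinuousLinearMap.comp_apply,
        ContinuousLinearMap.coe_restrictScalars', ContinuousLinearMap.toSpanSingleton_apply,
        neg_apply, sub_apply, s1, s2, s3, s4, iL_apply, one_smul, smul_sub, smul_add, neg_smul,
        smul_neg]
      abel
  · have hre : ((u : ℍ[ℝ]) + v • I).re = u := re_slice hI u v
    have hn : ‖(u : ℍ[ℝ]) + v • I‖ = ‖(⟨u, v⟩ : ℂ)‖ := norm_toSlice hI ⟨u, v⟩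
    have hz : (⟨u, v⟩ : ℂ) ∉ spectrum ℂ (toComplexCLM T) := fun H =>
      huv ((mem_sSpectrum_iff hre hn).2 H)
    have r1 := resolvent_eq_pseudoResolvent hre hn hz x
    have r2 := resolvent_eq_pseudoResolvent (s := (u : ℍ[ℝ]) + v • I)
      (z := (starRingEnd ℂ) ⟨u, v⟩) hre (by rw [RCLike.norm_conj]; exact hn)
      (conj_notMem_spectrum hz) x
    set y := pseudoResolvent T ((u : ℍ[ℝ]) + v • I) x with hy
    have c1 : (starRingEnd ℂ) (⟨u, v⟩ : ℂ) • y = u • y - Complex.I • (v • y) := by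
      rw [← rightComplex_ofReal_smul, ← rightComplex_ofReal_smul, smul_smul, ← sub_smul]
      congr 1
      apply Complex.ext <;> simp
    have c2 : (⟨u, v⟩ : ℂ) • y = u • y + Complex.I • (v • y) := by
      rw [← rightComplex_ofReal_smul, ← rightComplex_ofReal_smul, smul_smul, ← add_smul]
      congr 1
      apply Complex.ext <;> simp
    rw [c1] at r1
    rw [Complex.conj_conj, c2] at r2
    have half : ∀ w : H, (1 / 2 : ℝ) • (w + w) = w := fun w => by
      rw [← two_smul ℝ w, smul_smul]; norm_num
    constructor
    · beta_reduce
      rw [e_apply, e'_apply, hF.2 _ hz, hF.2 _ (conj_notMem_spectrum hz), r1, r2]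
      rw [← half (u • y - T y)]
      congr 1
      abel
    · beta_reduce
      rw [e_apply, e'_apply, hF.2 _ hz, hF.2 _ (conj_notMem_spectrum hz), r1, r2, iL_apply]
      have : u • y - Complex.I • v • y - T y - (u • y + Complex.I • v • y - T y) =
          -(Complex.I • (v • y + v • y)) := by rw [smul_add]; abel
      rw [this, smul_neg, smul_smul, Complex.I_mul_I, neg_smul, one_smul, neg_neg, half]

end Translation

/-! ### The hyperinvariant subspace -/

section Main

variable {ι H : Type*} [NormedAddCommGroup H] [NormedSpace ℝ H] [Module ℍ[ℝ]ᵐᵒᵖ H]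
  [QInnerProductSpace H]

attribute [local instance] rightComplexNormedSpace rightComplex_isScalarTower

/-- Right multiplication by a quaternion as a bounded real linear operator. -/
noncomputable def rsmulCLM (q : ℍ[ℝ]) : H →L[ℝ] H :=
  LinearMap.mkContinuous
    { toFun := fun x => x <• q
      map_add' := fun x y => smul_add _ x y
      map_smul' := fun r x => by
        rw [RingHom.id_apply, ← QInnerProductSpace.rsmul_coe, ← QInnerProductSpace.rsmul_coe,
          smul_smul, smul_smul, ← MulOpposite.op_mul, ← MulOpposite.op_mul,
          Quaternion.coe_commutes] }
    ‖q‖ fun x => by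
      rw [mul_comm]
      exact (QInnerProductSpace.norm_rsmul x q).le

/-- The vectors whose local resolvent extends off `E`, as a right linear subspace. -/
def pairExtensionSubmodule (T : H →L[ℍ[ℝ]ᵐᵒᵖ] H) (I : ℍ[ℝ]) (E : Set ℂ) :
    Submodule ℍ[ℝ]ᵐᵒᵖ H where
  carrier := {x | HasPairExtension T I E x}
  add_mem' hx hy := hx.add hy
  zero_mem' := HasPairExtension.zero T I E
  smul_mem' a _ hx := hx.map (rsmulCLM a.unop) fun y => (T.map_smul a y).symm

theorem isHyperinvariant_pairExtensionSubmodule (T : H →L[ℍ[ℝ]ᵐᵒᵖ] H) (I : ℍ[ℝ]) (E : Set ℂ) :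
    IsHyperinvariant T (pairExtensionSubmodule T I E) := fun B hB _ hx =>
  hx.map (B.restrictScalars ℝ) fun y => DFunLike.congr_fun hB y

variable [CompleteSpace H]

theorem toSlice_mem_sSpectrum_iff {T : H →L[ℍ[ℝ]ᵐᵒᵖ] H} {I : ℍ[ℝ]} (hI : I ∈ imagUnits) {z : ℂ} :
    toSlice I z ∈ sSpectrum T ↔ z ∈ spectrum ℂ (toComplexCLM T) :=
  mem_sSpectrum_iff (re_toSlice hI z) (norm_toSlice hI z)

/-- The spectrum of the complex operator in the disk of an exposed arc. -/
theorem IsExposedArc.exists_ball_inter_spectrum {T : H →L[ℍ[ℝ]ᵐᵒᵖ] H} {I : ℍ[ℝ]}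
    (hI : I ∈ imagUnits) {γ : ℝ → ℂ} (hγ : IsExposedArc (sSpectrum T) I γ) :
    ∃ (c : ℂ) (r : ℝ), ball c r ∩ spectrum ℂ (toComplexCLM T) = γ '' Ioo 0 1 := by
  obtain ⟨c, r, -, h⟩ := hγ.exists_disk
  refine ⟨c, r, ?_⟩
  apply (toSlice_injective hI).image_injective
  rw [← h]
  ext p
  constructor
  · rintro ⟨z, ⟨hz1, hz2⟩, rfl⟩
    exact ⟨⟨z, hz1, rfl⟩, (toSlice_mem_sSpectrum_iff hI).2 hz2⟩
  · rintro ⟨⟨z, hz1, rfl⟩, hz2⟩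
    exact ⟨z, ⟨hz1, (toSlice_mem_sSpectrum_iff hI).1 hz2⟩, rfl⟩

/-- The growth condition on the left `S`-resolvent implies the growth condition on the complex
resolvent. -/
theorem transversalGrowth_of_leftSResolvent (b : QHilbertBasis ι H) {T : H →L[ℍ[ℝ]ᵐᵒᵖ] H}
    {I : ℍ[ℝ]} (hI : I ∈ imagUnits) {γ : ℝ → ℂ} {k : ℕ}
    (hgrowth : ∀ t ∈ Ioo (0 : ℝ) 1, ∀ a c : ℂ, γ t ∈ segment ℝ a c →
      (¬ ∃ r : ℝ, c - a = r • deriv γ t) →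
      axialCompletion (toSlice I '' segment ℝ a c) ∩ sSpectrum T = qClass (toSlice I (γ t)) →
      ∃ K : ℝ, 0 < K ∧ ∀ s ∈ axialCompletion (toSlice I '' segment ℝ a c) \ qClass (toSlice I (γ t)),
        rightOpNorm (leftSResolvent b T s) ≤
          Real.exp (K * (classDist s (toSlice I (γ t)) ^ k)⁻¹)) :
    TransversalGrowth (toComplexCLM T) γ k := by
  intro t ht a c hmem htrans hσ hside
  have htσ : γ t ∈ spectrum ℂ (toComplexCLM T) := by
    have : γ t ∈ segment ℝ a c ∩ spectrum ℂ (toComplexCLM T) := hσ ▸ mem_singleton _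
    exact this.2
  obtain ⟨K, hK0, hK⟩ := hgrowth t ht a c hmem htrans (by
    ext p
    rw [mem_inter_iff, mem_axialCompletion_iff hI, mem_qClass_iff hI, re_toSlice hI,
      norm_im_toSlice hI]
    constructor
    · rintro ⟨⟨z, hz, h1, h2⟩, hp⟩
      have hzσ := (mem_sSpectrum_iff h1 (norm_eq_norm_of_class h1 h2)).1 hp
      have : z ∈ segment ℝ a c ∩ spectrum ℂ (toComplexCLM T) := ⟨hz, hzσ⟩
      rw [hσ, mem_singleton_iff] at this
      rw [← this]
      exact ⟨h1, h2⟩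
    · rintro ⟨h1, h2⟩
      exact ⟨⟨γ t, hmem, h1, h2⟩, (mem_sSpectrum_iff h1 (norm_eq_norm_of_class h1 h2)).2 htσ⟩)
  refine ⟨K, hK0.le, fun z hz hne => ?_⟩
  have hzσ : z ∉ spectrum ℂ (toComplexCLM T) := fun H => by
    have : z ∈ segment ℝ a c ∩ spectrum ℂ (toComplexCLM T) := ⟨hz, H⟩
    rw [hσ] at this
    exact hne this
  refine norm_resolvent_le_of_leftSResolvent b hI hzσ fun s hs => ?_
  have hs' := hs
  rw [mem_qClass_iff hI] at hs'
  have hnot : s ∉ qClass (toSlice I (γ t)) := by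
    intro H
    rw [mem_qClass_iff hI, hs'.1, hs'.2] at H
    exact hne (eq_of_mem_qClass hI (hside z hz) ((mem_qClass_iff hI).2 H))
  refine (hK s ⟨(mem_axialCompletion_iff hI).2 ⟨z, hz, ?_⟩, hnot⟩).trans ?_
  · rw [hs'.1, hs'.2]
    exact ⟨re_toSlice hI z, norm_im_toSlice hI z⟩
  · have h1 := norm_sub_le_classDist hI hs (hside z hz)
    have h2 : 0 < ‖z - γ t‖ := norm_pos_iff.2 (sub_ne_zero.2 hne)
    gcongr

theorem conjSubarc_subset_spectrum {T : H →L[ℍ[ℝ]ᵐᵒᵖ] H} {γ : ℝ → ℂ} {t₁ t₂ : ℝ}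
    (h : ∀ t ∈ Icc t₁ t₂, γ t ∈ spectrum ℂ (toComplexCLM T)) :
    conjSubarc γ t₁ t₂ ⊆ spectrum ℂ (toComplexCLM T) := by
  rintro z (⟨t, ht, rfl⟩ | ⟨_, ⟨t, ht, rfl⟩, rfl⟩)
  · exact h t ht
  · exact conj_mem_spectrum (h t ht)

/-- Right linearity and hyperinvariance are read off from the pairs (α, β), closedness and
nontriviality from the holomorphic extensions F. -/
theorem exists_hyperinvariant_subspace (b : QHilbertBasis ι H)
    (T : H →L[ℍ[ℝ]ᵐᵒᵖ] H) (I : ℍ[ℝ]) (hI : I ∈ imagUnits) (γ : ℝ → ℂ)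
    (hγ : IsExposedArc (sSpectrum T) I γ) (k : ℕ)
    (hgrowth : TransversalGrowth (toComplexCLM T) γ k) :
    ∃ M : Submodule ℍ[ℝ]ᵐᵒᵖ H, IsClosed (M : Set H) ∧ M ≠ ⊥ ∧ M ≠ ⊤ ∧ IsHyperinvariant T M ∧
      ∃ t₁ t₂ : ℝ, 0 < t₁ ∧ t₁ < t₂ ∧ t₂ < 1 ∧
        ∀ x : H, x ∈ M ↔ ∃ f : ℍ[ℝ] → H,
          IsLeftSliceHyperholomorphicOn b f
            (axialCompletion (toSlice I '' (γ '' Icc t₁ t₂)))ᶜ ∧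
          ∀ s ∉ sSpectrum T, f s = rightSResolvent b T s x := by
  obtain ⟨c, r, hball⟩ := hγ.exists_ball_inter_spectrum hI
  obtain ⟨t₁, t₂, h1, h12, h2, hclosed, ⟨x₀, hx₀, F₀, hF₀⟩, ⟨x₁, hx₁⟩⟩ :=
    exists_subarc hγ.isSmoothJordanArc hball (fun _ hz => conj_mem_spectrum hz)
      (norm_resolvent_conj_le T) hgrowth
  have hsub : Icc t₁ t₂ ⊆ Ioo 0 1 := fun t ht => ⟨h1.trans_le ht.1, ht.2.trans_lt h2⟩
  have hEσ := conjSubarc_subset_spectrum (T := T) (γ := γ) (t₁ := t₁) (t₂ := t₂) fun t ht => by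
    have : γ t ∈ ball c r ∩ spectrum ℂ (toComplexCLM T) := hball ▸ mem_image_of_mem γ (hsub ht)
    exact this.2
  have hEc : IsClosed (conjSubarc γ t₁ t₂) :=
    isClosed_conjSubarc (hγ.isSmoothJordanArc.continuousOn.mono hsub)
  have hiff : ∀ x : H, HasPairExtension T I (conjSubarc γ t₁ t₂) x ↔
      ∃ F, ExtendsResolvent (toComplexCLM T) (conjSubarc γ t₁ t₂) x F := fun x =>
    ⟨extendsResolvent_of_pair hI, fun ⟨_, hF⟩ =>
      pair_of_extendsResolvent hI hEc (fun _ hz => conj_mem_conjSubarc hz) hF⟩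
  refine ⟨pairExtensionSubmodule T I (conjSubarc γ t₁ t₂), ?_, ?_, ?_,
    isHyperinvariant_pairExtensionSubmodule T I _, t₁, t₂, h1, h12, h2, fun x =>
      (exists_slice_extension_iff b hI hEσ x).symm⟩
  · convert hclosed using 1
    ext x
    exact hiff x
  · intro H
    have : x₀ ∈ pairExtensionSubmodule T I (conjSubarc γ t₁ t₂) := (hiff x₀).2 ⟨F₀, hF₀⟩
    rw [H, Submodule.mem_bot] at this
    exact hx₀ this
  · intro H
    have : x₁ ∈ pairExtensionSubmodule T I (conjSubarc γ t₁ t₂) := by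
      rw [H]; exact Submodule.mem_top
    exact hx₁ ((hiff x₁).1 this)

end Main

theorem theorem5p1 {ι H : Type*} [NormedAddCommGroup H] [NormedSpace ℝ H] [Module ℍ[ℝ]ᵐᵒᵖ H]
    [QInnerProductSpace H] [CompleteSpace H] (b : QHilbertBasis ι H)
    (T : H →L[ℍ[ℝ]ᵐᵒᵖ] H) (I : ℍ[ℝ]) (hI : I ∈ imagUnits) (γ : ℝ → ℂ)
    (hγ : IsExposedArc (sSpectrum T) I γ) (k : ℕ)
    (hgrowth : ∀ t ∈ Ioo (0 : ℝ) 1, ∀ a c : ℂ, γ t ∈ segment ℝ a c →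
      (¬ ∃ r : ℝ, c - a = r • deriv γ t) →
      axialCompletion (toSlice I '' segment ℝ a c) ∩ sSpectrum T = qClass (toSlice I (γ t)) →
      ∃ K : ℝ, 0 < K ∧ ∀ s ∈ axialCompletion (toSlice I '' segment ℝ a c) \ qClass (toSlice I (γ t)),
        rightOpNorm (leftSResolvent b T s) ≤
          Real.exp (K * (classDist s (toSlice I (γ t)) ^ k)⁻¹)) :
    ∃ M : Submodule ℍ[ℝ]ᵐᵒᵖ H, IsClosed (M : Set H) ∧ M ≠ ⊥ ∧ M ≠ ⊤ ∧ IsHyperinvariant T M ∧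
      ∃ t₁ t₂ : ℝ, 0 < t₁ ∧ t₁ < t₂ ∧ t₂ < 1 ∧
        ∀ x : H, x ∈ M ↔ ∃ f : ℍ[ℝ] → H,
          IsLeftSliceHyperholomorphicOn b f
            (axialCompletion (toSlice I '' (γ '' Icc t₁ t₂)))ᶜ ∧
          ∀ s ∉ sSpectrum T, f s = rightSResolvent b T s x := by
  exact exists_hyperinvariant_subspace b T I hI γ hγ k
    (transversalGrowth_of_leftSResolvent b hI hgrowth)
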